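/- **Theorem (motion of two vortices, Types I/II/III).** Consider the Möbius band $M=\mathbb{C}/\langle\tau\rangle$, $\tau(x,y)=(x+\pi,-y)$, where $z=x+iy$. Two point vortices with lifts $z_k=x_k+iy_k$ and strengths $\Gamma_1,\Gamma_2$ move according to $\Gamma_k\dot x_k=\partial\mathcal H/\partial y_k$, $\Gamma_k\dot y_k=-\partial\mathcal H/\partial x_k$, where $$\mathcal H=-\tfrac{\Gamma_1\Gamma_2}{4\pi}\log\frac{\sin^2\frac{x_1-x_2}{2}+\sinh^2\frac{y_1-y_2}{2}}{\cos^2\frac{x_1-x_2}{2}+\sinh^2\frac{y_1+y_2}{2}}+\tfrac{\Gamma_1^2}{4\pi}\log\cosh y_1+\tfrac{\Gamma_2^2}{4\pi}\log\cosh y_2 ,$$ and $\Gamma_1y_1+\Gamma_2y_2=C$ is conserved. Substituting $y_2=(C-\Gamma_1y_1)/\Gamma_2$ gives the reduced Hamiltonian, a function of $(u,y_1)$, $u=x_1-x_2$, singular exactly at the collision points $\big(2k\pi,\frac{C}{\Gamma_1+\Gamma_2}\big)$ and $\big((2k+1)\pi,\frac{C}{\Gamma_1-\Gamma_2}\big)$,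 $k\in\mathbb Z$. Call $(\Gamma_1,\Gamma_2,C)$ *admissible* if $\Gamma_1>\Gamma_2>0$, $C\neq0$, and the reduced Hamiltonian has the least possible number of critical points: exactly two on the line $u=0$ and none on the line $u=\pi$. A *trajectory* is a connected component, in the $(u,y_1)$-plane without the collision points, of a level set of the reduced Hamiltonian; only trajectories containing no critical point are considered (so equilibria and separatrices are excluded). It is of *Type I* (resp. *Type II*) if it is a closed curve going around a point $\big(2k\pi,\frac{C}{\Gamma_1+\Gamma_2}\big)$ (resp. $\big((2k+1)\pi,\frac{C}{\Gamma_1-\Gamma_2}\big)$), and of *Type III* otherwise. Let $(\Gamma_1,\Gamma_2,C)$ be admissible. Every configuration of momentum $C$ whose reduced coordinates $(u,y_1)$ lie on a trajectory of Type I, II or III is the initial configuration of a collision-free motion defined for all time, and for such motions the following holds. 1. *Types I and II.* There are $T>0$, $d\in\mathbb R$ and $n\in\mathbb Z$, with $n$ even for Type I and odd for Type II, such that during every time interval of length $T$ the argument of $z_1-\tau^n z_2$ changes by exactly $2\pi$, or during every such interval by exactly $-2\pi$, and both lifts are displaced by the same horizontal amount: $z_k(t+T)=z_k(t)+d$ for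 all $t$ and $k=1,2$. Thus the vortices rotate about each other while drifting as a pair. The set of points $(u,y_1)$ on trajectories of Types I and II for which the motion on $M$ is periodic, or for which the drift $d$ is zero, has planar Lebesgue measure $0$. 2. *Type III.* There is $T>0$ such that $y_1$ and $y_2$ are $T$-periodic and either $u(t+T)=u(t)+2\pi$ for all $t$ or $u(t+T)=u(t)-2\pi$ for all $t$; the vertical separation $y_1-y_2$ is not constant; and the vortices do not rotate about each other: for every $n\in\mathbb Z$, any two values of a continuous argument of $z_1-\tau^nz_2$ along the motion differ by less than $2\pi$. 3. *Directions in Type III.* Say that the vortices move in the same (opposite) directions if, over a period $T$ as in 2, the displacements $x_1(t+T)-x_1(t)$ and $x_2(t+T)-x_2(t)$ have the same sign (opposite signs) and are nonzero. If $\Gamma_1<2\Gamma_2$ (resp. $\Gamma_1>2\Gamma_2$), there is $R$ such that on every Type III motion with $|y_1(0)|>R$ the vortices move in the same direction (resp. in opposite directions). Both cases occur: there are admissible parameters and a Type III motion with the vortices moving in the same direction, and there are admissible parameters and a Type III motion with the vortices moving in opposite directions. -/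

import Mathlib

noncomputable section

namespace MobiusVortex

/-- The `n`-th power of the Möbius flip `τ(x, y) = (x + π, -y)`, acting on the universal cover `ℂ`
of the Möbius band, `z = x + i y`. -/
def mobiusFlip (n : ℤ) (z : ℂ) : ℂ := ⟨z.re + n * Real.pi, (-1 : ℝ) ^ n * z.im⟩

theorem mobiusFlip_zero (z : ℂ) : mobiusFlip 0 z = z := by
  apply Complex.ext <;> simp [mobiusFlip]

theorem mobiusFlip_mobiusFlip (m n : ℤ) (z : ℂ) : mobiusFlip m (mobiusFlip n z) = mobiusFlip (m + n) z := by
  apply Complex.ext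
  · simp only [mobiusFlip, Int.cast_add]; ring
  · have h : (-1 : ℝ) ≠ 0 := by norm_num
    simp only [mobiusFlip, zpow_add₀ h]; ring

/-- Two points of the plane are equivalent if a power of the Möbius flip maps one to the other. -/
def bandSetoid : Setoid ℂ where
  r z w := ∃ n : ℤ, w = mobiusFlip n z
  iseqv :=
    { refl := fun z => ⟨0, (mobiusFlip_zero z).symm⟩
      symm := by
        rintro z w ⟨n, rfl⟩
        exact ⟨-n, by rw [mobiusFlip_mobiusFlip, neg_add_cancel, mobiusFlip_zero]⟩
      trans := by
        rintro z w v ⟨n, rfl⟩ ⟨m, rfl⟩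
        exact ⟨m + n, mobiusFlip_mobiusFlip m n z⟩ }

/-- The (infinitely high) Möbius band of width `π`. -/
def MobiusBand : Type := Quotient bandSetoid

/-- The covering projection of the plane onto the Möbius band. -/
def toBand (z : ℂ) : MobiusBand := Quotient.mk bandSetoid z

/-- `sin² ((x₁ - x₂)/2) + sinh² ((y₁ - y₂)/2)`; it vanishes iff `z₂` is an even power of
the flip applied to `z₁`. -/
def gapEven (z : ℂ × ℂ) : ℝ :=
  Real.sin ((z.1.re - z.2.re) / 2) ^ 2 + Real.sinh ((z.1.im - z.2.im) / 2) ^ 2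

/-- `cos² ((x₁ - x₂)/2) + sinh² ((y₁ + y₂)/2)`; it vanishes iff `z₂` is an odd power of
the flip applied to `z₁`. -/
def gapOdd (z : ℂ × ℂ) : ℝ :=
  Real.cos ((z.1.re - z.2.re) / 2) ^ 2 + Real.sinh ((z.1.im + z.2.im) / 2) ^ 2

/-- The two vortices are at different points of the Möbius band. -/
def NoCollision (z : ℂ × ℂ) : Prop := gapEven z ≠ 0 ∧ gapOdd z ≠ 0

/-- The Hamiltonian of two vortices of strengths `Γ₁`, `Γ₂` on the Möbius band. -/
def hamiltonian (Γ₁ Γ₂ : ℝ) (z : ℂ × ℂ) : ℝ :=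
  -(1 / (4 * Real.pi)) * (Γ₁ * Γ₂ * Real.log (gapEven z))
    + 1 / (4 * Real.pi) * (Γ₁ * Γ₂ * Real.log (gapOdd z))
    + 1 / (8 * Real.pi) * (Γ₁ ^ 2 * Real.log (1 + Real.sinh z.1.im ^ 2)
        + Γ₂ ^ 2 * Real.log (1 + Real.sinh z.2.im ^ 2))

/-- The momentum map. -/
def momentum (Γ₁ Γ₂ : ℝ) (z : ℂ × ℂ) : ℝ := Γ₁ * z.1.im + Γ₂ * z.2.im

/-- The right-hand side `(ẋ₁ + i ẏ₁, ẋ₂ + i ẏ₂)` of the equations of motion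
`Γₖ ẋₖ = ∂H/∂yₖ`, `Γₖ ẏₖ = -∂H/∂xₖ`. -/
def velocity (Γ₁ Γ₂ : ℝ) (z : ℂ × ℂ) : ℂ × ℂ :=
  (⟨-(1 / (8 * Real.pi)) * (Γ₂ * (Real.sinh (z.1.im - z.2.im) / gapEven z)
        - Γ₂ * (Real.sinh (z.1.im + z.2.im) / gapOdd z) - 2 * Γ₁ * Real.tanh z.1.im),
    Γ₂ * Real.sin (z.1.re - z.2.re) / (8 * Real.pi) * (1 / gapEven z + 1 / gapOdd z)⟩,
   ⟨-(1 / (8 * Real.pi)) * (Γ₁ * (Real.sinh (z.2.im - z.1.im) / gapEven z)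
        - Γ₁ * (Real.sinh (z.2.im + z.1.im) / gapOdd z) - 2 * Γ₂ * Real.tanh z.2.im),
    Γ₁ * Real.sin (z.2.re - z.1.re) / (8 * Real.pi) * (1 / gapEven z + 1 / gapOdd z)⟩)

/-- `s` is a motion, defined for all time, of two vortices that never collide (lifted to the
plane). -/
def IsMotion (Γ₁ Γ₂ : ℝ) (s : ℝ → ℂ × ℂ) : Prop :=
  ∀ t, NoCollision (s t) ∧ HasDerivAt s (velocity Γ₁ Γ₂ (s t)) t

/-! ### The reduced system, in the coordinates `(x₁ - x₂, y₁)` -/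

/-- The reduced coordinates `(x₁ - x₂, y₁)` of a configuration. -/
def reduce (z : ℂ × ℂ) : ℝ × ℝ := (z.1.re - z.2.re, z.1.im)

/-- A configuration of momentum `C` with given reduced coordinates (and `x₂ = 0`). -/
def expand (Γ₁ Γ₂ C : ℝ) (p : ℝ × ℝ) : ℂ × ℂ := (⟨p.1, p.2⟩, ⟨0, (C - Γ₁ * p.2) / Γ₂⟩)

/-- The reduced phase space: the plane without the collision points. -/
def reducedDomain (Γ₁ Γ₂ C : ℝ) : Set (ℝ × ℝ) := {p | NoCollision (expand Γ₁ Γ₂ C p)}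

/-- The reduced Hamiltonian at momentum `C`. -/
def reducedHamiltonian (Γ₁ Γ₂ C : ℝ) (p : ℝ × ℝ) : ℝ := hamiltonian Γ₁ Γ₂ (expand Γ₁ Γ₂ C p)

/-- Critical points of the reduced Hamiltonian. -/
def IsCritical (Γ₁ Γ₂ C : ℝ) (p : ℝ × ℝ) : Prop :=
  p ∈ reducedDomain Γ₁ Γ₂ C ∧ fderiv ℝ (reducedHamiltonian Γ₁ Γ₂ C) p = 0

/-- `Γ₁ > Γ₂ > 0`, `C ≠ 0`, and the reduced Hamiltonian has the least number of critical points: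
two on the line `x₁ - x₂ = 0` and none on the line `x₁ - x₂ = π` (by the symmetries
`u ↦ -u` and `u ↦ u + 2π` this covers all the lines `x₁ - x₂ ∈ ℤπ`). -/
structure Admissible (Γ₁ Γ₂ C : ℝ) : Prop where
  pos : 0 < Γ₂
  lt : Γ₂ < Γ₁
  ne_zero : C ≠ 0
  two_on_zero : {y : ℝ | IsCritical Γ₁ Γ₂ C (0, y)}.ncard = 2
  none_on_pi : {y : ℝ | IsCritical Γ₁ Γ₂ C (Real.pi, y)} = ∅

/-- The level curve of the reduced Hamiltonian through `p`: the connected component of `p` in its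
level set. -/
def levelCurve (Γ₁ Γ₂ C : ℝ) (p : ℝ × ℝ) : Set (ℝ × ℝ) :=
  connectedComponentIn
    {q | q ∈ reducedDomain Γ₁ Γ₂ C ∧ reducedHamiltonian Γ₁ Γ₂ C q = reducedHamiltonian Γ₁ Γ₂ C p} p

/-- The level curve through `p` is a regular one: it contains no critical point (so that it is
neither an equilibrium nor a separatrix). -/
def IsRegular (Γ₁ Γ₂ C : ℝ) (p : ℝ × ℝ) : Prop :=
  p ∈ reducedDomain Γ₁ Γ₂ C ∧ ∀ q ∈ levelCurve Γ₁ Γ₂ C p, ¬ IsCritical Γ₁ Γ₂ C q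

/-- The level curve through `p` is a closed trajectory going around the point `c`. -/
def GoesAround (Γ₁ Γ₂ C : ℝ) (p c : ℝ × ℝ) : Prop :=
  IsRegular Γ₁ Γ₂ C p ∧ IsCompact (levelCurve Γ₁ Γ₂ C p) ∧ c ∉ levelCurve Γ₁ Γ₂ C p ∧
    Bornology.IsBounded (connectedComponentIn (levelCurve Γ₁ Γ₂ C p)ᶜ c)

/-- Type I: closed trajectories around a point `(2kπ, C/(Γ₁ + Γ₂))`. Region I consists of these. -/
def IsTypeI (Γ₁ Γ₂ C : ℝ) (p : ℝ × ℝ) : Prop :=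
  ∃ k : ℤ, GoesAround Γ₁ Γ₂ C p (2 * k * Real.pi, C / (Γ₁ + Γ₂))

/-- Type II: closed trajectories around a point `((2k+1)π, C/(Γ₁ - Γ₂))`. Region II consists of
these. -/
def IsTypeII (Γ₁ Γ₂ C : ℝ) (p : ℝ × ℝ) : Prop :=
  ∃ k : ℤ, GoesAround Γ₁ Γ₂ C p ((2 * k + 1) * Real.pi, C / (Γ₁ - Γ₂))

/-- Type III: all the other trajectories. -/
def IsTypeIII (Γ₁ Γ₂ C : ℝ) (p : ℝ × ℝ) : Prop :=
  IsRegular Γ₁ Γ₂ C p ∧ ¬ IsTypeI Γ₁ Γ₂ C p ∧ ¬ IsTypeII Γ₁ Γ₂ C p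

/-! ### Description of the motion -/

/-- The vector from the `n`-th lift of the second vortex to the first vortex. -/
def separation (s : ℝ → ℂ × ℂ) (n : ℤ) (t : ℝ) : ℂ := (s t).1 - mobiusFlip n (s t).2

/-- `θ` is a continuous choice of the argument of `w`. -/
def IsAngle (w : ℝ → ℂ) (θ : ℝ → ℝ) : Prop :=
  Continuous θ ∧ ∀ t, w t = ‖w t‖ * Complex.exp (θ t * Complex.I)

/-- In every time interval of length `T`, the first vortex makes one net full turn about the
`n`-th lift of the second one, and both vortices are displaced horizontally by the same `d`, so
that their relative position recurs. -/
def TurnsAsPair (s : ℝ → ℂ × ℂ) (n : ℤ) (T d : ℝ) : Prop :=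
  0 < T ∧ (∀ t, (s (t + T)).1 = (s t).1 + d ∧ (s (t + T)).2 = (s t).2 + d) ∧
    ∃ θ : ℝ → ℝ, IsAngle (separation s n) θ ∧
      ((∀ t, θ (t + T) = θ t + 2 * Real.pi) ∨ ∀ t, θ (t + T) = θ t - 2 * Real.pi)

/-- The motion on the Möbius band is periodic. -/
def IsPeriodicOnBand (s : ℝ → ℂ × ℂ) : Prop :=
  ∃ P : ℝ, 0 < P ∧ ∀ t, toBand (s (t + P)).1 = toBand (s t).1 ∧
    toBand (s (t + P)).2 = toBand (s t).2

/-- The vortices never make a full turn about each other, whichever lift of the second one is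
considered. -/
def NeverTurns (s : ℝ → ℂ × ℂ) : Prop :=
  ∀ (n : ℤ) (θ : ℝ → ℝ), IsAngle (separation s n) θ → ∀ t t', |θ t - θ t'| < 2 * Real.pi

/-- After time `T` the heights of the vortices recur, and their horizontal separation recurs for
the first time modulo `2π`, having changed by exactly `2π` or `-2π`. -/
def IsSeparationPeriod (s : ℝ → ℂ × ℂ) (T : ℝ) : Prop :=
  0 < T ∧ (∀ t, (s (t + T)).1.im = (s t).1.im ∧ (s (t + T)).2.im = (s t).2.im) ∧
    ((∀ t, (s (t + T)).1.re - (s (t + T)).2.re = (s t).1.re - (s t).2.re + 2 * Real.pi) ∨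
      ∀ t, (s (t + T)).1.re - (s (t + T)).2.re = (s t).1.re - (s t).2.re - 2 * Real.pi)

/-- Over a period of the separation the vortices are displaced in the same direction. -/
def MoveSameDirection (s : ℝ → ℂ × ℂ) : Prop :=
  ∃ T, IsSeparationPeriod s T ∧
    ∀ t, 0 < ((s (t + T)).1.re - (s t).1.re) * ((s (t + T)).2.re - (s t).2.re)

/-- Over a period of the separation the vortices are displaced in opposite directions. -/
def MoveOppositeDirections (s : ℝ → ℂ × ℂ) : Prop :=
  ∃ T, IsSeparationPeriod s T ∧
    ∀ t, ((s (t + T)).1.re - (s t).1.re) * ((s (t + T)).2.re - (s t).2.re) < 0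

end MobiusVortex

end

open MobiusVortex

noncomputable section

namespace MobiusVortex

open Real Set Filter Topology

/-! Conservation of momentum leaves the two unknowns `(u, y₁)`. Each gap is half of a hyperbolic
cosine of a function of `y₁`, plus or minus `cos u`, and the self-interaction depends on `y₁` alone.
Hence a level set of the reduced Hamiltonian is a curve `cos u = W y`, where `W` is `levelCos` with
parameter `e = exp (-4πh / (Γ₁ Γ₂))` (`levelSet_eq`). On it the motion is `u' = -W'(y) G(y)`, `y' =
sin u · G(y)` with `G > 0`, and both horizontal velocities are functions of `y` only
(`velocity_eq`).

A component without critical points lies over a window `[α, β]`: `|W| < 1` inside, `|W| = 1` and `W'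
≠ 0` at the ends (`exists_isWindow`). If `W = 1` at both ends the component is a closed curve around
a segment of a line `u = 2jπ`; if `W = -1` at both ends, of a line `u = (2j+1)π`; if the values are
opposite it is unbounded. The signs of `critEven` and `critOdd` show that such a segment contains
the collision point, so these three cases are Types I, II and III (`window_cases`).

The equations are invariant under reversing time while reflecting `u` in a multiple of `π`. A
trajectory reaches the walls `u ∈ πℤ` in finite time, exactly at the ends of the window, and the
reflections at two consecutive wall times compose to a period translation (`IsFlow.period`). For
Types I and II the two walls agree, and the half period and its mirror image make one full turn
(`IsAngle.full_turn`). For Type III they differ, and the separation meets the vertical axis through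
a given lift at one point only, so its argument omits a direction (`neverTurns`).

If a Type I or II motion is periodic on the band or driftless, its horizontal displacement in a half
period is a rational multiple of `π`. As a function of the amplitude `ε` (with `ε² = e` or `ε² =
1/e`) this displacement is `ε² D(ε)`, with `D` analytic on an interval containing `0` and `D(0) ≠ 0`
because `C ≠ 0`. Each value is therefore taken for countably many `ε`, and countably many level
curves form a null set.

Far from the core circle the horizontal velocities, multiplied by the sign of `y₁`, approach `(Γ₁ -
2Γ₂)/(4π)` and `-Γ₂/(4π)`, and motions that start far out stay far out; this decides the directions.
The examples are `(5, 3, 1)` and `(3, 1, 1)`. -/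

/-! ### The curves `cos u = W y` -/

/-- The curve `cos u = W y` in the `(u, y)`-plane. -/
def cosCurve (W : ℝ → ℝ) : Set (ℝ × ℝ) := {q | cos q.1 = W q.2}

/-- `[α, β]` is an interval on which `|W| ≤ 1`, with equality exactly at the ends, where `W` is not
stationary. -/
structure IsWindow (W : ℝ → ℝ) (α β : ℝ) : Prop where
  lt : α < β
  inside : ∀ y ∈ Ioo α β, |W y| < 1
  left : |W α| = 1
  right : |W β| = 1
  deriv_left : deriv W α ≠ 0
  deriv_right : deriv W β ≠ 0

theorem isClosed_cosCurve {W : ℝ → ℝ} (hW : Continuous W) : IsClosed (cosCurve W) :=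
  isClosed_eq (by fun_prop) (by fun_prop)

theorem IsWindow.abs_le {W : ℝ → ℝ} {α β : ℝ} (h : IsWindow W α β) {y : ℝ} (hy : y ∈ Icc α β) :
    |W y| ≤ 1 := by
  rcases hy.1.eq_or_lt with rfl | h1
  · exact h.left.le
  rcases hy.2.eq_or_lt with rfl | h2
  · exact h.right.le
  exact (h.inside y ⟨h1, h2⟩).le

theorem exists_int_mul_pi_le (u : ℝ) : ∃ k : ℤ, k * π ≤ u ∧ u < (k + 1) * π := by
  refine ⟨⌊u / π⌋, ?_, ?_⟩
  · have := Int.floor_le (u / π)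
    rwa [le_div_iff₀ pi_pos] at this
  · have := Int.lt_floor_add_one (u / π)
    rwa [div_lt_iff₀ pi_pos] at this

theorem neg_one_zpow_mul_self (k : ℤ) : (-1 : ℝ) ^ k * (-1) ^ k = 1 := by
  rcases Int.even_or_odd k with h | h
  · simp [h.neg_one_zpow]
  · simp [h.neg_one_zpow]

theorem abs_neg_one_zpow_mul (k : ℤ) (x : ℝ) : |(-1 : ℝ) ^ k * x| = |x| := by
  simp [abs_mul, abs_zpow]

/-- In the strip `kπ ≤ u ≤ (k+1)π` the curve `cos u = w` is a graph. -/
theorem eq_add_arccos {k : ℤ} {u w : ℝ} (h1 : k * π ≤ u) (h2 : u ≤ (k + 1) * π) (h : cos u = w) :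
    u = k * π + arccos ((-1) ^ k * w) := by
  have hx : cos u = (-1) ^ k * cos (u - k * π) := by
    rw [← cos_add_int_mul_pi]; ring_nf
  have : (-1 : ℝ) ^ k * w = cos (u - k * π) := by
    rw [← h, hx, ← mul_assoc, neg_one_zpow_mul_self, one_mul]
  rw [this, arccos_cos (by linarith) (by linarith)]; ring

theorem cos_add_arccos (k : ℤ) {w : ℝ} (hw : |w| ≤ 1) :
    cos (k * π + arccos ((-1) ^ k * w)) = w := by
  have h : |(-1 : ℝ) ^ k * w| ≤ 1 := by rwa [abs_neg_one_zpow_mul]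
  rw [add_comm, cos_add_int_mul_pi, cos_arccos (abs_le.1 h).1 (abs_le.1 h).2, ← mul_assoc,
    neg_one_zpow_mul_self, one_mul]

/-- A graph piece of the curve lies in one component. -/
theorem arc_mem_component {W : ℝ → ℝ} (hW : Continuous W) {p : ℝ × ℝ} (hp : p ∈ cosCurve W)
    {I : Set ℝ} (hI : IsPreconnected I) (hpI : p.2 ∈ I) (hWI : ∀ y ∈ I, |W y| ≤ 1) {k : ℤ}
    (h1 : k * π ≤ p.1) (h2 : p.1 ≤ (k + 1) * π) {y : ℝ} (hy : y ∈ I) :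
    (k * π + arccos ((-1) ^ k * W y), y) ∈ connectedComponentIn (cosCurve W) p := by
  have hc : Continuous fun y => ((k * π + arccos ((-1) ^ k * W y), y) : ℝ × ℝ) := by
    have := continuous_arccos.comp (continuous_const.mul hW : Continuous fun y => (-1 : ℝ) ^ k * W y)
    exact (continuous_const.add this).prodMk continuous_id
  have h := (hI.image _ hc.continuousOn).subset_connectedComponentIn (F := cosCurve W) (x := p)
    ⟨p.2, hpI, by
      have := eq_add_arccos h1 h2 hp
      exact Prod.ext this.symm rfl⟩
    (by rintro _ ⟨z, hz, rfl⟩; exact cos_add_arccos k (hWI z hz))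
  exact h ⟨y, hy, rfl⟩

theorem isClosed_connectedComponentIn {X : Type*} [TopologicalSpace X] {F : Set X} (hF : IsClosed F)
    {x : X} (hx : x ∈ F) : IsClosed (connectedComponentIn F x) :=
  isClosed_of_closure_subset (isPreconnected_connectedComponentIn.closure.subset_connectedComponentIn
    (subset_closure (mem_connectedComponentIn hx))
    (closure_minimal (connectedComponentIn_subset _ _) hF))

/-- A component of the curve without stationary points lives over a window. -/
theorem exists_isWindow {W : ℝ → ℝ} (hW : Differentiable ℝ W) {R : ℝ}
    (hR : ∀ y, |W y| ≤ 1 → |y| ≤ R) {p : ℝ × ℝ} (hp : p ∈ cosCurve W)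
    (hreg : ∀ q ∈ connectedComponentIn (cosCurve W) p, sin q.1 = 0 → deriv W q.2 ≠ 0) :
    ∃ α β, IsWindow W α β ∧ ∀ q ∈ connectedComponentIn (cosCurve W) p, q.2 ∈ Icc α β := by
  set S : Set ℝ := {y | |W y| ≤ 1} with hS
  have hcurve : ∀ q ∈ cosCurve W, q.2 ∈ S := fun q hq => by
    show |W q.2| ≤ 1
    rw [← show cos q.1 = W q.2 from hq]; exact abs_cos_le_one _
  have hpS : p.2 ∈ S := hcurve p hp
  set I := connectedComponentIn S p.2 with hI
  have hpI : p.2 ∈ I := mem_connectedComponentIn hpS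
  have hIS : I ⊆ S := connectedComponentIn_subset _ _
  have hSc : IsClosed S := isClosed_le (hW.continuous.abs) continuous_const
  have hIpre : IsPreconnected I := isPreconnected_connectedComponentIn
  have hIcl : IsClosed I := isClosed_connectedComponentIn hSc hpS
  have hIcomp : IsCompact I := (isCompact_Icc (a := -R) (b := R)).of_isClosed_subset hIcl
    fun y hy => abs_le.1 (hR y (hIS hy))
  obtain ⟨α, β, hαβ⟩ : ∃ α β, I = Icc α β :=
    ⟨_, _, eq_Icc_of_connected_compact ⟨⟨_, hpI⟩, hIpre⟩ hIcomp⟩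
  have hpαβ : p.2 ∈ Icc α β := hαβ ▸ hpI
  have hle : α ≤ β := hpαβ.1.trans hpαβ.2
  -- maximality of the component
  have hmax : ∀ J : Set ℝ, IsPreconnected J → J ⊆ S → (∃ z ∈ J, z ∈ Icc α β) → J ⊆ Icc α β := by
    rintro J hJ hJS ⟨z, hzJ, hz⟩
    have hu : IsPreconnected (J ∪ I) := hJ.union z hzJ (hαβ ▸ hz) hIpre
    have := hu.subset_connectedComponentIn (Or.inr hpI) (union_subset hJS hIS)
    rw [← hαβ]; exact subset_union_left.trans this
  have hproj : ∀ q ∈ connectedComponentIn (cosCurve W) p, q.2 ∈ Icc α β := by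
    intro q hq
    have h := (isPreconnected_connectedComponentIn (x := p) (F := cosCurve W)).image Prod.snd
      continuous_snd.continuousOn
    have h2 := h.subset_connectedComponentIn (F := S) (x := p.2)
      ⟨p, mem_connectedComponentIn hp, rfl⟩
      (by rintro _ ⟨z, hz, rfl⟩; exact hcurve z (connectedComponentIn_subset _ _ hz))
    rw [← hαβ]; exact h2 ⟨q, hq, rfl⟩
  obtain ⟨k, hk1, hk2⟩ := exists_int_mul_pi_le p.1
  have hder : ∀ y ∈ Icc α β, |W y| = 1 → deriv W y ≠ 0 := by
    intro y hy h1
    have hm := arc_mem_component hW.continuous hp hIpre hpI (fun y hy => hIS hy) hk1 hk2.le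
      (hαβ ▸ hy : y ∈ I)
    -- The point of the arc at this height has `cos u = ±1`, so `sin u = 0` and the regularity
    -- hypothesis applies.
    refine hreg _ hm ?_
    have hc := cos_add_arccos k h1.le
    have := sin_sq_add_cos_sq (k * π + arccos ((-1) ^ k * W y))
    rw [hc, ← sq_abs (W y), h1] at this
    simpa using this
  -- near a point where `|W| = 1` the set `S` contains a one-sided neighbourhood
  have hside : ∀ y ∈ Icc α β, |W y| = 1 → ∃ δ > 0, Icc y (y + δ) ⊆ S ∨ Icc (y - δ) y ⊆ S := by
    intro y hy h1
    have hd := hder y hy h1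
    -- Passing to `W²` treats `W = 1` and `W = -1` together: its derivative is nonzero, so it drops
    -- below `1` on one side of `y`.
    have hsq : HasDerivAt (fun z => W z ^ 2) (2 * W y * deriv W y) y := by
      have h := (hW y).hasDerivAt.fun_pow 2
      simpa using h
    have hWy : W y ≠ 0 := by intro h; simp [h] at h1
    have hne : 2 * W y * deriv W y ≠ 0 := by positivity
    have h1' : W y ^ 2 = 1 := by rw [← sq_abs, h1]; norm_num
    have hmem : ∀ z, W z ^ 2 ≤ 1 → z ∈ S := fun z hz => by
      show |W z| ≤ 1
      exact abs_le_one_iff_mul_self_le_one.2 (by nlinarith)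
    rcases hne.lt_or_gt with h | h
    · have : ∀ᶠ z in 𝓝[>] y, W z ^ 2 < W y ^ 2 := by
        have hs := hsq.tendsto_slope
        have hs' : ∀ᶠ z in 𝓝[>] y, slope (fun z => W z ^ 2) y z < 0 :=
          (hs.mono_left (nhdsWithin_mono _ fun z hz => ne_of_gt hz)).eventually (gt_mem_nhds h)
        filter_upwards [hs', self_mem_nhdsWithin] with z hz hzy
        rw [slope_def_field, div_neg_iff] at hz
        have : 0 < z - y := sub_pos.2 hzy
        rcases hz with hz | hz <;> linarith
      obtain ⟨b, hb, hsub⟩ := (mem_nhdsGT_iff_exists_Ioo_subset).1 this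
      refine ⟨(b - y) / 2, by linarith [show y < b from hb], Or.inl fun z hz => hmem z ?_⟩
      rcases hz.1.eq_or_lt with rfl | hlt
      · exact h1'.le
      · have : W z ^ 2 < W y ^ 2 := hsub ⟨hlt, by linarith [hz.2, show y < b from hb]⟩
        linarith
    · have : ∀ᶠ z in 𝓝[<] y, W z ^ 2 < W y ^ 2 := by
        have hs := hsq.tendsto_slope
        have hs' : ∀ᶠ z in 𝓝[<] y, 0 < slope (fun z => W z ^ 2) y z :=
          (hs.mono_left (nhdsWithin_mono _ fun z hz => ne_of_lt hz)).eventually (lt_mem_nhds h)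
        filter_upwards [hs', self_mem_nhdsWithin] with z hz hzy
        rw [slope_def_field, div_pos_iff] at hz
        have : z - y < 0 := sub_neg.2 hzy
        rcases hz with hz | hz <;> linarith
      obtain ⟨b, hb, hsub⟩ := (mem_nhdsLT_iff_exists_Ioo_subset).1 this
      refine ⟨(y - b) / 2, by linarith [show b < y from hb], Or.inr fun z hz => hmem z ?_⟩
      rcases hz.2.eq_or_lt with rfl | hlt
      · exact h1'.le
      · have : W z ^ 2 < W y ^ 2 := hsub ⟨by linarith [hz.1, show b < y from hb], hlt⟩
        linarith
  have hnbhd : ∀ y, |W y| < 1 → ∃ δ > 0, Icc (y - δ) (y + δ) ⊆ S := by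
    intro y hy
    have : ∀ᶠ z in 𝓝 y, |W z| < 1 := (hW.continuous.abs.tendsto y).eventually (gt_mem_nhds hy)
    obtain ⟨δ, hδ, h⟩ := Metric.eventually_nhds_iff.1 this
    refine ⟨δ / 2, by positivity, fun z hz => (h ?_).le⟩
    rw [Real.dist_eq, abs_lt]; constructor <;> linarith [hz.1, hz.2]
  have hα : |W α| = 1 := by
    refine (show |W α| ≤ 1 from hIS (hαβ ▸ left_mem_Icc.2 hle)).eq_of_not_lt fun hlt => ?_
    obtain ⟨δ, hδ, h⟩ := hnbhd α hlt
    have := hmax _ isPreconnected_Icc h ⟨α, ⟨by linarith, by linarith⟩, left_mem_Icc.2 hle⟩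
      (left_mem_Icc.2 (by linarith : α - δ ≤ α + δ))
    linarith [this.1]
  have hβ : |W β| = 1 := by
    refine (show |W β| ≤ 1 from hIS (hαβ ▸ right_mem_Icc.2 hle)).eq_of_not_lt fun hlt => ?_
    obtain ⟨δ, hδ, h⟩ := hnbhd β hlt
    have := hmax _ isPreconnected_Icc h ⟨β, ⟨by linarith, by linarith⟩, right_mem_Icc.2 hle⟩
      (right_mem_Icc.2 (by linarith : β - δ ≤ β + δ))
    linarith [this.2]
  -- A component reduced to one point would contradict the one-sided neighbourhood.
  have hlt : α < β := by
    refine hle.lt_of_ne fun heq => ?_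
    obtain ⟨δ, hδ, h | h⟩ := hside α (left_mem_Icc.2 hle) hα
    · have := hmax _ isPreconnected_Icc h ⟨α, left_mem_Icc.2 (by linarith), left_mem_Icc.2 hle⟩
        (right_mem_Icc.2 (by linarith : α ≤ α + δ))
      linarith [this.2]
    · have := hmax _ isPreconnected_Icc h ⟨α, right_mem_Icc.2 (by linarith), left_mem_Icc.2 hle⟩
        (left_mem_Icc.2 (by linarith : α - δ ≤ α))
      linarith [this.1]
  refine ⟨α, β, ⟨hlt, fun y hy => ?_, hα, hβ, hder _ (left_mem_Icc.2 hle) hα,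
    hder _ (right_mem_Icc.2 hle) hβ⟩, hproj⟩
  have hyI : y ∈ Icc α β := Ioo_subset_Icc_self hy
  refine (show |W y| ≤ 1 from hIS (hαβ ▸ hyI)).lt_of_ne fun h1 => hder y hyI h1 ?_
  -- Touching `±1` inside the window would be a local extremum of `W`, hence a stationary point.
  have hloc : ∀ᶠ z in 𝓝 y, |W z| ≤ 1 := by
    filter_upwards [Icc_mem_nhds hy.1 hy.2] with z hz using hIS (hαβ ▸ hz)
  rcases (eq_or_eq_neg_of_abs_eq h1) with h | h
  · exact IsLocalMax.deriv_eq_zero (hloc.mono fun z hz => by rw [h]; exact (abs_le.1 hz).2)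
  · exact IsLocalMin.deriv_eq_zero (hloc.mono fun z hz => by rw [h]; exact (abs_le.1 hz).1)

/-- All of a window is covered by the component. -/
theorem arc_mem_of_window {W : ℝ → ℝ} (hW : Continuous W) {α β : ℝ} (hw : IsWindow W α β)
    {p q : ℝ × ℝ} (hq : q ∈ connectedComponentIn (cosCurve W) p)
    (hq2 : q.2 ∈ Icc α β) {k : ℤ} (h1 : k * π ≤ q.1) (h2 : q.1 ≤ (k + 1) * π)
    {y : ℝ} (hy : y ∈ Icc α β) :
    (k * π + arccos ((-1) ^ k * W y), y) ∈ connectedComponentIn (cosCurve W) p := by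
  rw [connectedComponentIn_eq hq]
  exact arc_mem_component hW (connectedComponentIn_subset _ _ hq) isPreconnected_Icc hq2
    (fun y hy => hw.abs_le hy) h1 h2 hy

/-- If `W = 1` at both ends of the window, the component is a closed curve in one strip. -/
theorem component_eq_of_window_one {W : ℝ → ℝ} (hW : Continuous W) {α β : ℝ}
    (hw : IsWindow W α β) (hα : W α = 1) (hβ : W β = 1) {p : ℝ × ℝ} (hp : p ∈ cosCurve W)
    (hX : ∀ q ∈ connectedComponentIn (cosCurve W) p, q.2 ∈ Icc α β) :
    ∃ j : ℤ, ∀ q : ℝ × ℝ, q ∈ connectedComponentIn (cosCurve W) p ↔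
      q.2 ∈ Icc α β ∧ |q.1 - 2 * j * π| < π ∧ cos q.1 = W q.2 := by
  set X := connectedComponentIn (cosCurve W) p with hXdef
  have hpX : p ∈ X := mem_connectedComponentIn hp
  have hgt : ∀ y ∈ Icc α β, -1 < W y := by
    intro y hy
    rcases hy.1.eq_or_lt with rfl | h1
    · rw [hα]; norm_num
    rcases hy.2.eq_or_lt with rfl | h2
    · rw [hβ]; norm_num
    exact (abs_lt.1 (hw.inside y ⟨h1, h2⟩)).1
  -- After the shift by `π`, halving the strip number gives the even multiple of `π` at distance at
  -- most `π` from `p.1`.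
  obtain ⟨k, hk1, hk2⟩ := exists_int_mul_pi_le (p.1 + π)
  -- the strip number
  obtain ⟨j, hj⟩ : ∃ j : ℤ, k = 2 * j ∨ k = 2 * j + 1 := by
    rcases Int.even_or_odd' k with ⟨j, h⟩
    exact ⟨j, h⟩
  have hpj : |p.1 - 2 * j * π| ≤ π := by
    rw [abs_le]
    rcases hj with rfl | rfl <;> push_cast at hk1 hk2 <;> constructor <;> nlinarith [pi_pos]
  have hcosb : ∀ u : ℝ, (u = 2 * j * π - π ∨ u = 2 * j * π + π) → cos u = -1 := by
    rintro u (rfl | rfl)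
    · rw [show 2 * (j : ℝ) * π - π = -π + j * (2 * π) by ring, cos_add_int_mul_two_pi]; simp
    · rw [show 2 * (j : ℝ) * π + π = π + j * (2 * π) by ring, cos_add_int_mul_two_pi]; simp
  -- On the walls at distance `π` the cosine is `-1`, a value that `W` does not take over the
  -- window; the connected component cannot pass them.
  have hne : ∀ q ∈ X, q.1 ≠ 2 * j * π - π ∧ q.1 ≠ 2 * j * π + π := by
    intro q hq
    have hc : cos q.1 = W q.2 := connectedComponentIn_subset (cosCurve W) p hq
    have := hgt q.2 (hX q hq)
    constructor <;> intro h
    · rw [hcosb _ (Or.inl h)] at hc; linarith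
    · rw [hcosb _ (Or.inr h)] at hc; linarith
  have hX1 : ∀ q ∈ X, |q.1 - 2 * j * π| < π := by
    intro q hq
    have hpre : IsPreconnected (Prod.fst '' X) :=
      isPreconnected_connectedComponentIn.image _ continuous_fst.continuousOn
    have hoc := hpre.ordConnected
    rw [abs_lt]
    have h0 := abs_le.1 hpj
    constructor
    · by_contra! hcon
      obtain ⟨r, hr, hr2⟩ := hoc.out ⟨q, hq, rfl⟩ ⟨p, hpX, rfl⟩
        (⟨by linarith, by linarith⟩ : 2 * j * π - π ∈ Icc q.1 p.1)
      exact (hne r hr).1 hr2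
    · by_contra! hcon
      obtain ⟨r, hr, hr2⟩ := hoc.out ⟨p, hpX, rfl⟩ ⟨q, hq, rfl⟩
        (⟨by linarith, by linarith⟩ : 2 * j * π + π ∈ Icc p.1 q.1)
      exact (hne r hr).2 hr2
  have hαm : α ∈ Icc α β := left_mem_Icc.2 hw.lt.le
  have he : ((-1 : ℝ)) ^ (2 * j) = 1 := (even_two_mul j).neg_one_zpow
  have ho : ((-1 : ℝ)) ^ (2 * j - 1) = -1 := by
    have : Odd (2 * j - 1) := ⟨j - 1, by ring⟩
    exact this.neg_one_zpow
  -- the vertex over `α`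
  have hvert : ((2 * j * π, α) : ℝ × ℝ) ∈ X := by
    have h0 := abs_le.1 hpj
    rcases le_total (2 * j * π) p.1 with h | h
    · have := arc_mem_of_window hW hw hpX (hX p hpX) (k := 2 * j) (by push_cast; linarith)
        (by push_cast; linarith) hαm
      rw [he, hα] at this; simpa using this
    · have := arc_mem_of_window hW hw hpX (hX p hpX) (k := 2 * j - 1) (by push_cast; linarith)
        (by push_cast; linarith) hαm
      rw [ho, hα] at this
      simp only [mul_one, arccos_neg_one] at this
      convert this using 2
      push_cast; ring
  refine ⟨j, fun q => ⟨fun hq => ⟨hX q hq, hX1 q hq, connectedComponentIn_subset (cosCurve W) p hq⟩, ?_⟩⟩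
  rintro ⟨hq2, hq1, hqc⟩
  have h0 := abs_lt.1 hq1
  -- Every point of the curve in this strip lies on one of the two arcs issuing from the vertex over
  -- `α`.
  rcases le_total (2 * j * π) q.1 with h | h
  · have := arc_mem_of_window hW hw hvert hαm (k := 2 * j) (by push_cast; simp)
      (by push_cast; linarith [pi_pos]) hq2
    rwa [← eq_add_arccos (by push_cast; linarith) (by push_cast; linarith) hqc] at this
  · have := arc_mem_of_window hW hw hvert hαm (k := 2 * j - 1) (by push_cast; linarith [pi_pos])
      (by push_cast; simp) hq2
    rwa [← eq_add_arccos (by push_cast; linarith) (by push_cast; linarith) hqc] at this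

/-- The closed curve `cos u = W y` in the strip around `u = u₀` encloses the points of the
axis over the open window. -/
theorem enclosed_of_window {W : ℝ → ℝ} (hW : Continuous W) {α β u₀ : ℝ} (hgt : ∀ y ∈ Icc α β, -1 < W y)
    (hlt : ∀ y ∈ Ioo α β, W y < 1) (hα : W α = 1) (hβ : W β = 1) {X : Set (ℝ × ℝ)}
    (hX : ∀ q : ℝ × ℝ, q ∈ X ↔ q.2 ∈ Icc α β ∧ |q.1 - u₀| < π ∧ cos (q.1 - u₀) = W q.2)
    {y : ℝ} (hy : y ∈ Ioo α β) :
    IsCompact X ∧ ((u₀, y) : ℝ × ℝ) ∉ X ∧ Bornology.IsBounded (connectedComponentIn Xᶜ (u₀, y)) := by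
  -- `D` is the open inside of the curve, and the closed set `E` is the union of `D` and the curve.
  set D : Set (ℝ × ℝ) := {q | q.2 ∈ Ioo α β ∧ |q.1 - u₀| < π ∧ W q.2 < cos (q.1 - u₀)} with hD
  set E : Set (ℝ × ℝ) := {q | q.2 ∈ Icc α β ∧ |q.1 - u₀| ≤ π ∧ W q.2 ≤ cos (q.1 - u₀)} with hE
  have habs : Continuous fun q : ℝ × ℝ => |q.1 - u₀| := by fun_prop
  have hWc : Continuous fun q : ℝ × ℝ => W q.2 := hW.comp continuous_snd
  have hcc : Continuous fun q : ℝ × ℝ => cos (q.1 - u₀) := by fun_prop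
  have hDo : IsOpen D := (isOpen_Ioo.preimage continuous_snd).inter
    ((isOpen_lt habs continuous_const).inter (isOpen_lt hWc hcc))
  have hEc : IsClosed E := (isClosed_Icc.preimage continuous_snd).inter
    ((isClosed_le habs continuous_const).inter (isClosed_le hWc hcc))
  have hbd : ∀ q : ℝ × ℝ, |q.1 - u₀| = π → cos (q.1 - u₀) = -1 := by
    intro q h; rw [← cos_abs, h, cos_pi]
  have hEU : ∀ q ∈ E, q ∈ D ∪ X := by
    rintro q ⟨h1, h2, h3⟩
    have h2' : |q.1 - u₀| < π := by
      refine h2.lt_of_ne fun h => ?_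
      have := hgt q.2 h1
      rw [hbd q h] at h3; linarith
    rcases h3.eq_or_lt with h | h
    · exact Or.inr ((hX q).2 ⟨h1, h2', h.symm⟩)
    · have hW1 : W q.2 < 1 := h.trans_le (cos_le_one _)
      refine Or.inl ⟨⟨h1.1.lt_of_ne ?_, h1.2.lt_of_ne ?_⟩, h2', h⟩
      · rintro h'; rw [← h', hα] at hW1; exact lt_irrefl _ hW1
      · rintro h'; rw [h', hβ] at hW1; exact lt_irrefl _ hW1
  have hXE : X ⊆ E := fun q hq => by
    obtain ⟨h1, h2, h3⟩ := (hX q).1 hq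
    exact ⟨h1, h2.le, h3.ge⟩
  have hEb : Bornology.IsBounded E := by
    refine ((Metric.isBounded_Icc (u₀ - π) (u₀ + π)).prod (Metric.isBounded_Icc α β)).subset ?_
    rintro q ⟨h1, h2, -⟩
    exact ⟨⟨by linarith [(abs_le.1 h2).1], by linarith [(abs_le.1 h2).2]⟩, h1⟩
  have hXc : X = E ∩ {q | cos (q.1 - u₀) = W q.2} := by
    ext q
    refine ⟨fun hq => ⟨hXE hq, ((hX q).1 hq).2.2⟩, ?_⟩
    rintro ⟨h1, h2⟩
    rcases hEU q h1 with h | h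
    · exact absurd (show cos (q.1 - u₀) = W q.2 from h2) h.2.2.ne'
    · exact h
  have hXcl : IsClosed X := by rw [hXc]; exact hEc.inter (isClosed_eq hcc hWc)
  have hcX : ((u₀, y) : ℝ × ℝ) ∉ X := fun h => by
    have := ((hX _).1 h).2.2
    simp only [sub_self, cos_zero] at this
    exact (hlt y hy).ne this.symm
  have hcD : ((u₀, y) : ℝ × ℝ) ∈ D := ⟨hy, by simpa using pi_pos, by simpa using hlt y hy⟩
  refine ⟨Metric.isCompact_of_isClosed_isBounded hXcl (hEb.subset hXE), hcX, ?_⟩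
  have hDE : D ⊆ E := fun q hq => ⟨Ioo_subset_Icc_self hq.1, hq.2.1.le, hq.2.2.le⟩
  refine hEb.subset (subset_trans ?_ hDE)
  have hcU : ((u₀, y) : ℝ × ℝ) ∈ Xᶜ := hcX
  -- Off the curve the plane is the disjoint union of the open sets `D` and `Eᶜ`, so a connected set
  -- meeting `D` stays in `D`.
  refine isPreconnected_connectedComponentIn.subset_left_of_subset_union hDo hEc.isOpen_compl
    (disjoint_left.2 fun q hq hq' => hq' (hDE hq)) (fun q hq => ?_)
    ⟨_, mem_connectedComponentIn hcU, hcD⟩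
  by_cases hqE : q ∈ E
  · exact Or.inl ((hEU q hqE).resolve_right (connectedComponentIn_subset _ _ hq))
  · exact Or.inr hqE

/-- A closed set that misses a vertical line does not enclose the points of that line. -/
theorem not_isBounded_component_of_line {X : Set (ℝ × ℝ)} {u₀ : ℝ} (hX : ∀ y, ((u₀, y) : ℝ × ℝ) ∉ X)
    (y : ℝ) : ¬ Bornology.IsBounded (connectedComponentIn Xᶜ (u₀, y)) := by
  intro h
  have hl : IsPreconnected (range fun z : ℝ => ((u₀, z) : ℝ × ℝ)) :=
    isPreconnected_range (by fun_prop)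
  have hsub := hl.subset_connectedComponentIn (x := (u₀, y)) (F := Xᶜ) ⟨y, rfl⟩
    (by rintro _ ⟨z, rfl⟩; exact hX z)
  have h2 := (h.subset hsub).image_snd
  have : Prod.snd '' (range fun z : ℝ => ((u₀, z) : ℝ × ℝ)) = univ := by
    ext z; simp
  rw [this] at h2
  exact noncompact_univ ℝ (Metric.isCompact_of_isClosed_isBounded isClosed_univ h2)

theorem IsWindow.neg {W : ℝ → ℝ} {α β : ℝ} (h : IsWindow W α β) : IsWindow (-W) α β where
  lt := h.lt
  inside y hy := by simpa using h.inside y hy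
  left := by simpa using h.left
  right := by simpa using h.right
  deriv_left := by simpa [deriv.neg] using h.deriv_left
  deriv_right := by simpa [deriv.neg] using h.deriv_right

/-- Shifting `u` by `π` amounts to a change of sign of `W`. -/
theorem mem_component_neg {W : ℝ → ℝ} {p q : ℝ × ℝ} (hp : p ∈ cosCurve W) :
    (q.1 + π, q.2) ∈ connectedComponentIn (cosCurve (-W)) (p.1 + π, p.2) ↔
      q ∈ connectedComponentIn (cosCurve W) p := by
  let T : ℝ × ℝ ≃ₜ ℝ × ℝ := (Homeomorph.addRight π).prodCongr (Homeomorph.refl ℝ)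
  have hT : T '' cosCurve W = cosCurve (-W) := by
    ext q
    constructor
    · rintro ⟨r, hr, rfl⟩
      have hr : cos r.1 = W r.2 := hr
      show cos (r.1 + π) = -W r.2
      rw [cos_add_pi, hr]
    · intro hq
      have hq : cos q.1 = -W q.2 := hq
      refine ⟨(q.1 - π, q.2), ?_, ?_⟩
      · show cos (q.1 - π) = W q.2
        rw [cos_sub_pi, hq, neg_neg]
      · exact Prod.ext (sub_add_cancel _ _) rfl
  have := T.image_connectedComponentIn hp
  rw [hT] at this
  rw [show ((p.1 + π, p.2) : ℝ × ℝ) = T p from rfl, ← this,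
    show ((q.1 + π, q.2) : ℝ × ℝ) = T q from rfl]
  exact T.injective.mem_set_image

/-- If `W = -1` at both ends of the window, the component is a closed curve in one strip. -/
theorem component_eq_of_window_neg_one {W : ℝ → ℝ} (hW : Continuous W) {α β : ℝ}
    (hw : IsWindow W α β) (hα : W α = -1) (hβ : W β = -1) {p : ℝ × ℝ} (hp : p ∈ cosCurve W)
    (hX : ∀ q ∈ connectedComponentIn (cosCurve W) p, q.2 ∈ Icc α β) :
    ∃ j : ℤ, ∀ q : ℝ × ℝ, q ∈ connectedComponentIn (cosCurve W) p ↔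
      q.2 ∈ Icc α β ∧ |q.1 - (2 * j + 1) * π| < π ∧ cos q.1 = W q.2 := by
  have hp' : ((p.1 + π, p.2) : ℝ × ℝ) ∈ cosCurve (-W) := by
    show cos (p.1 + π) = -W p.2
    rw [cos_add_pi, show cos p.1 = W p.2 from hp]
  obtain ⟨j, hj⟩ := component_eq_of_window_one hW.neg hw.neg (by simp [hα]) (by simp [hβ]) hp'
    (fun q hq => by
      have := hX (q.1 - π, q.2) ((mem_component_neg hp).1 (by simpa using hq))
      exact this)
  refine ⟨j - 1, fun q => ?_⟩
  rw [← mem_component_neg hp, hj]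
  simp only [cos_add_pi, Pi.neg_apply, neg_inj]
  rw [show q.1 + π - 2 * j * π = q.1 - (2 * ((j - 1 : ℤ) : ℝ) + 1) * π by push_cast; ring]

/-! ### Autonomous differential equations -/

/-- The set of times of agreement is closed by continuity and open by local uniqueness, since a `C¹`
field is locally Lipschitz. -/
theorem autonomous_solution_unique {E : Type*} [NormedAddCommGroup E] [NormedSpace ℝ E] {v : E → E}
    (hv : ContDiff ℝ 1 v) {f g : ℝ → E} (hf : ∀ t, HasDerivAt f (v (f t)) t)
    (hg : ∀ t, HasDerivAt g (v (g t)) t) {t₀ : ℝ} (h : f t₀ = g t₀) : f = g := by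
  have hfc : Continuous f := continuous_iff_continuousAt.2 fun t => (hf t).continuousAt
  have hgc : Continuous g := continuous_iff_continuousAt.2 fun t => (hg t).continuousAt
  have hcl : IsClopen {t | f t = g t} := by
    refine ⟨isClosed_eq hfc hgc, isOpen_iff_mem_nhds.2 fun t ht => ?_⟩
    have ht : f t = g t := ht
    obtain ⟨K, s, hs, hl⟩ := (hv.contDiffAt (x := f t)).exists_lipschitzOnWith
    exact ODE_solution_unique_of_eventually (v := fun _ => v) (s := fun _ => s)
      (Eventually.of_forall fun _ => hl)
      ((hfc.continuousAt.eventually_mem hs).mono fun t' h' => ⟨hf t', h'⟩)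
      ((hgc.continuousAt.eventually_mem (ht ▸ hs)).mono fun t' h' => ⟨hg t', h'⟩) ht
  have := hcl.eq_univ ⟨t₀, h⟩
  exact funext fun t => (this ▸ mem_univ t : t ∈ {t | f t = g t})

/-- With speed at most `L`, a solution stays within `L (n + 1)` of its start up to time `n + 1`, so
the Picard–Lindelöf theorem applies on every such interval; the solutions are glued by uniqueness.
-/
theorem exists_global_solution {E : Type*} [NormedAddCommGroup E] [NormedSpace ℝ E]
    [CompleteSpace E] {v : E → E} {K L : NNReal} (hK : LipschitzWith K v) (hL : ∀ x, ‖v x‖ ≤ L)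
    (x₀ : E) : ∃ f : ℝ → E, f 0 = x₀ ∧ ∀ t, HasDerivAt f (v (f t)) t := by
  have hloc : ∀ n : ℕ, ∃ f : ℝ → E, f 0 = x₀ ∧ ∀ t ∈ Ioo (-(n + 1) : ℝ) (n + 1),
      HasDerivAt f (v (f t)) t := by
    intro n
    have hn : (0 : ℝ) ∈ Icc (-(n + 1) : ℝ) (n + 1) := by
      constructor <;> linarith [n.cast_nonneg (α := ℝ)]
    have hPL : IsPicardLindelof (fun _ => v) (⟨0, hn⟩ : Icc (-(n + 1) : ℝ) (n + 1)) x₀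
        (L * (n + 1)) 0 L K :=
      IsPicardLindelof.of_time_independent (fun x _ => hL x) hK.lipschitzOnWith (by simp)
    obtain ⟨f, hf0, hf⟩ := hPL.exists_eq_forall_mem_Icc_hasDerivWithinAt₀
    exact ⟨f, hf0, fun t ht => (hf t (Ioo_subset_Icc_self ht)).hasDerivAt (Icc_mem_nhds ht.1 ht.2)⟩
  choose F hF0 hF using hloc
  have hagree : ∀ m n : ℕ, m ≤ n → EqOn (F m) (F n) (Ioo (-(m + 1) : ℝ) (m + 1)) := by
    intro m n hmn
    have hmn' : (m : ℝ) ≤ n := by exact_mod_cast hmn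
    have h0 : (0 : ℝ) ≤ m := m.cast_nonneg
    refine ODE_solution_unique_of_mem_Ioo (v := fun _ => v) (s := fun _ => univ) (K := K) (t₀ := 0)
      (fun _ _ => hK.lipschitzOnWith) ⟨by linarith, by linarith⟩
      (fun t ht => ⟨hF m t ht, mem_univ _⟩)
      (fun t ht => ⟨hF n t ⟨by linarith [ht.1], by linarith [ht.2]⟩, mem_univ _⟩) ?_
    rw [hF0, hF0]
  have hagree' : ∀ m n : ℕ, ∀ t : ℝ, |t| < m + 1 → |t| < n + 1 → F m t = F n t := by
    intro m n t h1 h2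
    rcases le_total m n with h | h
    · exact hagree m n h (abs_lt.1 h1)
    · exact (hagree n m h (abs_lt.1 h2)).symm
  refine ⟨fun t => F ⌈|t|⌉₊ t, by simp [hF0], fun t => ?_⟩
  have ht : |t| < (⌈|t|⌉₊ : ℝ) + 1 := (Nat.le_ceil _).trans_lt (lt_add_one _)
  refine (hF _ t (abs_lt.1 ht)).congr_of_eventuallyEq ?_
  have : ∀ᶠ t' in 𝓝 t, |t'| < (⌈|t|⌉₊ : ℝ) + 1 :=
    (continuous_abs.tendsto t).eventually (gt_mem_nhds ht)
  filter_upwards [this] with t' ht'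
  exact hagree' _ _ _ ((Nat.le_ceil _).trans_lt (lt_add_one _)) ht'

/-- By the mean value theorem `f (t + 1) - f t`, which tends to `0`, is a value of `f'` at a point
beyond `t`. This serves to show that the limit of a convergent orbit is an equilibrium. -/
theorem eq_zero_of_tendsto_deriv {f f' : ℝ → ℝ} {l m : ℝ} (hf : ∀ t, HasDerivAt f (f' t) t)
    (hl : Tendsto f atTop (𝓝 l)) (hm : Tendsto f' atTop (𝓝 m)) : m = 0 := by
  have hmv : ∀ t : ℝ, ∃ ξ, t < ξ ∧ f' ξ = f (t + 1) - f t := by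
    intro t
    obtain ⟨ξ, hξ, h⟩ := exists_hasDerivAt_eq_slope f f' (show t < t + 1 by linarith)
      (HasDerivAt.continuousOn fun x _ => hf x) (fun x _ => hf x)
    exact ⟨ξ, hξ.1, by rw [h]; simp⟩
  choose ξ hξ h using hmv
  have h1 : Tendsto ξ atTop atTop := tendsto_atTop_mono (fun t => (hξ t).le) tendsto_id
  have h2 : Tendsto (fun t => f (t + 1) - f t) atTop (𝓝 (l - l)) :=
    (hl.comp (tendsto_atTop_add_const_right _ 1 tendsto_id)).sub hl
  have h3 := hm.comp h1
  rw [sub_self] at h2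
  exact tendsto_nhds_unique (h3.congr fun t => h t) h2

/-- A function whose derivative is symmetric about `c` is point symmetric about `c`. -/
theorem reflect_of_hasDerivAt {x φ : ℝ → ℝ} (hx : ∀ t, HasDerivAt x (φ t) t) {c : ℝ}
    (hφ : ∀ t, φ (2 * c - t) = φ t) (t : ℝ) : x (2 * c - t) = 2 * x c - x t := by
  have hd : ∀ t, HasDerivAt (fun t => x (2 * c - t) + x t) 0 t := by
    intro t
    have h1 := (hx (2 * c - t)).comp_const_sub (2 * c) t
    have h2 := h1.add (hx t)
    rw [hφ, neg_add_cancel] at h2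
    exact h2
  have := is_const_of_deriv_eq_zero (fun t => (hd t).differentiableAt) (fun t => (hd t).deriv) t c
  rw [show 2 * c - c = c by ring] at this
  linarith

/-! ### The flow on a curve `cos u = W y` -/

/-- `(u, y)` moves along the curve `cos u = W y` with the Hamiltonian velocity, up to the
factor `G y`. -/
structure IsFlow (W G u y : ℝ → ℝ) : Prop where
  hasDerivAt_fst : ∀ t, HasDerivAt u (-(deriv W (y t) * G (y t))) t
  hasDerivAt_snd : ∀ t, HasDerivAt y (sin (u t) * G (y t)) t
  curve : ∀ t, cos (u t) = W (y t)

theorem contDiff_one_deriv {W : ℝ → ℝ} (hW : ContDiff ℝ 2 W) : ContDiff ℝ 1 (deriv W) :=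
  ((contDiff_succ_iff_deriv (n := 1) (f := W)).1 (by rwa [one_add_one_eq_two])).2.2

/-- The field is multiplied by a bump that is `1` on the window, which makes it bounded and globally
Lipschitz. The solution of the truncated equation stays in the component of the curve, where the
truncation has no effect. -/
theorem exists_isFlow {W G : ℝ → ℝ} (hW : ContDiff ℝ 2 W) (hG : ContDiff ℝ 1 G) {p : ℝ × ℝ}
    (hp : p ∈ cosCurve W) {α β : ℝ}
    (hX : ∀ q ∈ connectedComponentIn (cosCurve W) p, q.2 ∈ Icc α β) :
    ∃ u y : ℝ → ℝ, IsFlow W G u y ∧ u 0 = p.1 ∧ y 0 = p.2 := by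
  have hW' := contDiff_one_deriv hW
  let R := max |α| |β|
  let χ : ContDiffBump (0 : ℝ) := ⟨R + 1, R + 2, by positivity, by linarith⟩
  have hχ1 : ∀ y ∈ Icc α β, χ y = 1 := by
    intro y hy
    apply χ.one_of_mem_closedBall
    rw [mem_closedBall_zero_iff, Real.norm_eq_abs]
    exact (abs_le_max_abs_abs hy.1 hy.2).trans (by show _ ≤ R + 1; linarith)
  set a : ℝ → ℝ := fun y => χ y * -(deriv W y * G y) with ha
  set b : ℝ → ℝ := fun y => χ y * G y with hb
  have hac : ContDiff ℝ 1 a := χ.contDiff.mul (hW'.mul hG).neg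
  have hbc : ContDiff ℝ 1 b := χ.contDiff.mul hG
  have has : HasCompactSupport a := χ.hasCompactSupport.mul_right
  have hbs : HasCompactSupport b := χ.hasCompactSupport.mul_right
  obtain ⟨Ka, hKa⟩ := hac.lipschitzWith_of_hasCompactSupport has one_ne_zero
  obtain ⟨Kb, hKb⟩ := hbc.lipschitzWith_of_hasCompactSupport hbs one_ne_zero
  obtain ⟨Ma, hMa⟩ := has.exists_bound_of_continuous hac.continuous
  obtain ⟨Mb, hMb⟩ := hbs.exists_bound_of_continuous hbc.continuous
  have hMa0 : 0 ≤ Ma := (norm_nonneg _).trans (hMa 0)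
  have hMb0 : 0 ≤ Mb := (norm_nonneg _).trans (hMb 0)
  set v : ℝ × ℝ → ℝ × ℝ := fun q => (a q.2, sin q.1 * b q.2) with hv
  have hv1 : LipschitzWith (Ka + (Mb.toNNReal + Kb)) v := by
    refine LipschitzWith.of_dist_le_mul fun q r => ?_
    have hd1 : |q.1 - r.1| ≤ dist q r := by rw [← Real.dist_eq]; exact le_max_left _ _
    have hd2 : |q.2 - r.2| ≤ dist q r := by rw [← Real.dist_eq]; exact le_max_right _ _
    have hd : 0 ≤ dist q r := dist_nonneg
    have h1 : dist (a q.2) (a r.2) ≤ Ka * dist q r :=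
      (hKa.dist_le_mul _ _).trans (mul_le_mul_of_nonneg_left hd2 Ka.2)
    have h2 : dist (b q.2) (b r.2) ≤ Kb * dist q r :=
      (hKb.dist_le_mul _ _).trans (mul_le_mul_of_nonneg_left hd2 Kb.2)
    have h3 : |sin q.1 - sin r.1| ≤ dist q r := by
      have := (LipschitzWith.of_dist_le_mul (K := 1) (f := sin) fun x y => by
        simpa [Real.dist_eq] using Real.abs_sin_sub_sin_le x y).dist_le_mul q.1 r.1
      rw [Real.dist_eq, Real.dist_eq] at this
      simp only [NNReal.coe_one, one_mul] at this
      exact this.trans hd1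
    have h4 : dist (sin q.1 * b q.2) (sin r.1 * b r.2) ≤ (Mb + Kb) * dist q r := by
      rw [Real.dist_eq] at h2 ⊢
      have h5 : |b q.2| ≤ Mb := hMb q.2
      calc |sin q.1 * b q.2 - sin r.1 * b r.2|
          = |(sin q.1 - sin r.1) * b q.2 + sin r.1 * (b q.2 - b r.2)| := by ring_nf
        _ ≤ |(sin q.1 - sin r.1) * b q.2| + |sin r.1 * (b q.2 - b r.2)| := abs_add_le _ _
        _ = |sin q.1 - sin r.1| * |b q.2| + |sin r.1| * |b q.2 - b r.2| := by
            rw [abs_mul _ (b q.2), abs_mul (sin r.1)]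
        _ ≤ dist q r * Mb + 1 * (Kb * dist q r) := by
            gcongr
            exact abs_sin_le_one _
        _ = _ := by ring
    push_cast
    rw [Real.coe_toNNReal _ hMb0]
    refine max_le (h1.trans ?_) (h4.trans ?_)
    · have := Kb.2
      have : (0 : ℝ) ≤ Kb := Kb.2
      nlinarith [mul_nonneg hMb0 hd, mul_nonneg this hd]
    · have : (0 : ℝ) ≤ Ka := Ka.2
      nlinarith [mul_nonneg this hd]
  have hv2 : ∀ q, ‖v q‖ ≤ (Ma.toNNReal + Mb.toNNReal : NNReal) := by
    intro q
    push_cast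
    rw [Real.coe_toNNReal _ hMb0, Real.coe_toNNReal _ hMa0]
    refine max_le ((hMa _).trans (by linarith)) ?_
    show ‖sin q.1 * b q.2‖ ≤ _
    rw [norm_mul]
    have h1 : ‖sin q.1‖ ≤ 1 := abs_sin_le_one _
    have := mul_le_mul h1 (hMb q.2) (norm_nonneg _) zero_le_one
    linarith
  obtain ⟨f, hf0, hf⟩ := exists_global_solution hv1 hv2 p
  have hf1 : ∀ t, HasDerivAt (fun t => (f t).1) (a (f t).2) t := fun t => by
    exact (hasFDerivAt_fst (p := f t)).comp_hasDerivAt t (hf t)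
  have hf2 : ∀ t, HasDerivAt (fun t => (f t).2) (sin (f t).1 * b (f t).2) t := fun t => by
    exact (hasFDerivAt_snd (p := f t)).comp_hasDerivAt t (hf t)
  -- Both components of the field carry the same cutoff factor, so `cos u - W y` is still conserved.
  have hcons : ∀ t, cos (f t).1 = W (f t).2 := by
    have hd : ∀ t, HasDerivAt (fun t => cos (f t).1 - W (f t).2) 0 t := by
      intro t
      have h1 := (hf1 t).cos
      have h2 := ((hW.differentiable (by norm_num) _).hasDerivAt).comp t (hf2 t)
      have h3 := h1.sub h2
      have e : -sin (f t).1 * a (f t).2 - deriv W (f t).2 * (sin (f t).1 * b (f t).2) = 0 := by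
        simp only [ha, hb]; ring
      rw [e] at h3
      exact h3
    intro t
    have := is_const_of_deriv_eq_zero (fun t => (hd t).differentiableAt) (fun t => (hd t).deriv) t 0
    have h0 : f 0 = p := hf0
    rw [h0] at this
    have hp : cos p.1 = W p.2 := hp
    linarith
  have hfc : Continuous f := continuous_iff_continuousAt.2 fun t => (hf t).continuousAt
  have hmem : ∀ t, (f t).2 ∈ Icc α β := fun t =>
    hX _ ((isPreconnected_range hfc).subset_connectedComponentIn ⟨0, hf0⟩
      (by rintro _ ⟨t, rfl⟩; exact hcons t) ⟨t, rfl⟩)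
  refine ⟨fun t => (f t).1, fun t => (f t).2, ⟨fun t => ?_, fun t => ?_, hcons⟩, by simp [hf0],
    by simp [hf0]⟩
  · have := hf1 t
    simp only [ha, hχ1 _ (hmem t), one_mul] at this
    exact this
  · have := hf2 t
    simp only [hb, hχ1 _ (hmem t), one_mul] at this
    exact this

namespace IsFlow

variable {W G u y : ℝ → ℝ}

theorem continuous_fst (h : IsFlow W G u y) : Continuous u :=
  continuous_iff_continuousAt.2 fun t => (h.hasDerivAt_fst t).continuousAt

theorem continuous_snd (h : IsFlow W G u y) : Continuous y :=
  continuous_iff_continuousAt.2 fun t => (h.hasDerivAt_snd t).continuousAt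

theorem mem_component (h : IsFlow W G u y) (t₀ t : ℝ) :
    (u t, y t) ∈ connectedComponentIn (cosCurve W) (u t₀, y t₀) :=
  (isPreconnected_range (h.continuous_fst.prodMk h.continuous_snd)).subset_connectedComponentIn
    ⟨t₀, rfl⟩ (by rintro _ ⟨t, rfl⟩; exact h.curve t) ⟨t, rfl⟩

theorem unique (hW : ContDiff ℝ 2 W) (hG : ContDiff ℝ 1 G) (h : IsFlow W G u y) {u' y' : ℝ → ℝ}
    (h' : IsFlow W G u' y') {t₀ : ℝ} (hu : u t₀ = u' t₀) (hy : y t₀ = y' t₀) : u = u' ∧ y = y' := by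
  have hW' := contDiff_one_deriv hW
  have hv : ContDiff ℝ 1 fun q : ℝ × ℝ => ((-(deriv W q.2 * G q.2), sin q.1 * G q.2) : ℝ × ℝ) := by
    have h1 := hW'.comp (contDiff_snd (𝕜 := ℝ) (E := ℝ) (F := ℝ))
    have h2 := hG.comp (contDiff_snd (𝕜 := ℝ) (E := ℝ) (F := ℝ))
    exact (h1.mul h2).neg.prodMk ((contDiff_sin.comp contDiff_fst).mul h2)
  have := autonomous_solution_unique hv (f := fun t => (u t, y t)) (g := fun t => (u' t, y' t))
    (fun t => (h.hasDerivAt_fst t).prodMk (h.hasDerivAt_snd t))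
    (fun t => (h'.hasDerivAt_fst t).prodMk (h'.hasDerivAt_snd t)) (t₀ := t₀) (by simp [hu, hy])
  exact ⟨funext fun t => congrArg Prod.fst (congrFun this t),
    funext fun t => congrArg Prod.snd (congrFun this t)⟩

/-- Reversing time and reflecting `u` in `mπ` changes the sign of `sin u` and keeps `cos u`, so it
maps solutions to solutions on the same curve. -/
theorem reverse (h : IsFlow W G u y) (c d : ℝ) {m : ℤ} (hm : d = 2 * m * π) :
    IsFlow W G (fun t => d - u (c - t)) (fun t => y (c - t)) where
  hasDerivAt_fst t := by
    have := ((h.hasDerivAt_fst (c - t)).comp_const_sub c t).const_sub d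
    simpa using this
  hasDerivAt_snd t := by
    have := (h.hasDerivAt_snd (c - t)).comp_const_sub c t
    rw [hm, show 2 * (m : ℝ) * π - u (c - t) = -u (c - t) + m * (2 * π) by ring,
      sin_add_int_mul_two_pi, sin_neg]
    simpa using this
  curve t := by
    rw [hm, show 2 * (m : ℝ) * π - u (c - t) = -u (c - t) + m * (2 * π) by ring,
      cos_add_int_mul_two_pi, cos_neg, h.curve]

/-- At a time when `u` is a multiple of `π` the solution and its mirror image have the same initial
values, so they coincide. -/
theorem reflect (hW : ContDiff ℝ 2 W) (hG : ContDiff ℝ 1 G) (h : IsFlow W G u y) {c : ℝ} {m : ℤ}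
    (hc : u c = m * π) (t : ℝ) : u (2 * c - t) = 2 * u c - u t ∧ y (2 * c - t) = y t := by
  have h' := h.reverse (2 * c) (2 * u c) (m := m) (by rw [hc]; ring)
  obtain ⟨h1, h2⟩ := h.unique hW hG h' (t₀ := c) (by rw [show 2 * c - c = c by ring]; ring)
    (by rw [show 2 * c - c = c by ring])
  constructor
  · have := congrFun h1 t
    linarith
  · exact (congrFun h2 t).symm

end IsFlow

/-! ### Half periods: monotone passages from one end of the window to the other -/

namespace IsFlow

variable {W G u y : ℝ → ℝ} {α β : ℝ}

theorem neg_one_zpow_mul_sin_pos {k : ℤ} {x : ℝ} (hx : x ∈ Ioo (k * π) ((k + 1) * π)) :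
    0 < (-1) ^ k * sin x := by
  have h : sin x = (-1) ^ k * sin (x - k * π) := by
    rw [← sin_add_int_mul_pi]; ring_nf
  rw [h, ← mul_assoc, neg_one_zpow_mul_self, one_mul]
  exact sin_pos_of_pos_of_lt_pi (by linarith [hx.1]) (by linarith [hx.2])

/-- While `u` stays in a strip, `y` is monotone. -/
theorem strictMonoOn (h : IsFlow W G u y) (hG : ∀ y, 0 < G y) {k : ℤ} {s : Set ℝ}
    (hs : Convex ℝ s) (hu : ∀ t ∈ interior s, u t ∈ Ioo (k * π) ((k + 1) * π)) :
    StrictMonoOn (fun t => (-1) ^ k * y t) s := by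
  refine strictMonoOn_of_deriv_pos hs (h.continuous_snd.const_mul _).continuousOn fun t ht => ?_
  rw [((h.hasDerivAt_snd t).const_mul _).deriv, ← mul_assoc]
  exact mul_pos (neg_one_zpow_mul_sin_pos (hu t ht)) (hG _)

/-- If `u` stayed in the strip, `y` would be monotone and bounded, so `y` and then `u` would
converge. The limit would be an equilibrium, with `sin u = 0` and `W' = 0`; but then `|W| = 1`,
which happens only at the ends of the window, where `W' ≠ 0`. -/
theorem exists_not_mem_strip (hW : ContDiff ℝ 2 W) (hGc : Continuous G) (h : IsFlow W G u y)
    (hG : ∀ y, 0 < G y) (hw : IsWindow W α β) (hy : ∀ t, y t ∈ Icc α β) (k : ℤ) (t₀ : ℝ) :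
    ∃ t ≥ t₀, u t ∉ Ioo (k * π) ((k + 1) * π) := by
  by_contra! hcon
  have hmono := h.strictMonoOn hG (k := k) (convex_Ici t₀) (fun t ht => by
    rw [interior_Ici] at ht; exact hcon t ht.le)
  set s : ℝ := (-1) ^ k with hs
  have hss : s * s = 1 := neg_one_zpow_mul_self k
  have hmono' : Monotone fun t => s * y (max t₀ t) := fun a b hab =>
    hmono.monotoneOn (mem_Ici.2 (le_max_left _ _)) (mem_Ici.2 (le_max_left _ _)) (max_le_max le_rfl hab)
  have hbd : BddAbove (range fun t => s * y (max t₀ t)) := by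
    refine ⟨max |α| |β|, ?_⟩
    rintro _ ⟨t, rfl⟩
    have h1 := abs_le_max_abs_abs (hy (max t₀ t)).1 (hy (max t₀ t)).2
    have h2 := le_abs_self (s * y (max t₀ t))
    rw [hs, abs_neg_one_zpow_mul] at h2
    exact h2.trans h1
  have hlim := tendsto_atTop_ciSup hmono' hbd
  set z := ⨆ t, s * y (max t₀ t)
  have hylim : Tendsto y atTop (𝓝 (s * z)) := by
    refine (hlim.const_mul s).congr' ?_
    filter_upwards [eventually_ge_atTop t₀] with t ht
    rw [max_eq_right ht, ← mul_assoc, hss, one_mul]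
  set y' := s * z
  have hy' : y' ∈ Icc α β := isClosed_Icc.mem_of_tendsto hylim (Eventually.of_forall hy)
  have hulim : Tendsto u atTop (𝓝 (k * π + arccos (s * W y'))) := by
    have hc : Continuous fun y => k * π + arccos (s * W y) :=
      continuous_const.add (continuous_arccos.comp (continuous_const.mul hW.continuous))
    refine ((hc.tendsto y').comp hylim).congr' ?_
    filter_upwards [eventually_ge_atTop t₀] with t ht
    have := hcon t ht
    exact (eq_add_arccos this.1.le this.2.le (h.curve t)).symm
  set u' := k * π + arccos (s * W y')
  have hcu : cos u' = W y' := cos_add_arccos k (hw.abs_le hy')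
  have h1 := eq_zero_of_tendsto_deriv h.hasDerivAt_snd hylim
    (((continuous_sin.tendsto u').comp hulim).mul ((hGc.tendsto y').comp hylim))
  have h2 := eq_zero_of_tendsto_deriv h.hasDerivAt_fst hulim
    (((((contDiff_one_deriv hW).continuous.tendsto y').comp hylim).mul
      ((hGc.tendsto y').comp hylim)).neg)
  have hsin : sin u' = 0 := (mul_eq_zero.1 h1).resolve_right (hG y').ne'
  have hder : deriv W y' = 0 := (mul_eq_zero.1 (neg_eq_zero.1 h2)).resolve_right (hG y').ne'
  have habs : |W y'| = 1 := by
    have := sin_sq_add_cos_sq u'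
    rw [hsin, hcu, ← sq_abs (W y')] at this
    nlinarith [abs_nonneg (W y')]
  rcases hy'.1.eq_or_lt with h3 | h3
  · exact hw.deriv_left (h3 ▸ hder)
  rcases hy'.2.eq_or_lt with h4 | h4
  · exact hw.deriv_right (h4 ▸ hder)
  exact (hw.inside y' ⟨h3, h4⟩).ne habs

theorem exists_exit (hW : ContDiff ℝ 2 W) (hGc : Continuous G) (h : IsFlow W G u y)
    (hG : ∀ y, 0 < G y) (hw : IsWindow W α β) (hy : ∀ t, y t ∈ Icc α β) {k : ℤ} {t₀ : ℝ}
    (h0 : u t₀ ∈ Ioo (k * π) ((k + 1) * π)) :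
    ∃ t₂ > t₀, (∀ t ∈ Ico t₀ t₂, u t ∈ Ioo (k * π) ((k + 1) * π)) ∧
      (u t₂ = k * π ∨ u t₂ = (k + 1) * π) := by
  set A : Set ℝ := {t | t₀ ≤ t ∧ u t ∉ Ioo (k * π) ((k + 1) * π)} with hA
  have hAc : IsClosed A := isClosed_Ici.inter (isOpen_Ioo.preimage h.continuous_fst).isClosed_compl
  have hAn : A.Nonempty := by
    obtain ⟨t, ht, ht'⟩ := h.exists_not_mem_strip hW hGc hG hw hy k t₀
    exact ⟨t, ht, ht'⟩
  have hAb : BddBelow A := ⟨t₀, fun t ht => ht.1⟩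
  have hmem := hAc.csInf_mem hAn hAb
  set t₂ := sInf A
  have hlt : t₀ < t₂ := hmem.1.lt_of_ne (by rintro h'; exact hmem.2 (h' ▸ h0))
  have hin : ∀ t ∈ Ico t₀ t₂, u t ∈ Ioo (k * π) ((k + 1) * π) := by
    intro t ht
    by_contra hcon
    exact (csInf_le hAb ⟨ht.1, hcon⟩).not_gt ht.2
  refine ⟨t₂, hlt, hin, ?_⟩
  have hcl : u t₂ ∈ Icc (k * π) ((k + 1) * π) := by
    have : t₂ ∈ closure (Ico t₀ t₂) := by rw [closure_Ico hlt.ne]; exact right_mem_Icc.2 hlt.le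
    have hsub : Ico t₀ t₂ ⊆ u ⁻¹' Icc (k * π) ((k + 1) * π) := fun t ht =>
      Ioo_subset_Icc_self (hin t ht)
    exact closure_minimal hsub (isClosed_Icc.preimage h.continuous_fst) this
  by_contra! hne
  exact hmem.2 ⟨hcl.1.lt_of_ne (Ne.symm hne.1), hcl.2.lt_of_ne hne.2⟩

/-- A half period: `u` crosses a strip (or enters and leaves it) while `y` moves monotonically from
one end of the window to the other. -/
structure IsHalfPeriod (u y : ℝ → ℝ) (α β : ℝ) (k : ℤ) (t₁ t₂ : ℝ) : Prop where
  lt : t₁ < t₂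
  strip : ∀ t ∈ Ioo t₁ t₂, u t ∈ Ioo (k * π) ((k + 1) * π)
  left : u t₁ = k * π ∨ u t₁ = (k + 1) * π
  right : u t₂ = k * π ∨ u t₂ = (k + 1) * π
  strictMonoOn : StrictMonoOn (fun t => (-1) ^ k * y t) (Icc t₁ t₂)
  ends : y t₁ = α ∧ y t₂ = β ∨ y t₁ = β ∧ y t₂ = α

/-- From a time inside an open strip the orbit is followed forwards and backwards to its exits. On a
wall `|W| = 1`, so `y` is an end of the window, and the strict monotonicity of `y` makes the two
ends different. -/
theorem exists_isHalfPeriod (hW : ContDiff ℝ 2 W) (hGc : Continuous G) (h : IsFlow W G u y)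
    (hG : ∀ y, 0 < G y) (hw : IsWindow W α β) (hy : ∀ t, y t ∈ Icc α β) :
    ∃ (k : ℤ) (t₁ t₂ : ℝ), IsHalfPeriod u y α β k t₁ t₂ := by
  have hend : ∀ (m : ℤ) t, u t = m * π → y t = α ∨ y t = β := by
    intro m t ht
    have h1 : |W (y t)| = 1 := by rw [← h.curve, ht]; simp [cos_int_mul_pi, abs_zpow]
    by_contra! hne
    exact (hw.inside _ ⟨(hy t).1.lt_of_ne hne.1.symm, (hy t).2.lt_of_ne hne.2⟩).ne h1
  obtain ⟨k, t₀, h0⟩ : ∃ (k : ℤ) (t₀ : ℝ), u t₀ ∈ Ioo (k * π) ((k + 1) * π) := by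
    obtain ⟨k, hk1, hk2⟩ := exists_int_mul_pi_le (u 0)
    -- If the orbit starts on a wall, `u' = -W' G ≠ 0` there, so it is off the wall at nearby times.
    rcases hk1.eq_or_lt with heq | hlt
    · have hd : deriv W (y 0) ≠ 0 := by
        rcases hend k 0 heq.symm with h' | h' <;> rw [h']
        exacts [hw.deriv_left, hw.deriv_right]
      have h1 : ∀ᶠ t in 𝓝[≠] (0 : ℝ), u t ≠ k * π :=
        (h.hasDerivAt_fst 0).eventually_ne (neg_ne_zero.2 (mul_ne_zero hd (hG _).ne'))
      have h2 : ∀ᶠ t in 𝓝[≠] (0 : ℝ), u t ∈ Ioo ((k - 1) * π) ((k + 1) * π) :=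
        (h.continuous_fst.continuousAt.eventually_mem
          (Ioo_mem_nhds (by rw [← heq]; linarith [pi_pos]) hk2)).filter_mono nhdsWithin_le_nhds
      obtain ⟨t, ht1, ht2⟩ := (h1.and h2).exists
      rcases ht1.lt_or_gt with h3 | h3
      · exact ⟨k - 1, t, by push_cast; exact ht2.1, by push_cast; linarith⟩
      · exact ⟨k, t, h3, ht2.2⟩
    · exact ⟨k, 0, hlt, hk2⟩
  obtain ⟨t₂, ht₂, hin₂, hu₂⟩ := h.exists_exit hW hGc hG hw hy h0
  -- The backward exit is the forward exit of the reversed flow; `u ↦ -u` turns strip `k` into strip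
  -- `-k - 1`.
  have hrev := h.reverse 0 0 (m := 0) (by simp)
  obtain ⟨t₁, ht₁, hin₁, hu₁⟩ := hrev.exists_exit hW hGc hG hw (fun t => hy _) (k := -k - 1)
    (t₀ := -t₀) (by simp only [zero_sub, neg_neg]; push_cast; constructor <;> linarith [h0.1, h0.2])
  have hlt : -t₁ < t₂ := by linarith
  have hstrip : ∀ t ∈ Ioo (-t₁) t₂, u t ∈ Ioo (k * π) ((k + 1) * π) := by
    intro t ht
    rcases le_total t₀ t with h' | h'
    · exact hin₂ t ⟨h', ht.2⟩
    · have := hin₁ (-t) ⟨by linarith, by linarith [ht.1]⟩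
      simp only [zero_sub, neg_neg] at this
      push_cast at this
      constructor <;> linarith [this.1, this.2]
  have hleft : u (-t₁) = k * π ∨ u (-t₁) = (k + 1) * π := by
    simp only [zero_sub] at hu₁
    push_cast at hu₁
    rcases hu₁ with h' | h'
    · right; linarith
    · left; linarith
  have hmono := h.strictMonoOn hG (convex_Icc (-t₁) t₂) (by rw [interior_Icc]; exact hstrip)
  refine ⟨k, -t₁, t₂, hlt, hstrip, hleft, hu₂, hmono, ?_⟩
  have hne : y (-t₁) ≠ y t₂ := by
    intro h'
    have := hmono (left_mem_Icc.2 hlt.le) (right_mem_Icc.2 hlt.le) hlt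
    simp only [h'] at this
    exact lt_irrefl _ this
  have e1 : y (-t₁) = α ∨ y (-t₁) = β := by
    rcases hleft with h' | h'
    · exact hend k _ h'
    · exact hend (k + 1) _ (by push_cast; exact h')
  have e2 : y t₂ = α ∨ y t₂ = β := by
    rcases hu₂ with h' | h'
    · exact hend k _ h'
    · exact hend (k + 1) _ (by push_cast; exact h')
  rcases e1 with e1 | e1 <;> rcases e2 with e2 | e2
  · exact absurd (e1.trans e2.symm) hne
  · exact Or.inl ⟨e1, e2⟩
  · exact Or.inr ⟨e1, e2⟩
  · exact absurd (e1.trans e2.symm) hne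

/-- Two reflections make a period. -/
theorem period (hW : ContDiff ℝ 2 W) (hGc : ContDiff ℝ 1 G) (h : IsFlow W G u y) {k : ℤ} {t₁ t₂ : ℝ}
    (hp : IsHalfPeriod u y α β k t₁ t₂) (t : ℝ) :
    u (t + 2 * (t₂ - t₁)) = u t + 2 * (u t₂ - u t₁) ∧ y (t + 2 * (t₂ - t₁)) = y t := by
  obtain ⟨m₁, hm₁⟩ : ∃ m : ℤ, u t₁ = m * π :=
    hp.left.elim (fun h => ⟨k, h⟩) fun h => ⟨k + 1, by push_cast; exact h⟩
  obtain ⟨m₂, hm₂⟩ : ∃ m : ℤ, u t₂ = m * π :=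
    hp.right.elim (fun h => ⟨k, h⟩) fun h => ⟨k + 1, by push_cast; exact h⟩
  have h1 := h.reflect hW hGc hm₁ t
  have h2 := h.reflect hW hGc hm₂ (2 * t₁ - t)
  rw [show t + 2 * (t₂ - t₁) = 2 * t₂ - (2 * t₁ - t) by ring]
  exact ⟨by rw [h2.1, h1.1]; ring, by rw [h2.2, h1.2]⟩

/-- The velocity `X (y t)` is symmetric about `t₁` and about `t₂`, so `x` is point symmetric about
both times; the two symmetries compose to a translation. -/
theorem period_integral (hW : ContDiff ℝ 2 W) (hGc : ContDiff ℝ 1 G) (h : IsFlow W G u y) {k : ℤ}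
    {t₁ t₂ : ℝ} (hp : IsHalfPeriod u y α β k t₁ t₂) {x X : ℝ → ℝ}
    (hx : ∀ t, HasDerivAt x (X (y t)) t) (t : ℝ) :
    x (t + 2 * (t₂ - t₁)) = x t + 2 * (x t₂ - x t₁) := by
  obtain ⟨m₁, hm₁⟩ : ∃ m : ℤ, u t₁ = m * π :=
    hp.left.elim (fun h => ⟨k, h⟩) fun h => ⟨k + 1, by push_cast; exact h⟩
  obtain ⟨m₂, hm₂⟩ : ∃ m : ℤ, u t₂ = m * π :=
    hp.right.elim (fun h => ⟨k, h⟩) fun h => ⟨k + 1, by push_cast; exact h⟩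
  have h1 := reflect_of_hasDerivAt hx (c := t₁) (fun t => by rw [(h.reflect hW hGc hm₁ t).2]) t
  have h2 := reflect_of_hasDerivAt hx (c := t₂) (fun t => by rw [(h.reflect hW hGc hm₂ t).2])
    (2 * t₁ - t)
  rw [show t + 2 * (t₂ - t₁) = 2 * t₂ - (2 * t₁ - t) by ring, h2, h1]; ring

end IsFlow

/-! ### The level sets of the reduced Hamiltonian -/

/-- The height of the second vortex at momentum `C`. -/
def height₂ (Γ₁ Γ₂ C y : ℝ) : ℝ := (C - Γ₁ * y) / Γ₂

/-- Half of `coshDiff - cos u` is `gapEven`, and half of `coshSum + cos u` is `gapOdd`. -/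
def coshDiff (Γ₁ Γ₂ C y : ℝ) : ℝ := cosh (y - height₂ Γ₁ Γ₂ C y)

def coshSum (Γ₁ Γ₂ C y : ℝ) : ℝ := cosh (y + height₂ Γ₁ Γ₂ C y)

/-- The self-interaction part of the Hamiltonian, exponentiated. -/
def selfFactor (Γ₁ Γ₂ C y : ℝ) : ℝ :=
  exp (Γ₁ / Γ₂ * log (cosh y) + Γ₂ / Γ₁ * log (cosh (height₂ Γ₁ Γ₂ C y)))

/-- On the level set with parameter `e` the horizontal separation satisfies
`cos u = levelCos e y`. -/
def levelCos (Γ₁ Γ₂ C e y : ℝ) : ℝ :=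
  (coshDiff Γ₁ Γ₂ C y - e * selfFactor Γ₁ Γ₂ C y * coshSum Γ₁ Γ₂ C y) / (1 + e * selfFactor Γ₁ Γ₂ C y)

/-- On the level set with parameter `e` the vertical velocity of the first vortex is
`sin u * levelSpeed e y`. -/
def levelSpeed (Γ₁ Γ₂ C e y : ℝ) : ℝ :=
  Γ₂ / (4 * π) * (1 + e * selfFactor Γ₁ Γ₂ C y) ^ 2 /
    (e * selfFactor Γ₁ Γ₂ C y * (coshDiff Γ₁ Γ₂ C y + coshSum Γ₁ Γ₂ C y))

/-- The horizontal velocity of the first vortex on a level set. -/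
def levelDrift₁ (Γ₁ Γ₂ C e y : ℝ) : ℝ :=
  -(1 / (4 * π)) * (Γ₂ * (sinh (y - height₂ Γ₁ Γ₂ C y) * (1 + e * selfFactor Γ₁ Γ₂ C y) /
      (e * selfFactor Γ₁ Γ₂ C y * (coshDiff Γ₁ Γ₂ C y + coshSum Γ₁ Γ₂ C y)))
    - Γ₂ * (sinh (y + height₂ Γ₁ Γ₂ C y) * (1 + e * selfFactor Γ₁ Γ₂ C y) /
      (coshDiff Γ₁ Γ₂ C y + coshSum Γ₁ Γ₂ C y)) - Γ₁ * tanh y)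

/-- The horizontal velocity of the second vortex on a level set. -/
def levelDrift₂ (Γ₁ Γ₂ C e y : ℝ) : ℝ :=
  -(1 / (4 * π)) * (-(Γ₁ * (sinh (y - height₂ Γ₁ Γ₂ C y) * (1 + e * selfFactor Γ₁ Γ₂ C y) /
      (e * selfFactor Γ₁ Γ₂ C y * (coshDiff Γ₁ Γ₂ C y + coshSum Γ₁ Γ₂ C y))))
    - Γ₁ * (sinh (y + height₂ Γ₁ Γ₂ C y) * (1 + e * selfFactor Γ₁ Γ₂ C y) /
      (coshDiff Γ₁ Γ₂ C y + coshSum Γ₁ Γ₂ C y)) - Γ₂ * tanh (height₂ Γ₁ Γ₂ C y))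

/-- The parameter of the level set through a point; it is `exp (-4πh / (Γ₁ Γ₂))`. -/
def levelParam (Γ₁ Γ₂ C : ℝ) (q : ℝ × ℝ) : ℝ :=
  (coshDiff Γ₁ Γ₂ C q.2 - cos q.1) / ((coshSum Γ₁ Γ₂ C q.2 + cos q.1) * selfFactor Γ₁ Γ₂ C q.2)

section Basic

variable {Γ₁ Γ₂ C : ℝ}

theorem selfFactor_pos (y : ℝ) : 0 < selfFactor Γ₁ Γ₂ C y := exp_pos _

theorem one_le_coshDiff (y : ℝ) : 1 ≤ coshDiff Γ₁ Γ₂ C y := one_le_cosh _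

theorem one_le_coshSum (y : ℝ) : 1 ≤ coshSum Γ₁ Γ₂ C y := one_le_cosh _

theorem coshDiff_add_coshSum_pos (y : ℝ) : 0 < coshDiff Γ₁ Γ₂ C y + coshSum Γ₁ Γ₂ C y := by
  linarith [one_le_coshDiff (Γ₁ := Γ₁) (Γ₂ := Γ₂) (C := C) y,
    one_le_coshSum (Γ₁ := Γ₁) (Γ₂ := Γ₂) (C := C) y]

theorem one_add_mul_selfFactor_pos {e : ℝ} (he : 0 ≤ e) (y : ℝ) :
    0 < 1 + e * selfFactor Γ₁ Γ₂ C y := by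
  have := mul_nonneg he (selfFactor_pos (Γ₁ := Γ₁) (Γ₂ := Γ₂) (C := C) y).le
  linarith

theorem hasDerivAt_height₂ (y : ℝ) : HasDerivAt (height₂ Γ₁ Γ₂ C) (-(Γ₁ / Γ₂)) y := by
  have h := (((hasDerivAt_id y).const_mul Γ₁).const_sub C).div_const Γ₂
  simp only [mul_one, id, neg_div] at h
  exact h

theorem hasDerivAt_coshDiff (y : ℝ) : HasDerivAt (coshDiff Γ₁ Γ₂ C)
    (sinh (y - height₂ Γ₁ Γ₂ C y) * (1 + Γ₁ / Γ₂)) y := by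
  have h := ((hasDerivAt_id y).sub (hasDerivAt_height₂ (Γ₁ := Γ₁) (Γ₂ := Γ₂) (C := C) y)).cosh
  rw [sub_neg_eq_add] at h
  exact h

theorem hasDerivAt_coshSum (y : ℝ) : HasDerivAt (coshSum Γ₁ Γ₂ C)
    (sinh (y + height₂ Γ₁ Γ₂ C y) * (1 - Γ₁ / Γ₂)) y := by
  have h := ((hasDerivAt_id y).add (hasDerivAt_height₂ (Γ₁ := Γ₁) (Γ₂ := Γ₂) (C := C) y)).cosh
  rw [← sub_eq_add_neg] at h
  exact h

theorem hasDerivAt_log_cosh (y : ℝ) : HasDerivAt (fun y => log (cosh y)) (tanh y) y := by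
  have h := (hasDerivAt_cosh y).log (cosh_pos y).ne'
  rwa [← tanh_eq_sinh_div_cosh] at h

theorem hasDerivAt_selfFactor (h₁ : Γ₁ ≠ 0) (h₂ : Γ₂ ≠ 0) (y : ℝ) : HasDerivAt (selfFactor Γ₁ Γ₂ C)
    (selfFactor Γ₁ Γ₂ C y * (Γ₁ / Γ₂ * tanh y - tanh (height₂ Γ₁ Γ₂ C y))) y := by
  have h := (((hasDerivAt_log_cosh y).const_mul (Γ₁ / Γ₂)).add
    (((hasDerivAt_log_cosh _).comp y (hasDerivAt_height₂ (Γ₁ := Γ₁) (Γ₂ := Γ₂) (C := C) y)).const_mul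
      (Γ₂ / Γ₁))).exp
  have e : Γ₂ / Γ₁ * (tanh (height₂ Γ₁ Γ₂ C y) * -(Γ₁ / Γ₂)) = -tanh (height₂ Γ₁ Γ₂ C y) := by
    field_simp
  rw [e, ← sub_eq_add_neg] at h
  exact h

theorem hasDerivAt_levelCos (h₁ : Γ₁ ≠ 0) (h₂ : Γ₂ ≠ 0) {e : ℝ} (he : 0 < e) (y : ℝ) :
    HasDerivAt (levelCos Γ₁ Γ₂ C e)
      (((sinh (y - height₂ Γ₁ Γ₂ C y) * (1 + Γ₁ / Γ₂)
          - e * selfFactor Γ₁ Γ₂ C y * (sinh (y + height₂ Γ₁ Γ₂ C y) * (1 - Γ₁ / Γ₂)))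
          * (1 + e * selfFactor Γ₁ Γ₂ C y)
        - e * selfFactor Γ₁ Γ₂ C y * (Γ₁ / Γ₂ * tanh y - tanh (height₂ Γ₁ Γ₂ C y)) *
          (coshDiff Γ₁ Γ₂ C y + coshSum Γ₁ Γ₂ C y)) / (1 + e * selfFactor Γ₁ Γ₂ C y) ^ 2) y := by
  have hg := (hasDerivAt_selfFactor (C := C) h₁ h₂ y).const_mul e
  have h := ((hasDerivAt_coshDiff (Γ₁ := Γ₁) (Γ₂ := Γ₂) (C := C) y).sub
    (hg.mul (hasDerivAt_coshSum (Γ₁ := Γ₁) (Γ₂ := Γ₂) (C := C) y))).div (hg.const_add 1)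
    (one_add_mul_selfFactor_pos he.le y).ne'
  refine h.congr_deriv ?_
  congr 1
  simp only [Pi.mul_apply, Pi.sub_apply]
  ring

theorem contDiff_height₂ {n : WithTop ℕ∞} : ContDiff ℝ n (height₂ Γ₁ Γ₂ C) := by
  unfold height₂; fun_prop

theorem contDiff_coshDiff {n : WithTop ℕ∞} : ContDiff ℝ n (coshDiff Γ₁ Γ₂ C) :=
  (contDiff_id.sub contDiff_height₂).cosh

theorem contDiff_coshSum {n : WithTop ℕ∞} : ContDiff ℝ n (coshSum Γ₁ Γ₂ C) :=
  (contDiff_id.add contDiff_height₂).cosh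

theorem contDiff_selfFactor {n : WithTop ℕ∞} : ContDiff ℝ n (selfFactor Γ₁ Γ₂ C) :=
  ((contDiff_const.mul (contDiff_cosh.log fun y => (cosh_pos y).ne')).add
    (contDiff_const.mul (contDiff_height₂.cosh.log fun _ => (cosh_pos _).ne'))).exp

theorem contDiff_levelCos {n : WithTop ℕ∞} {e : ℝ} (he : 0 < e) :
    ContDiff ℝ n (levelCos Γ₁ Γ₂ C e) :=
  (contDiff_coshDiff.sub ((contDiff_const.mul contDiff_selfFactor).mul contDiff_coshSum)).div
    (contDiff_const.add (contDiff_const.mul contDiff_selfFactor))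
    fun y => (one_add_mul_selfFactor_pos he.le y).ne'

theorem contDiff_levelSpeed {n : WithTop ℕ∞} {e : ℝ} (he : 0 < e) :
    ContDiff ℝ n (levelSpeed Γ₁ Γ₂ C e) :=
  (contDiff_const.mul ((contDiff_const.add (contDiff_const.mul contDiff_selfFactor)).pow 2)).div
    ((contDiff_const.mul contDiff_selfFactor).mul (contDiff_coshDiff.add contDiff_coshSum))
    fun y => (mul_pos (mul_pos he (selfFactor_pos y)) (coshDiff_add_coshSum_pos y)).ne'

theorem continuous_height₂ : Continuous (height₂ Γ₁ Γ₂ C) :=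
  (contDiff_height₂ (n := 0)).continuous

theorem continuous_levelDrift₂ {e : ℝ} (he : 0 < e) : Continuous (levelDrift₂ Γ₁ Γ₂ C e) := by
  have h1 := continuous_height₂ (Γ₁ := Γ₁) (Γ₂ := Γ₂) (C := C)
  have h2 := (contDiff_coshDiff (Γ₁ := Γ₁) (Γ₂ := Γ₂) (C := C) (n := 0)).continuous
  have h3 := (contDiff_coshSum (Γ₁ := Γ₁) (Γ₂ := Γ₂) (C := C) (n := 0)).continuous
  have h4 := (contDiff_selfFactor (Γ₁ := Γ₁) (Γ₂ := Γ₂) (C := C) (n := 0)).continuous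
  have ht : Continuous tanh := by
    rw [show tanh = fun x => sinh x / cosh x from funext tanh_eq_sinh_div_cosh]
    exact continuous_sinh.div continuous_cosh fun x => (cosh_pos x).ne'
  have hs1 := continuous_sinh.comp (continuous_id.sub h1)
  have hs2 := continuous_sinh.comp (continuous_id.add h1)
  have hn1 : ∀ y, e * selfFactor Γ₁ Γ₂ C y * (coshDiff Γ₁ Γ₂ C y + coshSum Γ₁ Γ₂ C y) ≠ 0 :=
    fun y => (mul_pos (mul_pos he (selfFactor_pos y)) (coshDiff_add_coshSum_pos y)).ne'
  have hn2 : ∀ y, coshDiff Γ₁ Γ₂ C y + coshSum Γ₁ Γ₂ C y ≠ 0 :=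
    fun y => (coshDiff_add_coshSum_pos y).ne'
  have hk : Continuous fun y => 1 + e * selfFactor Γ₁ Γ₂ C y :=
    continuous_const.add (continuous_const.mul h4)
  exact continuous_const.mul ((((continuous_const.mul ((hs1.mul hk).div
    ((continuous_const.mul h4).mul (h2.add h3)) hn1)).neg).sub
    (continuous_const.mul ((hs2.mul hk).div (h2.add h3) hn2))).sub
    (continuous_const.mul (ht.comp h1)))

theorem levelSpeed_pos (h₂ : 0 < Γ₂) {e : ℝ} (he : 0 < e) (y : ℝ) : 0 < levelSpeed Γ₁ Γ₂ C e y := by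
  have h1 := one_add_mul_selfFactor_pos (Γ₁ := Γ₁) (Γ₂ := Γ₂) (C := C) he.le y
  have h3 := coshDiff_add_coshSum_pos (Γ₁ := Γ₁) (Γ₂ := Γ₂) (C := C) y
  have h4 := selfFactor_pos (Γ₁ := Γ₁) (Γ₂ := Γ₂) (C := C) y
  unfold levelSpeed
  have := pi_pos
  positivity

/-- The difference of the horizontal velocities. -/
theorem levelDrift_sub (h₁ : Γ₁ ≠ 0) (h₂ : Γ₂ ≠ 0) {e : ℝ} (he : 0 < e) (y : ℝ) :
    levelDrift₁ Γ₁ Γ₂ C e y - levelDrift₂ Γ₁ Γ₂ C e y =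
      -(deriv (levelCos Γ₁ Γ₂ C e) y * levelSpeed Γ₁ Γ₂ C e y) := by
  rw [(hasDerivAt_levelCos h₁ h₂ he y).deriv]
  unfold levelDrift₁ levelDrift₂ levelSpeed
  have h1 := (one_add_mul_selfFactor_pos (Γ₁ := Γ₁) (Γ₂ := Γ₂) (C := C) he.le y).ne'
  have h3 := (coshDiff_add_coshSum_pos (Γ₁ := Γ₁) (Γ₂ := Γ₂) (C := C) y).ne'
  have h4 := (selfFactor_pos (Γ₁ := Γ₁) (Γ₂ := Γ₂) (C := C) y).ne'
  have := pi_pos.ne'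
  have := he.ne'
  generalize selfFactor Γ₁ Γ₂ C y = g at *
  generalize coshDiff Γ₁ Γ₂ C y = A at *
  generalize coshSum Γ₁ Γ₂ C y = B at *
  field_simp
  ring

theorem gapEven_eq (z : ℂ × ℂ) :
    gapEven z = (cosh (z.1.im - z.2.im) - cos (z.1.re - z.2.re)) / 2 := by
  have h1 := cos_sq ((z.1.re - z.2.re) / 2)
  have h2 := sin_sq_add_cos_sq ((z.1.re - z.2.re) / 2)
  have h3 := cosh_two_mul ((z.1.im - z.2.im) / 2)
  have h4 := cosh_sq ((z.1.im - z.2.im) / 2)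
  rw [mul_div_cancel₀ _ (two_ne_zero' ℝ)] at h1 h3
  unfold gapEven
  linarith

theorem gapOdd_eq (z : ℂ × ℂ) :
    gapOdd z = (cosh (z.1.im + z.2.im) + cos (z.1.re - z.2.re)) / 2 := by
  have h1 := cos_sq ((z.1.re - z.2.re) / 2)
  have h3 := cosh_two_mul ((z.1.im + z.2.im) / 2)
  have h4 := cosh_sq ((z.1.im + z.2.im) / 2)
  rw [mul_div_cancel₀ _ (two_ne_zero' ℝ)] at h1 h3
  unfold gapOdd
  linarith

theorem noCollision_iff (z : ℂ × ℂ) : NoCollision z ↔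
    0 < cosh (z.1.im - z.2.im) - cos (z.1.re - z.2.re) ∧
      0 < cosh (z.1.im + z.2.im) + cos (z.1.re - z.2.re) := by
  have h1 := one_le_cosh (z.1.im - z.2.im)
  have h2 := one_le_cosh (z.1.im + z.2.im)
  have h3 := cos_le_one (z.1.re - z.2.re)
  have h4 := neg_one_le_cos (z.1.re - z.2.re)
  rw [NoCollision, gapEven_eq, gapOdd_eq]
  constructor
  · rintro ⟨h5, h6⟩
    refine ⟨(by linarith : (0 : ℝ) ≤ _).lt_of_ne ?_, (by linarith : (0 : ℝ) ≤ _).lt_of_ne ?_⟩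
    · intro h; exact h5 (by rw [← h]; simp)
    · intro h; exact h6 (by rw [← h]; simp)
  · rintro ⟨h5, h6⟩
    constructor <;> positivity

theorem mem_reducedDomain_iff (q : ℝ × ℝ) : q ∈ reducedDomain Γ₁ Γ₂ C ↔
    0 < coshDiff Γ₁ Γ₂ C q.2 - cos q.1 ∧ 0 < coshSum Γ₁ Γ₂ C q.2 + cos q.1 := by
  show NoCollision _ ↔ _
  rw [noCollision_iff]
  simp [expand, coshDiff, coshSum, height₂]

theorem isOpen_reducedDomain : IsOpen (reducedDomain Γ₁ Γ₂ C) := by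
  have h1 := (contDiff_coshDiff (Γ₁ := Γ₁) (Γ₂ := Γ₂) (C := C) (n := 0)).continuous
  have h2 := (contDiff_coshSum (Γ₁ := Γ₁) (Γ₂ := Γ₂) (C := C) (n := 0)).continuous
  have : reducedDomain Γ₁ Γ₂ C = {q | 0 < coshDiff Γ₁ Γ₂ C q.2 - cos q.1} ∩
      {q | 0 < coshSum Γ₁ Γ₂ C q.2 + cos q.1} := by
    ext q; exact mem_reducedDomain_iff q
  rw [this]
  exact (isOpen_lt continuous_const ((h1.comp continuous_snd).sub
    (continuous_cos.comp continuous_fst))).inter (isOpen_lt continuous_const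
    ((h2.comp continuous_snd).add (continuous_cos.comp continuous_fst)))

theorem levelParam_pos {q : ℝ × ℝ} (hq : q ∈ reducedDomain Γ₁ Γ₂ C) : 0 < levelParam Γ₁ Γ₂ C q := by
  obtain ⟨h1, h2⟩ := (mem_reducedDomain_iff q).1 hq
  exact div_pos h1 (mul_pos h2 (selfFactor_pos _))

/-- The equation `levelParam = e` is linear in `cos u` once the denominator is cleared. Conversely
the curve avoids the collision points by itself: the two gaps have positive ratio and positive sum,
so both are positive. -/
theorem mem_cosCurve_levelCos_iff {e : ℝ} (he : 0 < e) (q : ℝ × ℝ) :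
    q ∈ cosCurve (levelCos Γ₁ Γ₂ C e) ↔ q ∈ reducedDomain Γ₁ Γ₂ C ∧ levelParam Γ₁ Γ₂ C q = e := by
  have hg := selfFactor_pos (Γ₁ := Γ₁) (Γ₂ := Γ₂) (C := C) q.2
  have hAB := coshDiff_add_coshSum_pos (Γ₁ := Γ₁) (Γ₂ := Γ₂) (C := C) q.2
  have hK := one_add_mul_selfFactor_pos (Γ₁ := Γ₁) (Γ₂ := Γ₂) (C := C) he.le q.2
  rw [mem_reducedDomain_iff]
  show cos q.1 = levelCos Γ₁ Γ₂ C e q.2 ↔ _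
  unfold levelCos levelParam
  set A := coshDiff Γ₁ Γ₂ C q.2
  set B := coshSum Γ₁ Γ₂ C q.2
  set g := selfFactor Γ₁ Γ₂ C q.2
  have hegp : 0 < e * g := mul_pos he hg
  rw [eq_div_iff hK.ne']
  constructor
  · intro h
    have h1 : A - cos q.1 = e * g * (B + cos q.1) := by linarith
    have h2 : 0 < B + cos q.1 := by
      by_contra! hcon
      have := mul_nonpos_of_nonneg_of_nonpos hegp.le hcon
      linarith
    refine ⟨⟨by rw [h1]; positivity, h2⟩, ?_⟩
    rw [div_eq_iff (by positivity), h1]; ring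
  · rintro ⟨⟨h1, h2⟩, h⟩
    rw [div_eq_iff (by positivity)] at h
    linarith

theorem mem_cosCurve_self {q : ℝ × ℝ} (hq : q ∈ reducedDomain Γ₁ Γ₂ C) :
    q ∈ cosCurve (levelCos Γ₁ Γ₂ C (levelParam Γ₁ Γ₂ C q)) :=
  (mem_cosCurve_levelCos_iff (levelParam_pos hq) q).2 ⟨hq, rfl⟩

theorem reducedHamiltonian_eq (h₁ : Γ₁ ≠ 0) (h₂ : Γ₂ ≠ 0) {q : ℝ × ℝ}
    (hq : q ∈ reducedDomain Γ₁ Γ₂ C) :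
    reducedHamiltonian Γ₁ Γ₂ C q = -(Γ₁ * Γ₂ / (4 * π)) * log (levelParam Γ₁ Γ₂ C q) := by
  obtain ⟨h3, h4⟩ := (mem_reducedDomain_iff q).1 hq
  have hE : gapEven (expand Γ₁ Γ₂ C q) = (coshDiff Γ₁ Γ₂ C q.2 - cos q.1) / 2 := by
    rw [gapEven_eq]; simp [expand, coshDiff, height₂]
  have hO : gapOdd (expand Γ₁ Γ₂ C q) = (coshSum Γ₁ Γ₂ C q.2 + cos q.1) / 2 := by
    rw [gapOdd_eq]; simp [expand, coshSum, height₂]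
  have hs : ∀ x : ℝ, log (1 + sinh x ^ 2) = 2 * log (cosh x) := by
    intro x
    rw [add_comm, ← cosh_sq, log_pow]; norm_num
  rw [reducedHamiltonian, hamiltonian, hE, hO, hs, hs, levelParam,
    log_div h3.ne' (mul_pos h4 (selfFactor_pos _)).ne', log_mul h4.ne' (selfFactor_pos _).ne',
    log_div h3.ne' two_ne_zero, log_div h4.ne' two_ne_zero, selfFactor, log_exp]
  have e1 : (expand Γ₁ Γ₂ C q).1.im = q.2 := rfl
  have e2 : (expand Γ₁ Γ₂ C q).2.im = height₂ Γ₁ Γ₂ C q.2 := rfl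
  rw [e1, e2]
  have := pi_pos.ne'
  field_simp
  ring

theorem levelSet_eq (h₁ : Γ₁ ≠ 0) (h₂ : Γ₂ ≠ 0) {p : ℝ × ℝ} (hp : p ∈ reducedDomain Γ₁ Γ₂ C) :
    {q | q ∈ reducedDomain Γ₁ Γ₂ C ∧ reducedHamiltonian Γ₁ Γ₂ C q = reducedHamiltonian Γ₁ Γ₂ C p} =
      cosCurve (levelCos Γ₁ Γ₂ C (levelParam Γ₁ Γ₂ C p)) := by
  ext q
  rw [mem_cosCurve_levelCos_iff (levelParam_pos hp)]
  refine and_congr_right fun hq => ?_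
  rw [reducedHamiltonian_eq h₁ h₂ hq, reducedHamiltonian_eq h₁ h₂ hp]
  have hc : -(Γ₁ * Γ₂ / (4 * π)) ≠ 0 := by
    have := pi_pos.ne'
    simp [h₁, h₂, this]
  rw [mul_right_inj' hc]
  exact ⟨fun h => log_injOn_pos (levelParam_pos hq) (levelParam_pos hp) h, fun h => by rw [h]⟩

theorem levelCurve_eq (h₁ : Γ₁ ≠ 0) (h₂ : Γ₂ ≠ 0) {p : ℝ × ℝ} (hp : p ∈ reducedDomain Γ₁ Γ₂ C) :
    levelCurve Γ₁ Γ₂ C p =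
      connectedComponentIn (cosCurve (levelCos Γ₁ Γ₂ C (levelParam Γ₁ Γ₂ C p))) p := by
  rw [levelCurve, levelSet_eq h₁ h₂ hp]

/-- Near `q` one has `levelParam = e + c · f`, where `e` is the value at `q`, `f = levelCos e y -
cos u` and `c > 0`. Since `f` vanishes at `q`, only `c · df` survives. -/
theorem hasFDerivAt_levelParam {q : ℝ × ℝ}
    (hq : q ∈ reducedDomain Γ₁ Γ₂ C) : ∃ c : ℝ, 0 < c ∧
      HasFDerivAt (levelParam Γ₁ Γ₂ C) (c • (sin q.1 • ContinuousLinearMap.fst ℝ ℝ ℝ +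
        deriv (levelCos Γ₁ Γ₂ C (levelParam Γ₁ Γ₂ C q)) q.2 • ContinuousLinearMap.snd ℝ ℝ ℝ)) q := by
  set e := levelParam Γ₁ Γ₂ C q with he_def
  have he : 0 < e := levelParam_pos hq
  have hW : cos q.1 = levelCos Γ₁ Γ₂ C e q.2 := mem_cosCurve_self hq
  set c : ℝ × ℝ → ℝ := fun r => (1 + e * selfFactor Γ₁ Γ₂ C r.2) /
    ((coshSum Γ₁ Γ₂ C r.2 + cos r.1) * selfFactor Γ₁ Γ₂ C r.2) with hc
  set f : ℝ × ℝ → ℝ := fun r => levelCos Γ₁ Γ₂ C e r.2 - cos r.1 with hf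
  have hnhds : reducedDomain Γ₁ Γ₂ C ∈ 𝓝 q := isOpen_reducedDomain.mem_nhds hq
  have heq : (fun r => e + c r * f r) =ᶠ[𝓝 q] levelParam Γ₁ Γ₂ C := by
    filter_upwards [hnhds] with r hr
    obtain ⟨h3, h4⟩ := (mem_reducedDomain_iff r).1 hr
    have h5 := selfFactor_pos (Γ₁ := Γ₁) (Γ₂ := Γ₂) (C := C) r.2
    have h6 := one_add_mul_selfFactor_pos (Γ₁ := Γ₁) (Γ₂ := Γ₂) (C := C) he.le r.2
    have h7 := h4.ne'
    simp only [hc, hf, levelCos, levelParam]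
    field_simp
    ring
  obtain ⟨h3, h4⟩ := (mem_reducedDomain_iff q).1 hq
  have hcd : DifferentiableAt ℝ c q := by
    have hg : Differentiable ℝ fun r : ℝ × ℝ => selfFactor Γ₁ Γ₂ C r.2 :=
      (contDiff_selfFactor.differentiable one_ne_zero).comp differentiable_snd
    have hB : Differentiable ℝ fun r : ℝ × ℝ => coshSum Γ₁ Γ₂ C r.2 :=
      (contDiff_coshSum.differentiable one_ne_zero).comp differentiable_snd
    have hcos : Differentiable ℝ fun r : ℝ × ℝ => cos r.1 := differentiable_cos.comp differentiable_fst
    have hn : (coshSum Γ₁ Γ₂ C q.2 + cos q.1) * selfFactor Γ₁ Γ₂ C q.2 ≠ 0 :=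
      (mul_pos h4 (selfFactor_pos _)).ne'
    have hd2 : DifferentiableAt ℝ (fun r : ℝ × ℝ =>
        (coshSum Γ₁ Γ₂ C r.2 + cos r.1) * selfFactor Γ₁ Γ₂ C r.2) q := ((hB.fun_add hcos).fun_mul hg) q
    have hd1 : DifferentiableAt ℝ (fun r : ℝ × ℝ => 1 + e * selfFactor Γ₁ Γ₂ C r.2) q :=
      ((hg.const_mul e).const_add 1) q
    simp only [hc, div_eq_mul_inv]
    exact hd1.fun_mul (hd2.fun_inv hn)
  have hfd : HasFDerivAt f (sin q.1 • ContinuousLinearMap.fst ℝ ℝ ℝ +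
      deriv (levelCos Γ₁ Γ₂ C e) q.2 • ContinuousLinearMap.snd ℝ ℝ ℝ) q := by
    have h5 := ((contDiff_levelCos (Γ₁ := Γ₁) (Γ₂ := Γ₂) (C := C) he (n := 1)).differentiable
      one_ne_zero q.2).hasDerivAt.comp_hasFDerivAt q (hasFDerivAt_snd (𝕜 := ℝ) (p := q))
    have h6 := (hasDerivAt_cos q.1).comp_hasFDerivAt q (hasFDerivAt_fst (𝕜 := ℝ) (p := q))
    have h7 := h5.sub h6
    rw [neg_smul, sub_neg_eq_add, add_comm] at h7
    exact h7
  have hf0 : f q = 0 := by simp [hf, hW]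
  refine ⟨c q, div_pos (one_add_mul_selfFactor_pos he.le _) (mul_pos h4 (selfFactor_pos _)), ?_⟩
  have h := (hcd.hasFDerivAt.mul hfd).const_add e
  rw [hf0, zero_smul, add_zero] at h
  exact h.congr_of_eventuallyEq heq.symm

/-- The Hamiltonian is a nonzero multiple of the logarithm of `levelParam`, so its differential is a
nonzero multiple of `(sin u, W'(y))`. -/
theorem isCritical_iff (h₁ : Γ₁ ≠ 0) (h₂ : Γ₂ ≠ 0) (q : ℝ × ℝ) : IsCritical Γ₁ Γ₂ C q ↔
    q ∈ reducedDomain Γ₁ Γ₂ C ∧ sin q.1 = 0 ∧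
      deriv (levelCos Γ₁ Γ₂ C (levelParam Γ₁ Γ₂ C q)) q.2 = 0 := by
  refine and_congr_right fun hq => ?_
  obtain ⟨c, hc, hd⟩ := hasFDerivAt_levelParam hq
  have hpos := levelParam_pos hq
  have hd2 := (hd.log hpos.ne').const_mul (-(Γ₁ * Γ₂ / (4 * π)))
  have heq : (fun q => -(Γ₁ * Γ₂ / (4 * π)) * log (levelParam Γ₁ Γ₂ C q)) =ᶠ[𝓝 q]
      reducedHamiltonian Γ₁ Γ₂ C := by
    filter_upwards [isOpen_reducedDomain.mem_nhds hq] with r hr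
    exact (reducedHamiltonian_eq h₁ h₂ hr).symm
  rw [(hd2.congr_of_eventuallyEq heq.symm).fderiv, smul_smul, smul_smul]
  have hc : -(Γ₁ * Γ₂ / (4 * π)) * (levelParam Γ₁ Γ₂ C q)⁻¹ * c ≠ 0 := by
    have := pi_pos.ne'
    have := hpos.ne'
    have := hc.ne'
    simp [*]
  rw [smul_eq_zero_iff_right hc]
  constructor
  · intro h
    have e1 := DFunLike.congr_fun h ((1, 0) : ℝ × ℝ)
    have e2 := DFunLike.congr_fun h ((0, 1) : ℝ × ℝ)
    simp at e1 e2
    exact ⟨e1, e2⟩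
  · rintro ⟨e1, e2⟩
    rw [e1, e2]; simp

end Basic

/-! ### Motions and flows on level sets -/

section Motion

variable {Γ₁ Γ₂ C : ℝ}

theorem hasDerivAt_complex_iff {f : ℝ → ℂ} {v : ℂ} {t : ℝ} : HasDerivAt f v t ↔
    HasDerivAt (fun t => (f t).re) v.re t ∧ HasDerivAt (fun t => (f t).im) v.im t := by
  constructor
  · intro h
    exact ⟨(Complex.reCLM.hasFDerivAt (x := f t)).comp_hasDerivAt t h,
      (Complex.imCLM.hasFDerivAt (x := f t)).comp_hasDerivAt t h⟩
  · rintro ⟨h1, h2⟩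
    have h := h1.ofReal_comp.add (h2.ofReal_comp.mul_const Complex.I)
    rw [Complex.re_add_im] at h
    exact h.congr_of_eventuallyEq (Eventually.of_forall fun t => (Complex.re_add_im (f t)).symm)

theorem hasDerivAt_pair_iff {s : ℝ → ℂ × ℂ} {v : ℂ × ℂ} {t : ℝ} : HasDerivAt s v t ↔
    HasDerivAt (fun t => (s t).1) v.1 t ∧ HasDerivAt (fun t => (s t).2) v.2 t := by
  constructor
  · intro h
    exact ⟨(hasFDerivAt_fst (𝕜 := ℝ) (p := s t)).comp_hasDerivAt t h,
      (hasFDerivAt_snd (𝕜 := ℝ) (p := s t)).comp_hasDerivAt t h⟩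
  · rintro ⟨h1, h2⟩
    exact h1.prodMk h2

theorem momentum_eq_iff (h₂ : Γ₂ ≠ 0) (z : ℂ × ℂ) :
    momentum Γ₁ Γ₂ z = C ↔ z.2.im = height₂ Γ₁ Γ₂ C z.1.im := by
  rw [momentum, height₂, eq_div_iff h₂]
  constructor <;> intro h <;> linarith

theorem reduce_mem_reducedDomain_iff {z : ℂ × ℂ} (hz : z.2.im = height₂ Γ₁ Γ₂ C z.1.im) :
    reduce z ∈ reducedDomain Γ₁ Γ₂ C ↔ NoCollision z := by
  rw [mem_reducedDomain_iff, noCollision_iff, hz]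
  rfl

/-- On a level set both gaps become functions of `y₁` alone, so `u` enters the velocities only
through the factor `sin u`. -/
theorem velocity_eq (h₂ : Γ₂ ≠ 0) {e : ℝ} (he : 0 < e) {z : ℂ × ℂ}
    (hz : z.2.im = height₂ Γ₁ Γ₂ C z.1.im)
    (hcos : cos (z.1.re - z.2.re) = levelCos Γ₁ Γ₂ C e z.1.im) :
    velocity Γ₁ Γ₂ z =
      (⟨levelDrift₁ Γ₁ Γ₂ C e z.1.im, sin (z.1.re - z.2.re) * levelSpeed Γ₁ Γ₂ C e z.1.im⟩,
       ⟨levelDrift₂ Γ₁ Γ₂ C e z.1.im,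
        -(Γ₁ / Γ₂) * (sin (z.1.re - z.2.re) * levelSpeed Γ₁ Γ₂ C e z.1.im)⟩) := by
  have hg := selfFactor_pos (Γ₁ := Γ₁) (Γ₂ := Γ₂) (C := C) z.1.im
  have hAB := coshDiff_add_coshSum_pos (Γ₁ := Γ₁) (Γ₂ := Γ₂) (C := C) z.1.im
  have hK := one_add_mul_selfFactor_pos (Γ₁ := Γ₁) (Γ₂ := Γ₂) (C := C) he.le z.1.im
  have hE : gapEven z = e * selfFactor Γ₁ Γ₂ C z.1.im *
      (coshDiff Γ₁ Γ₂ C z.1.im + coshSum Γ₁ Γ₂ C z.1.im) /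
        (2 * (1 + e * selfFactor Γ₁ Γ₂ C z.1.im)) := by
    rw [gapEven_eq, hcos, hz, levelCos, ← coshDiff]
    field_simp
    ring
  have hO : gapOdd z = (coshDiff Γ₁ Γ₂ C z.1.im + coshSum Γ₁ Γ₂ C z.1.im) /
        (2 * (1 + e * selfFactor Γ₁ Γ₂ C z.1.im)) := by
    rw [gapOdd_eq, hcos, hz, levelCos, ← coshSum]
    field_simp
    ring
  have e1 : sinh (z.2.im - z.1.im) = -sinh (z.1.im - z.2.im) := by rw [← sinh_neg, neg_sub]
  have e2 : sinh (z.2.im + z.1.im) = sinh (z.1.im + z.2.im) := by rw [add_comm]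
  have e3 : sin (z.2.re - z.1.re) = -sin (z.1.re - z.2.re) := by rw [← sin_neg, neg_sub]
  rw [velocity, hE, hO, e1, e2, e3, hz]
  have := pi_pos.ne'
  have := he.ne'
  unfold levelDrift₁ levelDrift₂ levelSpeed
  generalize selfFactor Γ₁ Γ₂ C z.1.im = g at *
  generalize coshDiff Γ₁ Γ₂ C z.1.im = A at *
  generalize coshSum Γ₁ Γ₂ C z.1.im = B at *
  refine Prod.ext (Complex.ext ?_ ?_) (Complex.ext ?_ ?_) <;> dsimp only <;> field_simp <;> ring

/-- A motion, seen on its level set. -/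
structure IsLevelMotion (Γ₁ Γ₂ C e : ℝ) (s : ℝ → ℂ × ℂ) : Prop where
  pos : 0 < e
  height : ∀ t, (s t).2.im = height₂ Γ₁ Γ₂ C (s t).1.im
  flow : IsFlow (levelCos Γ₁ Γ₂ C e) (levelSpeed Γ₁ Γ₂ C e) (fun t => (s t).1.re - (s t).2.re)
    fun t => (s t).1.im
  drift₁ : ∀ t, HasDerivAt (fun t => (s t).1.re) (levelDrift₁ Γ₁ Γ₂ C e (s t).1.im) t
  drift₂ : ∀ t, HasDerivAt (fun t => (s t).2.re) (levelDrift₂ Γ₁ Γ₂ C e (s t).1.im) t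

theorem IsMotion.momentum_eq {s : ℝ → ℂ × ℂ} (hs : IsMotion Γ₁ Γ₂ s)
    (t : ℝ) : momentum Γ₁ Γ₂ (s t) = momentum Γ₁ Γ₂ (s 0) := by
  have hd : ∀ t, HasDerivAt (fun t => momentum Γ₁ Γ₂ (s t)) 0 t := by
    intro t
    obtain ⟨h3, h4⟩ := hasDerivAt_pair_iff.1 (hs t).2
    have h5 := ((hasDerivAt_complex_iff.1 h3).2.const_mul Γ₁).add
      ((hasDerivAt_complex_iff.1 h4).2.const_mul Γ₂)
    refine h5.congr_deriv ?_
    have e3 : sin ((s t).2.re - (s t).1.re) = -sin ((s t).1.re - (s t).2.re) := by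
      rw [← sin_neg, neg_sub]
    simp only [velocity, e3]
    ring
  exact is_const_of_deriv_eq_zero (fun t => (hd t).differentiableAt) (fun t => (hd t).deriv) t 0

/-- The velocities are first expressed with the level parameter of the current instant; in this form
the derivative of the parameter along the motion vanishes, so the parameter can be frozen at its
initial value. -/
theorem IsMotion.isLevelMotion (h₁ : Γ₁ ≠ 0) (h₂ : Γ₂ ≠ 0) {s : ℝ → ℂ × ℂ}
    (hs : IsMotion Γ₁ Γ₂ s) (hC : momentum Γ₁ Γ₂ (s 0) = C) :
    IsLevelMotion Γ₁ Γ₂ C (levelParam Γ₁ Γ₂ C (reduce (s 0))) s := by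
  have hheight : ∀ t, (s t).2.im = height₂ Γ₁ Γ₂ C (s t).1.im := fun t =>
    (momentum_eq_iff h₂ _).1 ((hs.momentum_eq t).trans hC)
  have hdom : ∀ t, reduce (s t) ∈ reducedDomain Γ₁ Γ₂ C := fun t =>
    (reduce_mem_reducedDomain_iff (hheight t)).2 (hs t).1
  -- velocities with the parameter at time `t`
  have hvel : ∀ t, HasDerivAt s _ t := fun t => by
    have h := (hs t).2
    rw [velocity_eq h₂ (levelParam_pos (hdom t)) (hheight t) (mem_cosCurve_self (hdom t))] at h
    exact h
  have hcomp := fun t => hasDerivAt_pair_iff.1 (hvel t)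
  have hx₁ := fun t => (hasDerivAt_complex_iff.1 (hcomp t).1).1
  have hy₁ := fun t => (hasDerivAt_complex_iff.1 (hcomp t).1).2
  have hx₂ := fun t => (hasDerivAt_complex_iff.1 (hcomp t).2).1
  dsimp only at hx₁ hy₁ hx₂
  have hu := fun t => (hx₁ t).sub (hx₂ t)
  have hconst : ∀ t, levelParam Γ₁ Γ₂ C (reduce (s t)) = levelParam Γ₁ Γ₂ C (reduce (s 0)) := by
    have hd : ∀ t, HasDerivAt (fun t => levelParam Γ₁ Γ₂ C (reduce (s t))) 0 t := by
      intro t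
      obtain ⟨c, -, hc⟩ := hasFDerivAt_levelParam (hdom t)
      have h := hc.comp_hasDerivAt t ((hu t).prodMk (hy₁ t))
      refine h.congr_deriv ?_
      rw [levelDrift_sub h₁ h₂ (levelParam_pos (hdom t))]
      simp only [reduce, smul_apply, add_apply,
        ContinuousLinearMap.coe_fst', ContinuousLinearMap.coe_snd', smul_eq_mul]
      ring
    intro t
    exact is_const_of_deriv_eq_zero (fun t => (hd t).differentiableAt) (fun t => (hd t).deriv) t 0
  have hpos := levelParam_pos (hdom 0)
  simp only [hconst] at hx₁ hy₁ hx₂ hu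
  refine ⟨hpos, hheight, ⟨fun t => ?_, hy₁, fun t => ?_⟩, hx₁, hx₂⟩
  · rw [← levelDrift_sub h₁ h₂ hpos]; exact hu t
  · have := mem_cosCurve_self (hdom t)
    rw [hconst t] at this
    exact this

theorem IsLevelMotion.isMotion (h₂ : Γ₂ ≠ 0) {e : ℝ} {s : ℝ → ℂ × ℂ}
    (hs : IsLevelMotion Γ₁ Γ₂ C e s) : IsMotion Γ₁ Γ₂ s := by
  intro t
  refine ⟨(reduce_mem_reducedDomain_iff (hs.height t)).1
    ((mem_cosCurve_levelCos_iff hs.pos _).1 (hs.flow.curve t)).1, ?_⟩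
  rw [velocity_eq h₂ hs.pos (hs.height t) (hs.flow.curve t), hasDerivAt_pair_iff,
    hasDerivAt_complex_iff, hasDerivAt_complex_iff]
  refine ⟨⟨hs.drift₁ t, hs.flow.hasDerivAt_snd t⟩, hs.drift₂ t, ?_⟩
  have h := (hasDerivAt_height₂ (Γ₁ := Γ₁) (Γ₂ := Γ₂) (C := C) (s t).1.im).comp t
    (hs.flow.hasDerivAt_snd t)
  exact h.congr_of_eventuallyEq (Eventually.of_forall fun t => hs.height t)

/-- Motions exist on bounded level curves. -/
theorem exists_isMotion (h₁ : Γ₁ ≠ 0) (h₂ : Γ₂ ≠ 0) {z₀ : ℂ × ℂ} (hC : momentum Γ₁ Γ₂ z₀ = C)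
    (hdom : reduce z₀ ∈ reducedDomain Γ₁ Γ₂ C) {α β : ℝ}
    (hX : ∀ q ∈ levelCurve Γ₁ Γ₂ C (reduce z₀), q.2 ∈ Icc α β) :
    ∃ s, IsMotion Γ₁ Γ₂ s ∧ s 0 = z₀ := by
  set e := levelParam Γ₁ Γ₂ C (reduce z₀) with he_def
  have he : 0 < e := levelParam_pos hdom
  rw [levelCurve_eq h₁ h₂ hdom] at hX
  obtain ⟨u, y, hf, hu0, hy0⟩ := exists_isFlow (contDiff_levelCos he) (contDiff_levelSpeed he)
    (mem_cosCurve_self hdom) hX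
  have hcont : Continuous fun t => levelDrift₂ Γ₁ Γ₂ C e (y t) :=
    (continuous_levelDrift₂ he).comp hf.continuous_snd
  -- Once `(u, y)` is known, `x₂` follows by a quadrature and `x₁ = x₂ + u`.
  set x : ℝ → ℝ := fun t => z₀.2.re + ∫ τ in (0 : ℝ)..t, levelDrift₂ Γ₁ Γ₂ C e (y τ) with hx
  have hxd : ∀ t, HasDerivAt x (levelDrift₂ Γ₁ Γ₂ C e (y t)) t := fun t =>
    (hcont.integral_hasStrictDerivAt 0 t).hasDerivAt.const_add _
  let s : ℝ → ℂ × ℂ := fun t => (⟨x t + u t, y t⟩, ⟨x t, height₂ Γ₁ Γ₂ C (y t)⟩)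
  have hs : IsLevelMotion Γ₁ Γ₂ C e s := by
    refine ⟨he, fun t => rfl, ?_, fun t => ?_, hxd⟩
    · have : (fun t => (s t).1.re - (s t).2.re) = u := by
        funext t; exact add_sub_cancel_left _ _
      rw [this]; exact hf
    · have h := (hxd t).add (hf.hasDerivAt_fst t)
      rw [← levelDrift_sub h₁ h₂ he] at h
      refine h.congr_deriv ?_
      show _ = levelDrift₁ Γ₁ Γ₂ C e (y t)
      ring
  refine ⟨s, hs.isMotion h₂, ?_⟩
  have hx0 : x 0 = z₀.2.re := by simp [hx]
  refine Prod.ext (Complex.ext ?_ ?_) (Complex.ext ?_ ?_)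
  · show x 0 + u 0 = _
    rw [hx0, hu0]; simp [reduce]
  · exact hy0
  · exact hx0
  · show height₂ Γ₁ Γ₂ C (y 0) = _
    rw [hy0, (momentum_eq_iff h₂ z₀).1 hC]; rfl

end Motion

/-! ### Critical points on the lines `u = 0` and `u = π` -/

def halfDiff (Γ₁ Γ₂ C y : ℝ) : ℝ := (y - height₂ Γ₁ Γ₂ C y) / 2

def halfSum (Γ₁ Γ₂ C y : ℝ) : ℝ := (y + height₂ Γ₁ Γ₂ C y) / 2

/-- Its zeros are the critical points on the line `u = 0`. -/
def critEven (Γ₁ Γ₂ C y : ℝ) : ℝ :=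
  (Γ₁ + Γ₂) * (cosh (halfDiff Γ₁ Γ₂ C y) * cosh (halfSum Γ₁ Γ₂ C y) ^ 3)
    + (Γ₁ - Γ₂) * (sinh (halfDiff Γ₁ Γ₂ C y) ^ 3 * sinh (halfSum Γ₁ Γ₂ C y))

/-- Its zeros are the critical points on the line `u = π`. -/
def critOdd (Γ₁ Γ₂ C y : ℝ) : ℝ :=
  (Γ₁ - Γ₂) * (cosh (halfDiff Γ₁ Γ₂ C y) ^ 3 * cosh (halfSum Γ₁ Γ₂ C y))
    + (Γ₁ + Γ₂) * (sinh (halfDiff Γ₁ Γ₂ C y) * sinh (halfSum Γ₁ Γ₂ C y) ^ 3)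

section Crit

variable {Γ₁ Γ₂ C : ℝ}

theorem coshDiff_eq (y : ℝ) : coshDiff Γ₁ Γ₂ C y = 1 + 2 * sinh (halfDiff Γ₁ Γ₂ C y) ^ 2 := by
  have := cosh_two_mul (halfDiff Γ₁ Γ₂ C y)
  rw [cosh_sq, halfDiff, mul_div_cancel₀ _ (two_ne_zero' ℝ)] at this
  rw [coshDiff, this, halfDiff]; ring

theorem coshSum_eq (y : ℝ) : coshSum Γ₁ Γ₂ C y = 1 + 2 * sinh (halfSum Γ₁ Γ₂ C y) ^ 2 := by
  have := cosh_two_mul (halfSum Γ₁ Γ₂ C y)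
  rw [cosh_sq, halfSum, mul_div_cancel₀ _ (two_ne_zero' ℝ)] at this
  rw [coshSum, this, halfSum]; ring

theorem sinh_sub_height₂ (y : ℝ) : sinh (y - height₂ Γ₁ Γ₂ C y) =
    2 * sinh (halfDiff Γ₁ Γ₂ C y) * cosh (halfDiff Γ₁ Γ₂ C y) := by
  rw [← sinh_two_mul, halfDiff, mul_div_cancel₀ _ (two_ne_zero' ℝ)]

theorem sinh_add_height₂ (y : ℝ) : sinh (y + height₂ Γ₁ Γ₂ C y) =
    2 * sinh (halfSum Γ₁ Γ₂ C y) * cosh (halfSum Γ₁ Γ₂ C y) := by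
  rw [← sinh_two_mul, halfSum, mul_div_cancel₀ _ (two_ne_zero' ℝ)]

theorem halfDiff_eq (h₂ : Γ₂ ≠ 0) (y : ℝ) :
    halfDiff Γ₁ Γ₂ C y = ((Γ₁ + Γ₂) * y - C) / (2 * Γ₂) := by
  rw [halfDiff, height₂]; field_simp; ring

theorem halfSum_eq (h₂ : Γ₂ ≠ 0) (y : ℝ) :
    halfSum Γ₁ Γ₂ C y = (C - (Γ₁ - Γ₂) * y) / (2 * Γ₂) := by
  rw [halfSum, height₂]; field_simp; ring

theorem hasDerivAt_halfDiff (y : ℝ) :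
    HasDerivAt (halfDiff Γ₁ Γ₂ C) ((1 + Γ₁ / Γ₂) / 2) y := by
  have h := ((hasDerivAt_id y).sub (hasDerivAt_height₂ (Γ₁ := Γ₁) (Γ₂ := Γ₂) (C := C) y)).div_const 2
  rw [sub_neg_eq_add] at h
  exact h

theorem hasDerivAt_halfSum (y : ℝ) :
    HasDerivAt (halfSum Γ₁ Γ₂ C) ((1 - Γ₁ / Γ₂) / 2) y := by
  have h := ((hasDerivAt_id y).add (hasDerivAt_height₂ (Γ₁ := Γ₁) (Γ₂ := Γ₂) (C := C) y)).div_const 2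
  rw [← sub_eq_add_neg] at h
  exact h

/-- The logarithmic derivative of the self-interaction factor. -/
theorem selfFactor_logDeriv (y : ℝ) :
    (Γ₁ / Γ₂ * tanh y - tanh (height₂ Γ₁ Γ₂ C y)) * (coshDiff Γ₁ Γ₂ C y + coshSum Γ₁ Γ₂ C y) =
      sinh (y - height₂ Γ₁ Γ₂ C y) * (1 + Γ₁ / Γ₂) - sinh (y + height₂ Γ₁ Γ₂ C y) * (1 - Γ₁ / Γ₂) := by
  have h1 := (cosh_pos y).ne'
  have h2 := (cosh_pos (height₂ Γ₁ Γ₂ C y)).ne'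
  rw [tanh_eq_sinh_div_cosh, tanh_eq_sinh_div_cosh, coshDiff, coshSum, cosh_sub, cosh_add, sinh_sub,
    sinh_add]
  have e : cosh y * cosh (height₂ Γ₁ Γ₂ C y) - sinh y * sinh (height₂ Γ₁ Γ₂ C y) +
      (cosh y * cosh (height₂ Γ₁ Γ₂ C y) + sinh y * sinh (height₂ Γ₁ Γ₂ C y)) =
      2 * cosh y * cosh (height₂ Γ₁ Γ₂ C y) := by ring
  rw [e]
  generalize Γ₁ / Γ₂ = r
  field_simp
  ring

/-- By `selfFactor_logDeriv` the cross terms of the quotient rule cancel: with `k = e * selfFactor`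
the numerator becomes `coshDiff' - k² coshSum'`. -/
theorem deriv_levelCos (h₁ : Γ₁ ≠ 0) (h₂ : Γ₂ ≠ 0) {e : ℝ} (he : 0 < e) (y : ℝ) :
    deriv (levelCos Γ₁ Γ₂ C e) y =
      (sinh (y - height₂ Γ₁ Γ₂ C y) * (1 + Γ₁ / Γ₂) - (e * selfFactor Γ₁ Γ₂ C y) ^ 2 *
        (sinh (y + height₂ Γ₁ Γ₂ C y) * (1 - Γ₁ / Γ₂))) / (1 + e * selfFactor Γ₁ Γ₂ C y) ^ 2 := by
  rw [(hasDerivAt_levelCos h₁ h₂ he y).deriv, mul_assoc _ _ (coshDiff Γ₁ Γ₂ C y + _),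
    selfFactor_logDeriv]
  congr 1
  ring

/-- The derivative of `levelCos` where `levelCos = 1`. -/
theorem deriv_levelCos_of_eq_one (h₁ : Γ₁ ≠ 0) (h₂ : Γ₂ ≠ 0) {e : ℝ} (he : 0 < e) {y : ℝ}
    (hy : levelCos Γ₁ Γ₂ C e y = 1) : ∃ c, 0 < c ∧ deriv (levelCos Γ₁ Γ₂ C e) y =
      c * (sinh (halfDiff Γ₁ Γ₂ C y) * critEven Γ₁ Γ₂ C y / Γ₂) := by
  have hK := one_add_mul_selfFactor_pos (Γ₁ := Γ₁) (Γ₂ := Γ₂) (C := C) he.le y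
  have h3 := cosh_pos (halfSum Γ₁ Γ₂ C y)
  refine ⟨8 * cosh (halfSum Γ₁ Γ₂ C y) / ((1 + coshSum Γ₁ Γ₂ C y) ^ 2 *
    (1 + e * selfFactor Γ₁ Γ₂ C y) ^ 2), ?_, ?_⟩
  · have := one_le_coshSum (Γ₁ := Γ₁) (Γ₂ := Γ₂) (C := C) y
    positivity
  have hB : 1 + coshSum Γ₁ Γ₂ C y = 2 * cosh (halfSum Γ₁ Γ₂ C y) ^ 2 := by
    rw [coshSum_eq, cosh_sq]; ring
  have hA : coshDiff Γ₁ Γ₂ C y - 1 = 2 * sinh (halfDiff Γ₁ Γ₂ C y) ^ 2 := by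
    rw [coshDiff_eq]; ring
  -- Where `levelCos = 1` this eliminates `e`, so the sign of the derivative depends on `y` alone.
  have hk : e * selfFactor Γ₁ Γ₂ C y = sinh (halfDiff Γ₁ Γ₂ C y) ^ 2 / cosh (halfSum Γ₁ Γ₂ C y) ^ 2 := by
    rw [levelCos, div_eq_one_iff_eq hK.ne'] at hy
    rw [eq_div_iff (by positivity)]
    linear_combination (-1/2) * hy + (1/2) * hA - (1/2) * (e * selfFactor Γ₁ Γ₂ C y) * hB
  rw [deriv_levelCos h₁ h₂ he, sinh_sub_height₂, sinh_add_height₂, critEven]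
  rw [hB]
  have hK' := hK.ne'
  generalize hgK : 1 + e * selfFactor Γ₁ Γ₂ C y = K1 at *
  rw [hk]
  generalize sinh (halfDiff Γ₁ Γ₂ C y) = sa
  generalize cosh (halfDiff Γ₁ Γ₂ C y) = ca
  generalize sinh (halfSum Γ₁ Γ₂ C y) = sb
  generalize cosh (halfSum Γ₁ Γ₂ C y) = cb at *
  field_simp
  ring

/-- The derivative of `levelCos` where `levelCos = -1`. -/
theorem deriv_levelCos_of_eq_neg_one (h₁ : Γ₁ ≠ 0) (h₂ : Γ₂ ≠ 0) {e : ℝ} (he : 0 < e) {y : ℝ}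
    (hy : levelCos Γ₁ Γ₂ C e y = -1) : ∃ c, 0 < c ∧ deriv (levelCos Γ₁ Γ₂ C e) y =
      c * (sinh (halfSum Γ₁ Γ₂ C y) * critOdd Γ₁ Γ₂ C y / Γ₂) := by
  have hK := one_add_mul_selfFactor_pos (Γ₁ := Γ₁) (Γ₂ := Γ₂) (C := C) he.le y
  have h3 := cosh_pos (halfDiff Γ₁ Γ₂ C y)
  have hA : 1 + coshDiff Γ₁ Γ₂ C y = 2 * cosh (halfDiff Γ₁ Γ₂ C y) ^ 2 := by
    rw [coshDiff_eq, cosh_sq]; ring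
  have hB : coshSum Γ₁ Γ₂ C y - 1 = 2 * sinh (halfSum Γ₁ Γ₂ C y) ^ 2 := by
    rw [coshSum_eq]; ring
  have hk : e * selfFactor Γ₁ Γ₂ C y * sinh (halfSum Γ₁ Γ₂ C y) ^ 2 =
      cosh (halfDiff Γ₁ Γ₂ C y) ^ 2 := by
    rw [levelCos, div_eq_iff hK.ne'] at hy
    linear_combination (-1/2) * hy + (1/2) * hA - (1/2) * (e * selfFactor Γ₁ Γ₂ C y) * hB
  -- By `hk` its square times a factor equals `cosh² > 0`.
  have hs : sinh (halfSum Γ₁ Γ₂ C y) ≠ 0 := by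
    intro h
    rw [h] at hk
    have : 0 < cosh (halfDiff Γ₁ Γ₂ C y) ^ 2 := by positivity
    rw [← hk] at this
    simp at this
  refine ⟨2 * cosh (halfDiff Γ₁ Γ₂ C y) / (sinh (halfSum Γ₁ Γ₂ C y) ^ 4 *
    (1 + e * selfFactor Γ₁ Γ₂ C y) ^ 2), by positivity, ?_⟩
  have hk' : e * selfFactor Γ₁ Γ₂ C y = cosh (halfDiff Γ₁ Γ₂ C y) ^ 2 / sinh (halfSum Γ₁ Γ₂ C y) ^ 2 := by
    rw [eq_div_iff (by positivity)]; exact hk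
  rw [deriv_levelCos h₁ h₂ he, sinh_sub_height₂, sinh_add_height₂, critOdd]
  have hK' := hK.ne'
  generalize hgK : 1 + e * selfFactor Γ₁ Γ₂ C y = K1 at *
  rw [hk']
  generalize sinh (halfDiff Γ₁ Γ₂ C y) = sa
  generalize cosh (halfDiff Γ₁ Γ₂ C y) = ca at *
  generalize sinh (halfSum Γ₁ Γ₂ C y) = sb at *
  generalize cosh (halfSum Γ₁ Γ₂ C y) = cb
  field_simp
  ring

/-- On `u = 0` the level curve has `levelCos = 1`, so `W'` is a nonzero multiple of `sinh (halfDiff)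
* critEven`. The first factor vanishes only at the collision point, where `critEven` does not, so
every zero of `critEven` lies in the domain. -/
theorem isCritical_zero_iff (h₁ : 0 < Γ₁) (h₂ : 0 < Γ₂) (y : ℝ) :
    IsCritical Γ₁ Γ₂ C (0, y) ↔ critEven Γ₁ Γ₂ C y = 0 := by
  have hdom : ((0, y) : ℝ × ℝ) ∈ reducedDomain Γ₁ Γ₂ C ↔ sinh (halfDiff Γ₁ Γ₂ C y) ≠ 0 := by
    rw [mem_reducedDomain_iff]
    simp only [cos_zero]
    rw [coshDiff_eq, coshSum_eq]
    constructor
    · rintro ⟨h, -⟩ h0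
      rw [h0] at h; norm_num at h
    · intro h
      constructor
      · have : 0 < sinh (halfDiff Γ₁ Γ₂ C y) ^ 2 := by positivity
        linarith
      · positivity
  rw [isCritical_iff h₁.ne' h₂.ne', hdom]
  constructor
  · rintro ⟨h3, -, h4⟩
    have hd := hdom.2 h3
    have hW : cos 0 = levelCos Γ₁ Γ₂ C _ y := mem_cosCurve_self hd
    rw [cos_zero] at hW
    obtain ⟨c, hc, hc'⟩ := deriv_levelCos_of_eq_one h₁.ne' h₂.ne' (levelParam_pos hd) hW.symm
    rw [hc'] at h4
    simpa [hc.ne', h3, h₂.ne'] using h4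
  · intro h
    have h3 : sinh (halfDiff Γ₁ Γ₂ C y) ≠ 0 := by
      intro h0
      rw [critEven, h0] at h
      have h4 := cosh_pos (halfDiff Γ₁ Γ₂ C y)
      have h5 := cosh_pos (halfSum Γ₁ Γ₂ C y)
      have : 0 < (Γ₁ + Γ₂) * (cosh (halfDiff Γ₁ Γ₂ C y) * cosh (halfSum Γ₁ Γ₂ C y) ^ 3) := by positivity
      simp at h
      rcases h with h | h | h
      · linarith
      · exact h4.ne' h
      · exact h5.ne' h
    have hd := hdom.2 h3
    have hW : cos 0 = levelCos Γ₁ Γ₂ C _ y := mem_cosCurve_self hd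
    rw [cos_zero] at hW
    obtain ⟨c, hc, hc'⟩ := deriv_levelCos_of_eq_one h₁.ne' h₂.ne' (levelParam_pos hd) hW.symm
    exact ⟨h3, sin_zero, by rw [hc', h]; simp⟩

theorem isCritical_pi_iff (h₂ : 0 < Γ₂) (h : Γ₂ < Γ₁) (y : ℝ) :
    IsCritical Γ₁ Γ₂ C (π, y) ↔ critOdd Γ₁ Γ₂ C y = 0 := by
  have h₁ : 0 < Γ₁ := h₂.trans h
  have hdom : ((π, y) : ℝ × ℝ) ∈ reducedDomain Γ₁ Γ₂ C ↔ sinh (halfSum Γ₁ Γ₂ C y) ≠ 0 := by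
    rw [mem_reducedDomain_iff]
    simp only [cos_pi]
    rw [coshDiff_eq, coshSum_eq]
    constructor
    · rintro ⟨-, h⟩ h0
      rw [h0] at h; norm_num at h
    · intro h
      constructor
      · have : 0 ≤ sinh (halfDiff Γ₁ Γ₂ C y) ^ 2 := by positivity
        linarith
      · have : 0 < sinh (halfSum Γ₁ Γ₂ C y) ^ 2 := by positivity
        linarith
  rw [isCritical_iff h₁.ne' h₂.ne', hdom]
  constructor
  · rintro ⟨h3, -, h4⟩
    have hd := hdom.2 h3
    have hW : cos π = levelCos Γ₁ Γ₂ C _ y := mem_cosCurve_self hd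
    rw [cos_pi] at hW
    obtain ⟨c, hc, hc'⟩ := deriv_levelCos_of_eq_neg_one h₁.ne' h₂.ne' (levelParam_pos hd) hW.symm
    rw [hc'] at h4
    simpa [hc.ne', h3, h₂.ne'] using h4
  · intro h
    have h3 : sinh (halfSum Γ₁ Γ₂ C y) ≠ 0 := by
      intro h0
      rw [critOdd, h0] at h
      have h4 := cosh_pos (halfDiff Γ₁ Γ₂ C y)
      have h5 := cosh_pos (halfSum Γ₁ Γ₂ C y)
      simp at h
      rcases h with h | h | h
      · linarith
      · exact h4.ne' h
      · exact h5.ne' h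
    have hd := hdom.2 h3
    have hW : cos π = levelCos Γ₁ Γ₂ C _ y := mem_cosCurve_self hd
    rw [cos_pi] at hW
    obtain ⟨c, hc, hc'⟩ := deriv_levelCos_of_eq_neg_one h₁.ne' h₂.ne' (levelParam_pos hd) hW.symm
    exact ⟨h3, sin_pi, by rw [hc', h]; simp⟩

/-! ### Behaviour at infinity -/

theorem abs_sub_log_two_le_log_cosh (x : ℝ) : |x| - log 2 ≤ log (cosh x) := by
  rw [← cosh_abs, le_log_iff_exp_le (cosh_pos _), exp_sub, exp_log two_pos, cosh_eq]
  have := exp_pos (-|x|)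
  linarith

/-- The parameter of the level set decays at infinity. -/
theorem levelParam_tendsto_zero (h₂ : 0 < Γ₂) (h : Γ₂ < Γ₁) {ε : ℝ} (hε : 0 < ε) :
    ∃ R, ∀ q : ℝ × ℝ, R < |q.2| → levelParam Γ₁ Γ₂ C q < ε := by
  have h₁ : 0 < Γ₁ := h₂.trans h
  set r := Γ₁ / Γ₂ with hr
  set c := |C| / Γ₂ with hc
  have hc0 : 0 ≤ c := by positivity
  have hr1 : 1 < r := (one_lt_div h₂).2 h
  have hr' : Γ₂ / Γ₁ = r⁻¹ := by rw [hr, inv_div]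
  have hri : 0 < r⁻¹ := by positivity
  have hri1 : r⁻¹ * r = 1 := inv_mul_cancel₀ (by positivity)
  -- With `r = Γ₁ / Γ₂` the numerator of `levelParam` is of order `exp ((1 + r)|y|)`, the
  -- denominator at least of order `exp ((r - 1)|y| + (r + 1)|y|)`, so the quotient decays like `exp
  -- (-(r - 1)|y|)`. `K0` collects the constants. The bound with `2 + c` makes `|y₁ + y₂| ≥ 2`,
  -- hence `exp |y₁ + y₂| ≥ 3`, which absorbs `cos u`.
  set K0 := log 16 + 2 * c + r * log 2 + r⁻¹ * (c + log 2) with hK0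
  refine ⟨max ((2 + c) / (r - 1)) ((K0 - log ε) / (r - 1)), fun q hq => ?_⟩
  have hq1 : 2 + c < (r - 1) * |q.2| := by
    have := (le_max_left _ _).trans_lt hq
    rwa [div_lt_iff₀ (by linarith), mul_comm] at this
  have hq2 : K0 - log ε < (r - 1) * |q.2| := by
    have := (le_max_right _ _).trans_lt hq
    rwa [div_lt_iff₀ (by linarith), mul_comm] at this
  set y := q.2
  have hy2 : height₂ Γ₁ Γ₂ C y = C / Γ₂ - r * y := by rw [height₂, hr]; ring
  have hcabs : |C / Γ₂| = c := by rw [abs_div, abs_of_pos h₂]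
  have hry : |r * y| = r * |y| := by rw [abs_mul, abs_of_pos (by positivity)]
  have b1 : |y - height₂ Γ₁ Γ₂ C y| ≤ (1 + r) * |y| + c := by
    rw [hy2, show y - (C / Γ₂ - r * y) = (1 + r) * y - C / Γ₂ by ring]
    refine (abs_sub _ _).trans ?_
    rw [hcabs, abs_mul, abs_of_pos (by positivity)]
  have b2 : (r - 1) * |y| - c ≤ |y + height₂ Γ₁ Γ₂ C y| := by
    rw [hy2, show y + (C / Γ₂ - r * y) = C / Γ₂ - (r - 1) * y by ring, abs_sub_comm]
    refine le_trans ?_ (abs_sub_abs_le_abs_sub _ _)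
    rw [hcabs, abs_mul, abs_of_pos (show 0 < r - 1 by linarith)]
  have b3 : r * |y| - c ≤ |height₂ Γ₁ Γ₂ C y| := by
    rw [hy2, abs_sub_comm]
    refine le_trans ?_ (abs_sub_abs_le_abs_sub _ _)
    rw [hcabs, hry]
  have hg : r * (|y| - log 2) + r⁻¹ * (|height₂ Γ₁ Γ₂ C y| - log 2) ≤ log (selfFactor Γ₁ Γ₂ C y) := by
    rw [selfFactor, log_exp, ← hr, hr']
    gcongr <;> exact abs_sub_log_two_le_log_cosh _
  have hA : coshDiff Γ₁ Γ₂ C y - cos q.1 ≤ 2 * exp |y - height₂ Γ₁ Γ₂ C y| := by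
    have h1 := neg_one_le_cos q.1
    have h3 : coshDiff Γ₁ Γ₂ C y ≤ exp |y - height₂ Γ₁ Γ₂ C y| := by
      rw [coshDiff, ← cosh_abs, cosh_eq]
      have : exp (-|y - height₂ Γ₁ Γ₂ C y|) ≤ exp |y - height₂ Γ₁ Γ₂ C y| :=
        exp_le_exp.2 (by linarith [abs_nonneg (y - height₂ Γ₁ Γ₂ C y)])
      linarith
    have h4 : 1 ≤ exp |y - height₂ Γ₁ Γ₂ C y| := one_le_exp (abs_nonneg _)
    linarith
  have hB : exp |y + height₂ Γ₁ Γ₂ C y| / 8 ≤ coshSum Γ₁ Γ₂ C y + cos q.1 := by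
    have h1 := neg_one_le_cos q.1
    have h3 : exp |y + height₂ Γ₁ Γ₂ C y| / 2 ≤ coshSum Γ₁ Γ₂ C y := by
      rw [coshSum, ← cosh_abs, cosh_eq]
      have := exp_pos (-|y + height₂ Γ₁ Γ₂ C y|)
      linarith
    have h4 := add_one_le_exp |y + height₂ Γ₁ Γ₂ C y|
    linarith
  have hpos : 0 < (coshSum Γ₁ Γ₂ C y + cos q.1) * selfFactor Γ₁ Γ₂ C y :=
    mul_pos (lt_of_lt_of_le (by positivity) hB) (selfFactor_pos y)
  rw [levelParam, div_lt_iff₀ hpos]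
  have key : 16 * exp |y - height₂ Γ₁ Γ₂ C y| <
      ε * (exp |y + height₂ Γ₁ Γ₂ C y| * selfFactor Γ₁ Γ₂ C y) := by
    have e1 : 16 * exp |y - height₂ Γ₁ Γ₂ C y| = exp (log 16 + |y - height₂ Γ₁ Γ₂ C y|) := by
      rw [exp_add, exp_log (by norm_num)]
    have e2 : ε * (exp |y + height₂ Γ₁ Γ₂ C y| * selfFactor Γ₁ Γ₂ C y) =
        exp (log ε + (|y + height₂ Γ₁ Γ₂ C y| + log (selfFactor Γ₁ Γ₂ C y))) := by
      rw [exp_add, exp_add, exp_log hε, exp_log (selfFactor_pos y)]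
    rw [e1, e2, exp_lt_exp]
    have b4 : r⁻¹ * (r * |y| - c - log 2) ≤ r⁻¹ * (|height₂ Γ₁ Γ₂ C y| - log 2) := by gcongr
    have b5 : r⁻¹ * (r * |y| - c - log 2) = |y| - r⁻¹ * (c + log 2) := by
      linear_combination |y| * hri1
    rw [b5] at b4
    linarith
  have h5 := selfFactor_pos (Γ₁ := Γ₁) (Γ₂ := Γ₂) (C := C) y
  have h6 := mul_le_mul_of_nonneg_right hB h5.le
  have h7 := mul_le_mul_of_nonneg_left h6 hε.le
  linarith

/-- If `|levelCos y| ≤ 1`, some point at height `y` has level parameter `e`; far out the parameter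
is smaller than `e`. -/
theorem levelCos_bounded (h₂ : 0 < Γ₂) (h : Γ₂ < Γ₁) {e : ℝ} (he : 0 < e) :
    ∃ R, ∀ y, |levelCos Γ₁ Γ₂ C e y| ≤ 1 → |y| ≤ R := by
  obtain ⟨R, hR⟩ := levelParam_tendsto_zero (C := C) h₂ h he
  refine ⟨R, fun y hy => ?_⟩
  by_contra! hcon
  have hm : ((arccos (levelCos Γ₁ Γ₂ C e y), y) : ℝ × ℝ) ∈ cosCurve (levelCos Γ₁ Γ₂ C e) :=
    cos_arccos (abs_le.1 hy).1 (abs_le.1 hy).2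
  have := ((mem_cosCurve_levelCos_iff he _).1 hm).2
  exact (hR _ hcon).ne this

end Crit

/-! ### Signs of `critEven` and `critOdd`; the collision point lies in the window -/

section Sign

variable {Γ₁ Γ₂ C : ℝ}

theorem halfDiff_pos_iff (h₂ : 0 < Γ₂) (h₁ : 0 < Γ₁) (y : ℝ) :
    0 < halfDiff Γ₁ Γ₂ C y ↔ C / (Γ₁ + Γ₂) < y := by
  rw [halfDiff_eq h₂.ne', div_lt_iff₀ (by linarith), div_pos_iff_of_pos_right (by linarith)]
  constructor <;> intro h <;> linarith

theorem halfSum_neg_iff (h₂ : 0 < Γ₂) (h : Γ₂ < Γ₁) (y : ℝ) :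
    halfSum Γ₁ Γ₂ C y < 0 ↔ C / (Γ₁ - Γ₂) < y := by
  rw [halfSum_eq h₂.ne', div_lt_iff₀ (by linarith), div_lt_iff₀ (by linarith), zero_mul]
  constructor <;> intro h <;> linarith

theorem halfDiff_neg (y : ℝ) : halfDiff Γ₁ Γ₂ (-C) (-y) = -halfDiff Γ₁ Γ₂ C y := by
  simp only [halfDiff, height₂]; ring

theorem halfSum_neg (y : ℝ) : halfSum Γ₁ Γ₂ (-C) (-y) = -halfSum Γ₁ Γ₂ C y := by
  simp only [halfSum, height₂]; ring

theorem critEven_neg (y : ℝ) : critEven Γ₁ Γ₂ (-C) (-y) = critEven Γ₁ Γ₂ C y := by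
  simp only [critEven, halfDiff_neg, halfSum_neg, cosh_neg, sinh_neg]; ring

/-- By `critEven_eq_ratio`, `critEven` is positive exactly where this ratio is below `(Γ₁ + Γ₂)/(Γ₁
- Γ₂)`, so monotonicity gives at most one zero. Above both collision heights `s = sinh (halfDiff)`
and `t = sinh (-halfSum)` are positive. With `c`, `T` the corresponding `cosh`, the derivative has
the sign of `p t T (3 + 2s²) + q s c (1 - 2t²)`, positive because `q < p`, `t ≤ T` and `2sc ≤ 2s² +
1`. -/
theorem strictMonoOn_ratio (h₂ : 0 < Γ₂) (h : Γ₂ < Γ₁) :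
    StrictMonoOn (fun y => sinh (halfDiff Γ₁ Γ₂ C y) ^ 3 * sinh (-halfSum Γ₁ Γ₂ C y) /
      (cosh (halfDiff Γ₁ Γ₂ C y) * cosh (-halfSum Γ₁ Γ₂ C y) ^ 3))
      (Ioi (C / (Γ₁ + Γ₂)) ∩ Ioi (C / (Γ₁ - Γ₂))) := by
  set p := (1 + Γ₁ / Γ₂) / 2 with hp
  set q := (Γ₁ / Γ₂ - 1) / 2 with hq
  have hr : 1 < Γ₁ / Γ₂ := (one_lt_div h₂).2 h
  have hp0 : 0 < p := by rw [hp]; linarith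
  have hq0 : 0 < q := by rw [hq]; linarith
  have hpq : q < p := by rw [hq, hp]; linarith
  have hd : ∀ y, HasDerivAt (fun y => sinh (halfDiff Γ₁ Γ₂ C y) ^ 3 * sinh (-halfSum Γ₁ Γ₂ C y) /
      (cosh (halfDiff Γ₁ Γ₂ C y) * cosh (-halfSum Γ₁ Γ₂ C y) ^ 3))
      (sinh (halfDiff Γ₁ Γ₂ C y) ^ 2 * cosh (-halfSum Γ₁ Γ₂ C y) ^ 2 *
        (p * sinh (-halfSum Γ₁ Γ₂ C y) * cosh (-halfSum Γ₁ Γ₂ C y) *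
            (3 + 2 * sinh (halfDiff Γ₁ Γ₂ C y) ^ 2)
          + q * sinh (halfDiff Γ₁ Γ₂ C y) * cosh (halfDiff Γ₁ Γ₂ C y) *
            (1 - 2 * sinh (-halfSum Γ₁ Γ₂ C y) ^ 2)) /
        (cosh (halfDiff Γ₁ Γ₂ C y) * cosh (-halfSum Γ₁ Γ₂ C y) ^ 3) ^ 2) y := by
    intro y
    have h3 := hasDerivAt_halfDiff (Γ₁ := Γ₁) (Γ₂ := Γ₂) (C := C) y
    have h4 := (hasDerivAt_halfSum (Γ₁ := Γ₁) (Γ₂ := Γ₂) (C := C) y).fun_neg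
    have hn : cosh (halfDiff Γ₁ Γ₂ C y) * cosh (-halfSum Γ₁ Γ₂ C y) ^ 3 ≠ 0 := by
      have := cosh_pos (halfDiff Γ₁ Γ₂ C y)
      have := cosh_pos (-halfSum Γ₁ Γ₂ C y)
      positivity
    have h5 := ((h3.sinh.fun_pow 3).fun_mul h4.sinh).fun_div (h3.cosh.fun_mul (h4.cosh.fun_pow 3)) hn
    refine h5.congr_deriv ?_
    congr 1
    have e : -((1 - Γ₁ / Γ₂) / 2) = q := by rw [hq]; ring
    rw [e]
    have e1 := cosh_sq (halfDiff Γ₁ Γ₂ C y)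
    have e2 := cosh_sq (-halfSum Γ₁ Γ₂ C y)
    generalize sinh (halfDiff Γ₁ Γ₂ C y) = s at *
    generalize cosh (halfDiff Γ₁ Γ₂ C y) = c at *
    generalize sinh (-halfSum Γ₁ Γ₂ C y) = t at *
    generalize cosh (-halfSum Γ₁ Γ₂ C y) = T at *
    push_cast
    linear_combination (3 * p * s ^ 2 * t * T ^ 3) * e1 + (q * s ^ 3 * c * T ^ 2) * e2
  refine strictMonoOn_of_deriv_pos ((convex_Ioi _).inter (convex_Ioi _))
    (fun y _ => (hd y).continuousAt.continuousWithinAt) fun y hy => ?_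
  rw [(isOpen_Ioi.inter isOpen_Ioi).interior_eq] at hy
  rw [(hd y).deriv]
  have hs : 0 < sinh (halfDiff Γ₁ Γ₂ C y) :=
    sinh_pos_iff.2 ((halfDiff_pos_iff h₂ (h₂.trans h) y).2 hy.1)
  have ht : 0 < sinh (-halfSum Γ₁ Γ₂ C y) :=
    sinh_pos_iff.2 (neg_pos.2 ((halfSum_neg_iff h₂ h y).2 hy.2))
  have hc := cosh_pos (halfDiff Γ₁ Γ₂ C y)
  have hT := cosh_pos (-halfSum Γ₁ Γ₂ C y)
  have hsc : 2 * (sinh (halfDiff Γ₁ Γ₂ C y) * cosh (halfDiff Γ₁ Γ₂ C y)) ≤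
      2 * sinh (halfDiff Γ₁ Γ₂ C y) ^ 2 + 1 := by
    nlinarith [cosh_sq (halfDiff Γ₁ Γ₂ C y),
      sq_nonneg (sinh (halfDiff Γ₁ Γ₂ C y) - cosh (halfDiff Γ₁ Γ₂ C y))]
  have htT : sinh (-halfSum Γ₁ Γ₂ C y) ≤ cosh (-halfSum Γ₁ Γ₂ C y) := (sinh_lt_cosh _).le
  generalize sinh (halfDiff Γ₁ Γ₂ C y) = s at *
  generalize cosh (halfDiff Γ₁ Γ₂ C y) = c at *
  generalize sinh (-halfSum Γ₁ Γ₂ C y) = t at *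
  generalize cosh (-halfSum Γ₁ Γ₂ C y) = T at *
  have key : 0 < p * t * T * (3 + 2 * s ^ 2) + q * s * c * (1 - 2 * t ^ 2) := by
    have a1 : q * (s * c) * (2 * t ^ 2) ≤ p * (s * c) * (2 * (t * T)) := by
      have : t ^ 2 ≤ t * T := by nlinarith
      gcongr
    have a2 : p * (t * T) * (2 * (s * c)) ≤ p * (t * T) * (2 * s ^ 2 + 1) := by gcongr
    have a3 : 0 < p * (t * T) := by positivity
    have a4 : 0 < q * (s * c) := by positivity
    linarith
  positivity

theorem critEven_pos_of_halfSum_nonneg (h₂ : 0 < Γ₂) (h : Γ₂ < Γ₁) {y : ℝ}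
    (ha : 0 ≤ halfDiff Γ₁ Γ₂ C y) (hb : 0 ≤ halfSum Γ₁ Γ₂ C y) : 0 < critEven Γ₁ Γ₂ C y := by
  have h3 := cosh_pos (halfDiff Γ₁ Γ₂ C y)
  have h4 := cosh_pos (halfSum Γ₁ Γ₂ C y)
  have h5 := sinh_nonneg_iff.2 ha
  have h6 := sinh_nonneg_iff.2 hb
  have h7 : 0 < Γ₁ - Γ₂ := by linarith
  have h8 : 0 < Γ₁ + Γ₂ := by linarith
  have h9 : 0 < (Γ₁ + Γ₂) * (cosh (halfDiff Γ₁ Γ₂ C y) * cosh (halfSum Γ₁ Γ₂ C y) ^ 3) := by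
    positivity
  have h10 : 0 ≤ (Γ₁ - Γ₂) * (sinh (halfDiff Γ₁ Γ₂ C y) ^ 3 * sinh (halfSum Γ₁ Γ₂ C y)) :=
    mul_nonneg h7.le (mul_nonneg (pow_nonneg h5 3) h6)
  unfold critEven
  linarith

theorem critEven_eq_ratio (y : ℝ) : critEven Γ₁ Γ₂ C y =
    (cosh (halfDiff Γ₁ Γ₂ C y) * cosh (-halfSum Γ₁ Γ₂ C y) ^ 3) *
      ((Γ₁ + Γ₂) - (Γ₁ - Γ₂) * (sinh (halfDiff Γ₁ Γ₂ C y) ^ 3 * sinh (-halfSum Γ₁ Γ₂ C y) /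
      (cosh (halfDiff Γ₁ Γ₂ C y) * cosh (-halfSum Γ₁ Γ₂ C y) ^ 3))) := by
  have h3 := (cosh_pos (halfDiff Γ₁ Γ₂ C y)).ne'
  have h4 := (cosh_pos (halfSum Γ₁ Γ₂ C y)).ne'
  rw [critEven, cosh_neg, sinh_neg]
  field_simp
  ring

theorem critEven_center_pos (h₂ : 0 < Γ₂) (h₁ : 0 < Γ₁) : 0 < critEven Γ₁ Γ₂ C (C / (Γ₁ + Γ₂)) := by
  have h0 : halfDiff Γ₁ Γ₂ C (C / (Γ₁ + Γ₂)) = 0 := by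
    rw [halfDiff_eq h₂.ne']; field_simp; simp
  have := cosh_pos (halfSum Γ₁ Γ₂ C (C / (Γ₁ + Γ₂)))
  rw [critEven, h0]
  simp only [cosh_zero, sinh_zero]
  have : 0 < Γ₁ + Γ₂ := by linarith
  norm_num
  positivity

/-- The curve of the level parameter on the line `u = 0`. -/
theorem hasDerivAt_levelParam_zero (h₁ : 0 < Γ₁) (h₂ : 0 < Γ₂) {y : ℝ}
    (hy : halfDiff Γ₁ Γ₂ C y ≠ 0) : ∃ c, 0 < c ∧ HasDerivAt (fun y => levelParam Γ₁ Γ₂ C (0, y))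
      (c * (sinh (halfDiff Γ₁ Γ₂ C y) * critEven Γ₁ Γ₂ C y)) y := by
  have hs : sinh (halfDiff Γ₁ Γ₂ C y) ≠ 0 := sinh_ne_zero.2 hy
  have hd : ((0, y) : ℝ × ℝ) ∈ reducedDomain Γ₁ Γ₂ C := by
    rw [mem_reducedDomain_iff]
    simp only [cos_zero]
    rw [coshDiff_eq, coshSum_eq]
    constructor
    · have : 0 < sinh (halfDiff Γ₁ Γ₂ C y) ^ 2 := by positivity
      linarith
    · positivity
  obtain ⟨c, hc, hF⟩ := hasFDerivAt_levelParam hd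
  have hW : cos 0 = levelCos Γ₁ Γ₂ C _ y := mem_cosCurve_self hd
  rw [cos_zero] at hW
  obtain ⟨c', hc', hd'⟩ := deriv_levelCos_of_eq_one h₁.ne' h₂.ne' (levelParam_pos hd) hW.symm
  have h := hF.comp_hasDerivAt y ((hasDerivAt_const y (0 : ℝ)).prodMk (hasDerivAt_id y))
  refine ⟨c * c' / Γ₂, by positivity, h.congr_deriv ?_⟩
  simp only [smul_apply, add_apply, ContinuousLinearMap.coe_fst', ContinuousLinearMap.coe_snd',
    smul_eq_mul, hd', mul_zero, zero_add, mul_one]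
  ring

theorem continuous_levelParam_zero : Continuous fun y => levelParam Γ₁ Γ₂ C (0, y) := by
  have h2 := (contDiff_coshDiff (Γ₁ := Γ₁) (Γ₂ := Γ₂) (C := C) (n := 0)).continuous
  have h3 := (contDiff_coshSum (Γ₁ := Γ₁) (Γ₂ := Γ₂) (C := C) (n := 0)).continuous
  have h4 := (contDiff_selfFactor (Γ₁ := Γ₁) (Γ₂ := Γ₂) (C := C) (n := 0)).continuous
  unfold levelParam
  simp only [cos_zero]
  refine Continuous.div (by fun_prop) (by fun_prop) fun y => ?_
  have h5 := one_le_coshSum (Γ₁ := Γ₁) (Γ₂ := Γ₂) (C := C) y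
  refine (mul_pos ?_ (selfFactor_pos y)).ne'
  linarith

/-- To the right of the collision point there is exactly one critical point. -/
theorem exists_critEven_right (h₂ : 0 < Γ₂) (h : Γ₂ < Γ₁) (C : ℝ) :
    ∃ b, C / (Γ₁ + Γ₂) < b ∧ critEven Γ₁ Γ₂ C b = 0 ∧
      (∀ y ∈ Ioo (C / (Γ₁ + Γ₂)) b, 0 < critEven Γ₁ Γ₂ C y) ∧ ∀ y ∈ Ioi b, critEven Γ₁ Γ₂ C y < 0 := by
  have h₁ : 0 < Γ₁ := h₂.trans h
  set c := C / (Γ₁ + Γ₂) with hc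
  have hpos : ∀ y, c < y → 0 < halfDiff Γ₁ Γ₂ C y := fun y hy => (halfDiff_pos_iff h₂ h₁ y).2 hy
  set ρ : ℝ → ℝ := fun y => levelParam Γ₁ Γ₂ C (0, y) with hρ
  have hρc : ρ c = 0 := by
    have h0 : halfDiff Γ₁ Γ₂ C c = 0 := by
      rw [halfDiff_eq h₂.ne', hc]; field_simp; simp
    simp [hρ, levelParam, coshDiff_eq, h0]
  have hρpos : ∀ y, c < y → 0 < ρ y := by
    intro y hy
    refine levelParam_pos ?_
    rw [mem_reducedDomain_iff]
    simp only [cos_zero]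
    rw [coshDiff_eq, coshSum_eq]
    have := sinh_pos_iff.2 (hpos y hy)
    constructor
    · have : 0 < sinh (halfDiff Γ₁ Γ₂ C y) ^ 2 := by positivity
      linarith
    · positivity
  obtain ⟨R, hR⟩ := levelParam_tendsto_zero (C := C) h₂ h (hρpos (c + 1) (by linarith))
  set R' := max (c + 2) (|R| + 1) with hR'
  have hRR : R < |R'| := by
    have h3 : |R| + 1 ≤ R' := le_max_right _ _
    have h4 := le_abs_self R
    have h5 := le_abs_self R'
    linarith
  have hcR : c + 2 ≤ R' := le_max_left _ _
  -- On `u = 0` the level parameter vanishes at the collision point and is small at infinity; its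
  -- maximum in between is a critical point.
  obtain ⟨b, hb, hmax⟩ := (isCompact_Icc (a := c) (b := R')).exists_isMaxOn
    (nonempty_Icc.2 (by linarith)) (continuous_levelParam_zero (Γ₁ := Γ₁) (Γ₂ := Γ₂) (C := C)).continuousOn
  have hb1 : ρ (c + 1) ≤ ρ b := hmax (⟨by linarith, by linarith⟩ : c + 1 ∈ Icc c R')
  have hcb : c < b := hb.1.lt_of_ne (by
    rintro rfl
    rw [hρc] at hb1
    linarith [hρpos (c + 1) (by linarith)])
  have hbR : b < R' := hb.2.lt_of_ne (by
    rintro heq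
    have := hR (0, R') hRR
    rw [heq] at hb1
    exact hb1.not_gt this)
  have hcrit : critEven Γ₁ Γ₂ C b = 0 := by
    obtain ⟨k, hk, hd⟩ := hasDerivAt_levelParam_zero (C := C) h₁ h₂ (hpos b hcb).ne'
    have hloc : IsLocalMax ρ b := hmax.isLocalMax (Icc_mem_nhds hcb hbR)
    have h0 := hloc.hasDerivAt_eq_zero hd
    have hs := (sinh_pos_iff.2 (hpos b hcb)).ne'
    simpa [hk.ne', hs] using h0
  -- A height where `critEven ≤ 0` lies beyond the other collision height too, that is, in the
  -- domain of `strictMonoOn_ratio`.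
  have hsum : ∀ y, c < y → critEven Γ₁ Γ₂ C y ≤ 0 → C / (Γ₁ - Γ₂) < y := by
    intro y hy hle
    rw [← halfSum_neg_iff h₂ h]
    by_contra! hcon
    exact hle.not_gt (critEven_pos_of_halfSum_nonneg h₂ h (hpos y hy).le hcon)
  have hbs := hsum b hcb hcrit.le
  have hmono := strictMonoOn_ratio (C := C) h₂ h
  have hcpos : ∀ y, 0 < cosh (halfDiff Γ₁ Γ₂ C y) * cosh (-halfSum Γ₁ Γ₂ C y) ^ 3 := fun y => by
    have h3 := cosh_pos (halfDiff Γ₁ Γ₂ C y)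
    have h4 := cosh_pos (-halfSum Γ₁ Γ₂ C y)
    positivity
  have hb0 : (Γ₁ + Γ₂) - (Γ₁ - Γ₂) * (sinh (halfDiff Γ₁ Γ₂ C b) ^ 3 * sinh (-halfSum Γ₁ Γ₂ C b) /
      (cosh (halfDiff Γ₁ Γ₂ C b) * cosh (-halfSum Γ₁ Γ₂ C b) ^ 3)) = 0 := by
    rw [critEven_eq_ratio] at hcrit
    exact (mul_eq_zero.1 hcrit).resolve_left (hcpos b).ne'
  have hsub : 0 < Γ₁ - Γ₂ := by linarith
  refine ⟨b, hcb, hcrit, fun y hy => ?_, fun y hy => ?_⟩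
  · by_contra! hcon
    have hys := hsum y hy.1 hcon
    have h3 := hmono ⟨hy.1, hys⟩ ⟨hcb, hbs⟩ hy.2
    have h4 := mul_lt_mul_of_pos_left h3 hsub
    rw [critEven_eq_ratio] at hcon
    simp only at h4
    have : 0 < (Γ₁ + Γ₂) - (Γ₁ - Γ₂) * (sinh (halfDiff Γ₁ Γ₂ C y) ^ 3 * sinh (-halfSum Γ₁ Γ₂ C y) /
      (cosh (halfDiff Γ₁ Γ₂ C y) * cosh (-halfSum Γ₁ Γ₂ C y) ^ 3)) := by linarith
    exact hcon.not_gt (mul_pos (hcpos y) this)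
  · have hy : b < y := hy
    have h3 := hmono ⟨hcb, hbs⟩ ⟨hcb.trans hy, hbs.trans hy⟩ hy
    have h4 := mul_lt_mul_of_pos_left h3 hsub
    rw [critEven_eq_ratio]
    simp only at h4
    exact mul_neg_of_pos_of_neg (hcpos y) (by linarith)

/-- The sign of `critEven`. -/
theorem exists_critEven_sign (h₂ : 0 < Γ₂) (h : Γ₂ < Γ₁) (C : ℝ) :
    ∃ a b, a < C / (Γ₁ + Γ₂) ∧ C / (Γ₁ + Γ₂) < b ∧ critEven Γ₁ Γ₂ C a = 0 ∧ critEven Γ₁ Γ₂ C b = 0 ∧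
      (∀ y ∈ Ioo a b, 0 < critEven Γ₁ Γ₂ C y) ∧ (∀ y ∈ Iio a, critEven Γ₁ Γ₂ C y < 0) ∧
      ∀ y ∈ Ioi b, critEven Γ₁ Γ₂ C y < 0 := by
  obtain ⟨b, hb, hb0, hb1, hb2⟩ := exists_critEven_right h₂ h C
  -- The symmetry `(y, C) ↦ (-y, -C)` gives the zero on the left.
  obtain ⟨a, ha, ha0, ha1, ha2⟩ := exists_critEven_right h₂ h (-C)
  rw [neg_div] at ha ha1
  refine ⟨-a, b, by linarith, hb, ?_, hb0, fun y hy => ?_, fun y hy => ?_, hb2⟩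
  · rw [← critEven_neg, neg_neg]; exact ha0
  · rcases lt_trichotomy y (C / (Γ₁ + Γ₂)) with h3 | h3 | h3
    · rw [← critEven_neg]; exact ha1 _ ⟨by linarith, by linarith [hy.1]⟩
    · rw [h3]; exact critEven_center_pos h₂ (h₂.trans h)
    · exact hb1 y ⟨h3, hy.2⟩
  · rw [← critEven_neg]; exact ha2 _ (by show a < -y; linarith [show y < -a from hy])

/-- The condition on the line `u = 0` in `Admissible` is thus automatic when `Γ₁ > Γ₂ > 0`; only the
line `u = π` needs checking in the examples. -/
theorem ncard_critical_zero (h₂ : 0 < Γ₂) (h : Γ₂ < Γ₁) (C : ℝ) :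
    {y : ℝ | IsCritical Γ₁ Γ₂ C (0, y)}.ncard = 2 := by
  obtain ⟨a, b, ha, hb, ha0, hb0, h3, h4, h5⟩ := exists_critEven_sign h₂ h C
  have : {y : ℝ | IsCritical Γ₁ Γ₂ C (0, y)} = {a, b} := by
    ext y
    rw [mem_ofPred_eq, isCritical_zero_iff (h₂.trans h) h₂]
    constructor
    · intro hy
      rcases lt_trichotomy y a with h6 | h6 | h6
      · exact absurd hy (h4 y h6).ne
      · exact Or.inl h6
      rcases lt_trichotomy y b with h7 | h7 | h7
      · exact absurd hy (h3 y ⟨h6, h7⟩).ne'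
      · exact Or.inr h7
      · exact absurd hy (h5 y h7).ne
    · rintro (rfl | rfl)
      exacts [ha0, hb0]
  rw [this, ncard_pair (ha.trans hb).ne]

/-- It has no zeros by admissibility and is positive at the collision height, where `sinh (halfSum)
= 0`; the intermediate value theorem does the rest. -/
theorem critOdd_pos (hA : Admissible Γ₁ Γ₂ C) (y : ℝ) : 0 < critOdd Γ₁ Γ₂ C y := by
  have h₂ := hA.pos
  have h := hA.lt
  have hne : ∀ y, critOdd Γ₁ Γ₂ C y ≠ 0 := by
    intro y hy
    have : y ∈ {y : ℝ | IsCritical Γ₁ Γ₂ C (π, y)} := (isCritical_pi_iff h₂ h y).2 hy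
    rw [hA.none_on_pi] at this
    exact this
  have hc : Continuous (critOdd Γ₁ Γ₂ C) := by
    have h1 : Continuous (halfDiff Γ₁ Γ₂ C) :=
      continuous_iff_continuousAt.2 fun y => (hasDerivAt_halfDiff y).continuousAt
    have h2 : Continuous (halfSum Γ₁ Γ₂ C) :=
      continuous_iff_continuousAt.2 fun y => (hasDerivAt_halfSum y).continuousAt
    unfold critOdd
    fun_prop
  have hpos : 0 < critOdd Γ₁ Γ₂ C (C / (Γ₁ - Γ₂)) := by
    have h0 : halfSum Γ₁ Γ₂ C (C / (Γ₁ - Γ₂)) = 0 := by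
      have : Γ₁ - Γ₂ ≠ 0 := by linarith
      rw [halfSum_eq h₂.ne']; field_simp; simp
    have := cosh_pos (halfDiff Γ₁ Γ₂ C (C / (Γ₁ - Γ₂)))
    rw [critOdd, h0]
    simp only [cosh_zero, sinh_zero]
    have : 0 < Γ₁ - Γ₂ := by linarith
    norm_num
    positivity
  by_contra! hcon
  have := mem_range_of_exists_le_of_exists_ge hc ⟨y, hcon⟩ ⟨_, hpos.le⟩
  obtain ⟨z, hz⟩ := this
  exact hne z hz

theorem IsWindow.deriv_left_neg {W : ℝ → ℝ} {α β : ℝ} (h : IsWindow W α β) (hα : W α = 1) :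
    deriv W α < 0 := by
  refine lt_of_le_of_ne ?_ h.deriv_left
  have hd := (differentiableAt_of_deriv_ne_zero h.deriv_left).hasDerivAt
  have ht := (hasDerivWithinAt_iff_tendsto_slope' (s := Ioi α) self_notMem_Ioi).1 hd.hasDerivWithinAt
  refine le_of_tendsto ht ?_
  filter_upwards [Ioo_mem_nhdsGT h.lt] with y hy
  rw [slope_def_field]
  have := (abs_lt.1 (h.inside y hy)).2
  exact div_nonpos_of_nonpos_of_nonneg (by linarith) (by linarith [hy.1])

theorem IsWindow.deriv_right_pos {W : ℝ → ℝ} {α β : ℝ} (h : IsWindow W α β) (hβ : W β = 1) :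
    0 < deriv W β := by
  refine lt_of_le_of_ne ?_ h.deriv_right.symm
  have hd := (differentiableAt_of_deriv_ne_zero h.deriv_right).hasDerivAt
  have ht := (hasDerivWithinAt_iff_tendsto_slope' (s := Iio β) self_notMem_Iio).1 hd.hasDerivWithinAt
  refine ge_of_tendsto ht ?_
  filter_upwards [Ioo_mem_nhdsLT h.lt] with y hy
  rw [slope_def_field]
  have := (abs_lt.1 (h.inside y hy)).2
  exact div_nonneg_of_nonpos (by linarith) (by linarith [hy.2])

/-- A window with `levelCos = 1` at both ends contains the collision point of the line `u = 0`. -/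
theorem window_even (h₂ : 0 < Γ₂) (h : Γ₂ < Γ₁) {e α β : ℝ} (he : 0 < e)
    (hw : IsWindow (levelCos Γ₁ Γ₂ C e) α β) (hα : levelCos Γ₁ Γ₂ C e α = 1)
    (hβ : levelCos Γ₁ Γ₂ C e β = 1) :
    C / (Γ₁ + Γ₂) ∈ Ioo α β ∧ ∀ y ∈ Icc α β, 0 < critEven Γ₁ Γ₂ C y := by
  have h₁ := h₂.trans h
  obtain ⟨a, b, ha, hb, ha0, hb0, h3, h4, h5⟩ := exists_critEven_sign h₂ h C
  have hpos : ∀ y, C / (Γ₁ + Γ₂) < y → 0 < sinh (halfDiff Γ₁ Γ₂ C y) := fun y hy =>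
    sinh_pos_iff.2 ((halfDiff_pos_iff h₂ h₁ y).2 hy)
  have hneg : ∀ y, y ≤ C / (Γ₁ + Γ₂) → sinh (halfDiff Γ₁ Γ₂ C y) ≤ 0 := fun y hy =>
    sinh_nonpos_iff.2 (not_lt.1 fun hc => hy.not_gt ((halfDiff_pos_iff h₂ h₁ y).1 hc))
  -- `levelCos` falls from `1` at `α` and rises to `1` at `β`, so `sinh (halfDiff) * critEven` is
  -- negative at `α` and positive at `β`. The sign table of `critEven` then forces `a < α` and `β <
  -- b`, and `sinh (halfDiff)` changes sign over the window.
  have hdα : sinh (halfDiff Γ₁ Γ₂ C α) * critEven Γ₁ Γ₂ C α < 0 := by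
    obtain ⟨c, hc, hd⟩ := deriv_levelCos_of_eq_one h₁.ne' h₂.ne' he hα
    have h6 := hw.deriv_left_neg hα
    rw [hd] at h6
    by_contra! h7
    exact h6.not_ge (by positivity)
  have hdβ : 0 < sinh (halfDiff Γ₁ Γ₂ C β) * critEven Γ₁ Γ₂ C β := by
    obtain ⟨c, hc, hd⟩ := deriv_levelCos_of_eq_one h₁.ne' h₂.ne' he hβ
    have h6 := hw.deriv_right_pos hβ
    rw [hd] at h6
    by_contra! h7
    exact h6.not_ge (mul_nonpos_of_nonneg_of_nonpos hc.le (div_nonpos_of_nonpos_of_nonneg h7 h₂.le))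
  have haα : a < α := by
    by_contra! hc
    rcases hc.lt_or_eq with hc | hc
    · exact hdα.not_ge (mul_nonneg_of_nonpos_of_nonpos (hneg α (hc.trans ha).le) (h4 α hc).le)
    · rw [hc, ha0, mul_zero] at hdα; exact hdα.false
  have hβb : β < b := by
    by_contra! hc
    rcases hc.lt_or_eq with hc | hc
    · exact hdβ.not_ge (mul_nonpos_of_nonneg_of_nonpos (hpos β (hb.trans hc)).le (h5 β hc).le)
    · rw [← hc, hb0, mul_zero] at hdβ; exact hdβ.false
  have hsign : ∀ y ∈ Icc α β, 0 < critEven Γ₁ Γ₂ C y := fun y hy =>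
    h3 y ⟨haα.trans_le hy.1, hy.2.trans_lt hβb⟩
  refine ⟨⟨?_, ?_⟩, hsign⟩
  · by_contra! hc
    have h8 := hsign α ⟨le_rfl, hw.lt.le⟩
    rcases hc.lt_or_eq with hc | hc
    · exact hdα.not_gt (mul_pos (hpos α hc) h8)
    · have : halfDiff Γ₁ Γ₂ C α = 0 := by
        rw [halfDiff_eq h₂.ne', ← hc]; field_simp; simp
      rw [this, sinh_zero, zero_mul] at hdα
      exact hdα.false
  · by_contra! hc
    exact hdβ.not_ge (mul_nonpos_of_nonpos_of_nonneg (hneg β hc) (hsign β ⟨hw.lt.le, le_rfl⟩).le)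

/-- A window with `levelCos = -1` at both ends contains the collision point of the line `u = π`. -/
theorem window_odd (hA : Admissible Γ₁ Γ₂ C) {e α β : ℝ} (he : 0 < e)
    (hw : IsWindow (levelCos Γ₁ Γ₂ C e) α β) (hα : levelCos Γ₁ Γ₂ C e α = -1)
    (hβ : levelCos Γ₁ Γ₂ C e β = -1) : C / (Γ₁ - Γ₂) ∈ Ioo α β := by
  have h₂ := hA.pos
  have h₁ := h₂.trans hA.lt
  have hdα : 0 < sinh (halfSum Γ₁ Γ₂ C α) := by
    obtain ⟨c, hc, hd⟩ := deriv_levelCos_of_eq_neg_one h₁.ne' h₂.ne' he hα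
    have h6 := hw.neg.deriv_left_neg (by simp [hα])
    rw [deriv.neg, hd] at h6
    by_contra! h7
    have := mul_nonpos_of_nonneg_of_nonpos hc.le (div_nonpos_of_nonpos_of_nonneg
      (mul_nonpos_of_nonpos_of_nonneg h7 (critOdd_pos hA α).le) h₂.le)
    linarith
  have hdβ : sinh (halfSum Γ₁ Γ₂ C β) < 0 := by
    obtain ⟨c, hc, hd⟩ := deriv_levelCos_of_eq_neg_one h₁.ne' h₂.ne' he hβ
    have h6 := hw.neg.deriv_right_pos (by simp [hβ])
    rw [deriv.neg, hd] at h6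
    by_contra! h7
    have := critOdd_pos hA β
    have : 0 ≤ c * (sinh (halfSum Γ₁ Γ₂ C β) * critOdd Γ₁ Γ₂ C β / Γ₂) := by positivity
    linarith
  refine ⟨?_, (halfSum_neg_iff h₂ hA.lt β).1 (sinh_neg_iff.1 hdβ)⟩
  have h3 := sinh_pos_iff.1 hdα
  rw [halfSum_eq h₂.ne', div_pos_iff_of_pos_right (by linarith)] at h3
  rw [lt_div_iff₀ (by linarith [hA.lt])]
  linarith

end Sign

namespace IsFlow

variable {W G u y : ℝ → ℝ} {α β : ℝ}

/-- At the ends of a half period `u` is on one of two consecutive walls, where `cos u` takes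
opposite values. So equal values of `W` mean return to the same wall, opposite values mean that the
strip is crossed. -/
theorem levelCos_left (h : IsFlow W G u y) {k : ℤ} {t₁ t₂ : ℝ} (hp : IsHalfPeriod u y α β k t₁ t₂) :
    (W (y t₁) = W (y t₂) → u t₁ = u t₂) ∧
      (W (y t₁) = -W (y t₂) → u t₂ - u t₁ = π ∨ u t₂ - u t₁ = -π) := by
  have h0 : cos ((k + 1 : ℝ) * π) = -cos (k * π) := by rw [add_mul, one_mul, cos_add_pi]
  have hn : cos (k * π) ≠ 0 := by
    rw [cos_int_mul_pi]; exact zpow_ne_zero _ (by norm_num)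
  rw [← h.curve, ← h.curve]
  rcases hp.left with h1 | h1 <;> rcases hp.right with h2 | h2 <;> rw [h1, h2] <;>
    refine ⟨fun h3 => ?_, fun h3 => ?_⟩ <;>
    first
      | rfl
      | (left; ring1)
      | (right; ring1)
      | (exfalso; rw [h0] at h3; apply hn; linarith)
      | (exfalso; apply hn; linarith)

theorem ends_eq {k : ℤ} {t₁ t₂ : ℝ} (hp : IsHalfPeriod u y α β k t₁ t₂) {w : ℝ} (hα : W α = w)
    (hβ : W β = w) : W (y t₁) = w ∧ W (y t₂) = w := by
  rcases hp.ends with ⟨h1, h2⟩ | ⟨h1, h2⟩ <;> rw [h1, h2] <;> constructor <;> assumption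

theorem ends_neg {k : ℤ} {t₁ t₂ : ℝ} (hp : IsHalfPeriod u y α β k t₁ t₂) (hαβ : W α = -W β) :
    W (y t₁) = -W (y t₂) := by
  rcases hp.ends with ⟨h1, h2⟩ | ⟨h1, h2⟩ <;> rw [h1, h2]
  · exact hαβ
  · rw [hαβ, neg_neg]

theorem add_nat_mul_period (hW : ContDiff ℝ 2 W) (hGc : ContDiff ℝ 1 G) (h : IsFlow W G u y) {k : ℤ}
    {t₁ t₂ : ℝ} (hp : IsHalfPeriod u y α β k t₁ t₂) (t : ℝ) (n : ℕ) :
    u (t + n * (2 * (t₂ - t₁))) = u t + n * (2 * (u t₂ - u t₁)) := by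
  induction n with
  | zero => simp
  | succ n ih =>
    have := (h.period hW hGc hp (t + n * (2 * (t₂ - t₁)))).1
    push_cast
    rw [show t + ((n : ℝ) + 1) * (2 * (t₂ - t₁)) = t + n * (2 * (t₂ - t₁)) + 2 * (t₂ - t₁) by ring,
      this, ih]
    ring

/-- If the ends of the window are different, then the curve is not bounded. -/
theorem not_isCompact (hW : ContDiff ℝ 2 W) (hGc : ContDiff ℝ 1 G) (h : IsFlow W G u y)
    (hG : ∀ y, 0 < G y) (hw : IsWindow W α β) (hy : ∀ t, y t ∈ Icc α β) (hαβ : W α = -W β) :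
    ¬ IsCompact (connectedComponentIn (cosCurve W) (u 0, y 0)) := by
  intro hc
  obtain ⟨k, t₁, t₂, hp⟩ := h.exists_isHalfPeriod hW hGc.continuous hG hw hy
  have hΔ := (h.levelCos_left hp).2 (ends_neg hp hαβ)
  obtain ⟨M, hM⟩ := (hc.image _root_.continuous_fst).isBounded.exists_norm_le
  have hb : ∀ t, |u t| ≤ M := fun t => hM _ ⟨_, h.mem_component 0 t, rfl⟩
  obtain ⟨n, hn⟩ := exists_nat_gt (2 * M)
  have h1 := h.add_nat_mul_period hW hGc hp 0 n
  have h2 := hb 0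
  have h3 := hb (0 + n * (2 * (t₂ - t₁)))
  have h4 : |(n : ℝ) * (2 * (u t₂ - u t₁))| ≤ 2 * M := by
    rw [show (n : ℝ) * (2 * (u t₂ - u t₁)) = u (0 + n * (2 * (t₂ - t₁))) - u 0 by rw [h1]; ring]
    exact (abs_sub _ _).trans (by linarith)
  have h5 : |(2 * (u t₂ - u t₁))| = 2 * π := by
    rcases hΔ with h | h <;> rw [h, abs_mul] <;> simp [abs_of_pos pi_pos]
  rw [abs_mul, h5, Nat.abs_cast] at h4
  have : (n : ℝ) * 1 ≤ n * (2 * π) := by gcongr; linarith [pi_gt_three]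
  linarith

end IsFlow

/-! ### The three types of trajectories and their windows -/

section Types

variable {Γ₁ Γ₂ C : ℝ}

theorem exists_window_of_isRegular (h₂ : 0 < Γ₂) (h : Γ₂ < Γ₁) {p : ℝ × ℝ}
    (hp : IsRegular Γ₁ Γ₂ C p) : ∃ α β, IsWindow (levelCos Γ₁ Γ₂ C (levelParam Γ₁ Γ₂ C p)) α β ∧
      ∀ q ∈ levelCurve Γ₁ Γ₂ C p, q.2 ∈ Icc α β := by
  have h₁ := h₂.trans h
  have he := levelParam_pos hp.1
  obtain ⟨R, hR⟩ := levelCos_bounded (C := C) h₂ h he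
  have hcurve := levelCurve_eq h₁.ne' h₂.ne' hp.1
  rw [hcurve]
  refine exists_isWindow ((contDiff_levelCos (n := 1) he).differentiable one_ne_zero) hR
    (mem_cosCurve_self hp.1) fun q hq hs hd => ?_
  have h3 := (mem_cosCurve_levelCos_iff he q).1 (connectedComponentIn_subset _ _ hq)
  exact hp.2 q (hcurve ▸ hq) ((isCritical_iff h₁.ne' h₂.ne' q).2 ⟨h3.1, hs, by rw [h3.2]; exact hd⟩)

theorem isTypeI_of_window (h₂ : 0 < Γ₂) (h : Γ₂ < Γ₁) {p : ℝ × ℝ} (hp : IsRegular Γ₁ Γ₂ C p) {α β : ℝ}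
    (hw : IsWindow (levelCos Γ₁ Γ₂ C (levelParam Γ₁ Γ₂ C p)) α β)
    (hX : ∀ q ∈ levelCurve Γ₁ Γ₂ C p, q.2 ∈ Icc α β)
    (hα : levelCos Γ₁ Γ₂ C (levelParam Γ₁ Γ₂ C p) α = 1)
    (hβ : levelCos Γ₁ Γ₂ C (levelParam Γ₁ Γ₂ C p) β = 1) : IsTypeI Γ₁ Γ₂ C p := by
  have h₁ := h₂.trans h
  have he := levelParam_pos hp.1
  have hc := (contDiff_levelCos (Γ₁ := Γ₁) (Γ₂ := Γ₂) (C := C) (n := 1) he).continuous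
  have hcurve := levelCurve_eq h₁.ne' h₂.ne' hp.1
  rw [hcurve] at hX
  obtain ⟨j, hj⟩ := component_eq_of_window_one hc hw hα hβ (mem_cosCurve_self hp.1) hX
  rw [← hcurve] at hj
  have hgt : ∀ y ∈ Icc α β, -1 < levelCos Γ₁ Γ₂ C (levelParam Γ₁ Γ₂ C p) y := by
    intro y hy
    rcases hy.1.eq_or_lt with rfl | h3
    · rw [hα]; norm_num
    rcases hy.2.eq_or_lt with rfl | h4
    · rw [hβ]; norm_num
    exact (abs_lt.1 (hw.inside y ⟨h3, h4⟩)).1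
  refine ⟨j, hp, enclosed_of_window hc hgt (fun y hy => (abs_lt.1 (hw.inside y hy)).2) hα hβ
    (fun q => ?_) (window_even h₂ h he hw hα hβ).1⟩
  rw [hj]
  have : cos (q.1 - 2 * j * π) = cos q.1 := by
    rw [show (2 * j * π : ℝ) = j * (2 * π) by ring, cos_sub_int_mul_two_pi]
  rw [this]

theorem isTypeII_of_window (hA : Admissible Γ₁ Γ₂ C) {p : ℝ × ℝ} (hp : IsRegular Γ₁ Γ₂ C p) {α β : ℝ}
    (hw : IsWindow (levelCos Γ₁ Γ₂ C (levelParam Γ₁ Γ₂ C p)) α β)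
    (hX : ∀ q ∈ levelCurve Γ₁ Γ₂ C p, q.2 ∈ Icc α β)
    (hα : levelCos Γ₁ Γ₂ C (levelParam Γ₁ Γ₂ C p) α = -1)
    (hβ : levelCos Γ₁ Γ₂ C (levelParam Γ₁ Γ₂ C p) β = -1) : IsTypeII Γ₁ Γ₂ C p := by
  have h₂ := hA.pos
  have h₁ := h₂.trans hA.lt
  have he := levelParam_pos hp.1
  have hc := (contDiff_levelCos (Γ₁ := Γ₁) (Γ₂ := Γ₂) (C := C) (n := 1) he).continuous
  have hcurve := levelCurve_eq h₁.ne' h₂.ne' hp.1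
  rw [hcurve] at hX
  obtain ⟨j, hj⟩ := component_eq_of_window_neg_one hc hw hα hβ (mem_cosCurve_self hp.1) hX
  rw [← hcurve] at hj
  have hlt : ∀ y ∈ Icc α β, levelCos Γ₁ Γ₂ C (levelParam Γ₁ Γ₂ C p) y < 1 := by
    intro y hy
    rcases hy.1.eq_or_lt with rfl | h3
    · rw [hα]; norm_num
    rcases hy.2.eq_or_lt with rfl | h4
    · rw [hβ]; norm_num
    exact (abs_lt.1 (hw.inside y ⟨h3, h4⟩)).2
  refine ⟨j, hp, enclosed_of_window hc.neg (fun y hy => by simpa using hlt y hy)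
    (fun y hy => ?_) (by simp [hα]) (by simp [hβ])
    (fun q => ?_) (window_odd hA he hw hα hβ)⟩
  · have := (abs_lt.1 (hw.inside y hy)).1
    simp only [Pi.neg_apply]; linarith
  rw [hj]
  have : cos (q.1 - (2 * j + 1) * π) = -cos q.1 := by
    rw [show q.1 - (2 * j + 1) * π = q.1 - j * (2 * π) - π by ring, cos_sub_pi,
      cos_sub_int_mul_two_pi]
  rw [this, Pi.neg_apply, neg_inj]

/-- Here `levelCos < 1` on the window, so the curve misses the lines `u = 2kπ` and cannot enclose a
point of them. -/
theorem not_isTypeI_of_window (h₂ : 0 < Γ₂) (h : Γ₂ < Γ₁) {p : ℝ × ℝ} (hp : IsRegular Γ₁ Γ₂ C p)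
    {α β : ℝ} (hw : IsWindow (levelCos Γ₁ Γ₂ C (levelParam Γ₁ Γ₂ C p)) α β)
    (hX : ∀ q ∈ levelCurve Γ₁ Γ₂ C p, q.2 ∈ Icc α β)
    (hα : levelCos Γ₁ Γ₂ C (levelParam Γ₁ Γ₂ C p) α = -1)
    (hβ : levelCos Γ₁ Γ₂ C (levelParam Γ₁ Γ₂ C p) β = -1) : ¬ IsTypeI Γ₁ Γ₂ C p := by
  rintro ⟨k, -, -, -, hb⟩
  refine not_isBounded_component_of_line (fun y hy => ?_) _ hb
  have h3 : cos (2 * k * π) = levelCos Γ₁ Γ₂ C (levelParam Γ₁ Γ₂ C p) y := by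
    rw [levelCurve_eq (h₂.trans h).ne' h₂.ne' hp.1] at hy
    exact connectedComponentIn_subset (cosCurve _) _ hy
  rw [show (2 * k * π : ℝ) = k * (2 * π) by ring, cos_int_mul_two_pi] at h3
  obtain ⟨h4, h5⟩ := hX _ hy
  rcases h4.eq_or_lt with h6 | h6
  · simp only at h6; rw [← h6, hα] at h3; norm_num at h3
  rcases h5.eq_or_lt with h7 | h7
  · simp only at h7; rw [h7, hβ] at h3; norm_num at h3
  have := (abs_lt.1 (hw.inside y ⟨h6, h7⟩)).2
  linarith

theorem not_isTypeII_of_window (h₂ : 0 < Γ₂) (h : Γ₂ < Γ₁) {p : ℝ × ℝ} (hp : IsRegular Γ₁ Γ₂ C p)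
    {α β : ℝ} (hw : IsWindow (levelCos Γ₁ Γ₂ C (levelParam Γ₁ Γ₂ C p)) α β)
    (hX : ∀ q ∈ levelCurve Γ₁ Γ₂ C p, q.2 ∈ Icc α β)
    (hα : levelCos Γ₁ Γ₂ C (levelParam Γ₁ Γ₂ C p) α = 1)
    (hβ : levelCos Γ₁ Γ₂ C (levelParam Γ₁ Γ₂ C p) β = 1) : ¬ IsTypeII Γ₁ Γ₂ C p := by
  rintro ⟨k, -, -, -, hb⟩
  refine not_isBounded_component_of_line (fun y hy => ?_) _ hb
  have h3 : cos ((2 * k + 1) * π) = levelCos Γ₁ Γ₂ C (levelParam Γ₁ Γ₂ C p) y := by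
    rw [levelCurve_eq (h₂.trans h).ne' h₂.ne' hp.1] at hy
    exact connectedComponentIn_subset (cosCurve _) _ hy
  rw [show ((2 * k + 1) * π : ℝ) = k * (2 * π) + π by ring, cos_int_mul_two_pi_add_pi] at h3
  obtain ⟨h4, h5⟩ := hX _ hy
  rcases h4.eq_or_lt with h6 | h6
  · simp only at h6; rw [← h6, hα] at h3; norm_num at h3
  rcases h5.eq_or_lt with h7 | h7
  · simp only at h7; rw [h7, hβ] at h3; norm_num at h3
  have := (abs_lt.1 (hw.inside y ⟨h6, h7⟩)).1
  linarith

/-- If the ends of the window are different, then the level curve is not closed. -/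
theorem not_isCompact_levelCurve (h₂ : 0 < Γ₂) (h : Γ₂ < Γ₁) {p : ℝ × ℝ} (hp : p ∈ reducedDomain Γ₁ Γ₂ C)
    {α β : ℝ} (hw : IsWindow (levelCos Γ₁ Γ₂ C (levelParam Γ₁ Γ₂ C p)) α β)
    (hX : ∀ q ∈ levelCurve Γ₁ Γ₂ C p, q.2 ∈ Icc α β)
    (hαβ : levelCos Γ₁ Γ₂ C (levelParam Γ₁ Γ₂ C p) α = -levelCos Γ₁ Γ₂ C (levelParam Γ₁ Γ₂ C p) β) :
    ¬ IsCompact (levelCurve Γ₁ Γ₂ C p) := by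
  have he := levelParam_pos hp
  rw [levelCurve_eq (h₂.trans h).ne' h₂.ne' hp] at hX ⊢
  obtain ⟨u, y, hf, hu, hy⟩ := exists_isFlow (contDiff_levelCos he)
    (contDiff_levelSpeed (Γ₁ := Γ₁) (Γ₂ := Γ₂) (C := C) he)
    (mem_cosCurve_self hp) hX
  have := hf.not_isCompact (contDiff_levelCos he) (contDiff_levelSpeed he) (levelSpeed_pos h₂ he) hw
    (fun t => hX _ (by have := hf.mem_component 0 t; rwa [hu, hy] at this)) hαβ
  rwa [hu, hy] at this

/-- The windows of the trajectories of the three types. -/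
theorem window_cases (hA : Admissible Γ₁ Γ₂ C) {p : ℝ × ℝ} (hp : IsRegular Γ₁ Γ₂ C p) :
    ∃ α β, IsWindow (levelCos Γ₁ Γ₂ C (levelParam Γ₁ Γ₂ C p)) α β ∧
      (∀ q ∈ levelCurve Γ₁ Γ₂ C p, q.2 ∈ Icc α β) ∧
      (IsTypeI Γ₁ Γ₂ C p → levelCos Γ₁ Γ₂ C (levelParam Γ₁ Γ₂ C p) α = 1 ∧
        levelCos Γ₁ Γ₂ C (levelParam Γ₁ Γ₂ C p) β = 1) ∧
      (IsTypeII Γ₁ Γ₂ C p → levelCos Γ₁ Γ₂ C (levelParam Γ₁ Γ₂ C p) α = -1 ∧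
        levelCos Γ₁ Γ₂ C (levelParam Γ₁ Γ₂ C p) β = -1) ∧
      (¬ IsTypeI Γ₁ Γ₂ C p → ¬ IsTypeII Γ₁ Γ₂ C p → levelCos Γ₁ Γ₂ C (levelParam Γ₁ Γ₂ C p) α =
        -levelCos Γ₁ Γ₂ C (levelParam Γ₁ Γ₂ C p) β) ∧
      (levelCos Γ₁ Γ₂ C (levelParam Γ₁ Γ₂ C p) α = -levelCos Γ₁ Γ₂ C (levelParam Γ₁ Γ₂ C p) β →
        IsTypeIII Γ₁ Γ₂ C p) := by
  have h₂ := hA.pos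
  have h := hA.lt
  obtain ⟨α, β, hw, hX⟩ := exists_window_of_isRegular h₂ h hp
  refine ⟨α, β, hw, hX, ?_⟩
  have hnc := not_isCompact_levelCurve h₂ h hp.1 hw hX
  have h1 := isTypeI_of_window h₂ h hp hw hX
  have h2 := isTypeII_of_window hA hp hw hX
  have h3 := not_isTypeI_of_window h₂ h hp hw hX
  have h4 := not_isTypeII_of_window h₂ h hp hw hX
  have hα := (abs_eq zero_le_one).1 hw.left
  have hβ := (abs_eq zero_le_one).1 hw.right
  have hc1 : IsTypeI Γ₁ Γ₂ C p → IsCompact (levelCurve Γ₁ Γ₂ C p) := fun ⟨_, hk⟩ => hk.2.1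
  have hc2 : IsTypeII Γ₁ Γ₂ C p → IsCompact (levelCurve Γ₁ Γ₂ C p) := fun ⟨_, hk⟩ => hk.2.1
  rw [IsTypeIII]
  clear hX hw
  generalize levelCos Γ₁ Γ₂ C (levelParam Γ₁ Γ₂ C p) α = x at *
  generalize levelCos Γ₁ Γ₂ C (levelParam Γ₁ Γ₂ C p) β = y at *
  have hne : ¬ (1 : ℝ) = -1 := by norm_num
  have hne' : ¬ (-1 : ℝ) = 1 := by norm_num
  -- The values at the ends are `±1`; each of the four combinations is settled by the implications
  -- above, with compactness separating Type III from the others.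
  rcases hα with rfl | rfl <;> rcases hβ with rfl | rfl <;>
    simp only [neg_neg, hne, hne', forall_true_left, and_self, and_true, false_imp_iff,
      and_false, imp_false] at * <;> tauto

end Types

/-! ### Continuous arguments -/

/-- A continuous function that avoids a number modulo `2π` varies by less than `2π`. -/
theorem abs_sub_lt_two_pi {θ : ℝ → ℝ} {c t t' : ℝ} (hθ : ContinuousOn θ (uIcc t t'))
    (h : ∀ s ∈ uIcc t t', ∀ n : ℤ, θ s ≠ c + n * (2 * π)) : |θ t - θ t'| < 2 * π := by
  have hpi := pi_pos
  by_contra! hcon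
  have hivt := intermediate_value_uIcc hθ
  set m := min (θ t) (θ t')
  obtain ⟨n, hn1, hn2⟩ : ∃ n : ℤ, m ≤ c + n * (2 * π) ∧ c + n * (2 * π) ≤ m + 2 * π := by
    refine ⟨⌈(m - c) / (2 * π)⌉, ?_, ?_⟩
    · have := Int.le_ceil ((m - c) / (2 * π))
      rw [div_le_iff₀ (by positivity)] at this
      linarith
    · have := (Int.ceil_lt_add_one ((m - c) / (2 * π))).le
      rw [← sub_le_iff_le_add, le_div_iff₀ (by positivity)] at this
      linarith
  have hmem : c + n * (2 * π) ∈ uIcc (θ t) (θ t') := by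
    refine ⟨hn1, hn2.trans ?_⟩
    have h1 : max (θ t) (θ t') - m = |θ t - θ t'| := max_sub_min_eq_abs' _ _
    change m + 2 * π ≤ max (θ t) (θ t')
    linarith
  obtain ⟨s, hs, hs'⟩ := hivt hmem
  exact h s hs n hs'

/-- Such a function never takes a value `f t₀ + π` modulo `2π`, so it varies by less than `2π`,
while its differences from `f t₀` are multiples of `2π`. -/
theorem eq_of_cos_sub_eq_one {f : ℝ → ℝ} (hf : Continuous f) {t₀ : ℝ}
    (h : ∀ t, cos (f t - f t₀) = 1) (t : ℝ) : f t = f t₀ := by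
  have h1 : |f t - f t₀| < 2 * π := by
    refine abs_sub_lt_two_pi (c := f t₀ + π) hf.continuousOn fun s _ n hs => ?_
    have := h s
    rw [hs, show f t₀ + π + n * (2 * π) - f t₀ = n * (2 * π) + π by ring,
      cos_int_mul_two_pi_add_pi] at this
    norm_num at this
  obtain ⟨n, hn⟩ := (cos_eq_one_iff _).1 (h t)
  have h2 := abs_lt.1 (hn ▸ h1)
  have h3 : n = 0 := by
    have hpi := two_pi_pos
    have h4 : (n : ℝ) < 1 := by nlinarith [h2.2]
    have h5 : (-1 : ℝ) < n := by nlinarith [h2.1]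
    have h4' : n < 1 := by exact_mod_cast h4
    have h5' : -1 < n := by exact_mod_cast h5
    omega
  rw [h3] at hn
  simp at hn
  linarith

namespace IsAngle

variable {w : ℝ → ℂ} {θ : ℝ → ℝ}

theorem re_eq (h : IsAngle w θ) (t : ℝ) : (w t).re = ‖w t‖ * cos (θ t) := by
  conv_lhs => rw [h.2 t]
  rw [Complex.re_ofReal_mul, Complex.exp_ofReal_mul_I_re]

theorem im_eq (h : IsAngle w θ) (t : ℝ) : (w t).im = ‖w t‖ * sin (θ t) := by
  conv_lhs => rw [h.2 t]
  rw [Complex.im_ofReal_mul, Complex.exp_ofReal_mul_I_im]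

end IsAngle

/-- With `F` a primitive of `w'/w`, one has `w = w(0) exp F`; the imaginary part of `F`, added to
the argument of `w(0)`, is an angle. -/
theorem exists_isAngle {w w' : ℝ → ℂ} (hw : ∀ t, HasDerivAt w (w' t) t) (hw' : Continuous w')
    (h0 : ∀ t, w t ≠ 0) : ∃ θ, IsAngle w θ := by
  have hwc : Continuous w := continuous_iff_continuousAt.2 fun t => (hw t).continuousAt
  have hc : Continuous fun t => w' t / w t := hw'.div hwc h0
  set F : ℝ → ℂ := fun t => ∫ s in (0 : ℝ)..t, w' s / w s with hF
  have hFd : ∀ t, HasDerivAt F (w' t / w t) t := fun t =>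
    intervalIntegral.integral_hasDerivAt_right (hc.intervalIntegrable _ _)
      (hc.stronglyMeasurableAtFilter _ _) hc.continuousAt
  have hFc : Continuous F := continuous_iff_continuousAt.2 fun t => (hFd t).continuousAt
  have hprod : ∀ t, w t = w 0 * Complex.exp (F t) := by
    have hd : ∀ t, HasDerivAt (fun t => w t * Complex.exp (-F t)) 0 t := fun t => by
      refine ((hw t).mul (hFd t).fun_neg.cexp).congr_deriv ?_
      have := h0 t
      field_simp
      ring
    intro t
    have := is_const_of_deriv_eq_zero (fun t => (hd t).differentiableAt) (fun t => (hd t).deriv) t 0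
    simp only [hF, intervalIntegral.integral_same, neg_zero, Complex.exp_zero, mul_one] at this
    rw [← this, mul_assoc, ← Complex.exp_add, neg_add_cancel, Complex.exp_zero, mul_one]
  refine ⟨fun t => (w 0).arg + (F t).im, by fun_prop, fun t => ?_⟩
  have hn : ‖w t‖ = ‖w 0‖ * rexp (F t).re := by
    rw [hprod t, norm_mul, Complex.norm_exp]
  rw [hn]
  conv_lhs => rw [hprod t, ← Complex.norm_mul_exp_arg_mul_I (w 0), ← Complex.re_add_im (F t)]
  push_cast
  rw [Complex.exp_add, add_mul, Complex.exp_add]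
  ring

/-- A closed curve that consists of an arc in a half plane, joining opposite directions, and of its
mirror image, makes a full turn. -/
theorem IsAngle.full_turn {w : ℝ → ℂ} {θ : ℝ → ℝ} (h : IsAngle w θ) (h0 : ∀ t, w t ≠ 0) {t₁ t₂ σ : ℝ}
    (h12 : t₁ < t₂) (hσ : σ = 1 ∨ σ = -1) (hre : ∀ t ∈ Icc t₁ t₂, 0 ≤ σ * (w t).re)
    (h1 : (w t₁).re = 0) (h2 : (w t₂).re = 0) (him : (w t₁).im * (w t₂).im < 0)
    (hrefl : ∀ t, (w (2 * t₂ - t)).re = -(w t).re ∧ (w (2 * t₂ - t)).im = (w t).im)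
    (hper : ∀ t, w (t + 2 * (t₂ - t₁)) = w t) :
    (∀ t, θ (t + 2 * (t₂ - t₁)) = θ t + 2 * π) ∨ ∀ t, θ (t + 2 * (t₂ - t₁)) = θ t - 2 * π := by
  have hn : ∀ t, 0 < ‖w t‖ := fun t => norm_pos_iff.2 (h0 t)
  have hθ := h.1
  have hcos1 : cos (θ t₁) = 0 := by
    have := h.re_eq t₁; rw [h1] at this
    simpa [(hn t₁).ne'] using this.symm
  have hcos2 : cos (θ t₂) = 0 := by
    have := h.re_eq t₂; rw [h2] at this
    simpa [(hn t₂).ne'] using this.symm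
  have hsin : sin (θ t₁) * sin (θ t₂) < 0 := by
    rw [h.im_eq, h.im_eq] at him
    by_contra! hc
    have := mul_nonneg (mul_pos (hn t₁) (hn t₂)).le hc
    linarith
  have hdiff : cos (θ t₂ - θ t₁) = -1 := by
    rw [cos_sub, hcos1, hcos2]
    have e1 := sin_sq_add_cos_sq (θ t₁)
    have e2 := sin_sq_add_cos_sq (θ t₂)
    rw [hcos1] at e1
    rw [hcos2] at e2
    have h3 : (sin (θ t₁) * sin (θ t₂)) ^ 2 = 1 := by
      rw [mul_pow]
      have e1' : sin (θ t₁) ^ 2 = 1 := by linarith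
      have e2' : sin (θ t₂) ^ 2 = 1 := by linarith
      rw [e1', e2', one_mul]
    have h4 : (sin (θ t₁) * sin (θ t₂) - 1) * (sin (θ t₁) * sin (θ t₂) + 1) = 0 := by linarith
    rcases mul_eq_zero.1 h4 with h4 | h4 <;> linarith
  -- In the half plane of sign `σ` the angle omits the direction of the opposite real half-axis.
  -- Being an odd multiple of `π` and less than `2π` in size, the change is `±π`.
  have hlt : |θ t₂ - θ t₁| < 2 * π := by
    rw [abs_sub_comm]
    refine abs_sub_lt_two_pi (c := if σ = 1 then π else 0) hθ.continuousOn fun s hs n hs' => ?_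
    rw [uIcc_of_le h12.le] at hs
    have h3 := hre s hs
    rw [h.re_eq, hs'] at h3
    have := hn s
    rcases hσ with rfl | rfl
    · rw [if_pos rfl, cos_add_int_mul_two_pi, cos_pi] at h3; linarith
    · rw [if_neg (by norm_num), cos_add_int_mul_two_pi, cos_zero] at h3; linarith
  have hpm : θ t₂ - θ t₁ = π ∨ θ t₂ - θ t₁ = -π := by
    have h3 : cos (θ t₂ - θ t₁ + π) = 1 := by rw [cos_add_pi, hdiff, neg_neg]
    obtain ⟨n, hn⟩ := (cos_eq_one_iff _).1 h3
    have h4 := abs_lt.1 hlt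
    have hpi := pi_pos
    have h5 : n = 0 ∨ n = 1 := by
      have h6 : (n : ℝ) < 2 := by nlinarith
      have h7 : (-1 : ℝ) < n := by nlinarith
      have h6' : n < 2 := by exact_mod_cast h6
      have h7' : -1 < n := by exact_mod_cast h7
      omega
    rcases h5 with rfl | rfl
    · right; simp at hn; linarith
    · left; simp at hn; linarith
  -- The mirror symmetry makes `θ (2t₂ - t) + θ t` constant, so the second half contributes the same
  -- change as the first.
  have hsum : θ (2 * t₂ - t₁) + θ t₁ = θ (2 * t₂ - t₂) + θ t₂ := by
    refine eq_of_cos_sub_eq_one (f := fun t => θ (2 * t₂ - t) + θ t) (by fun_prop) (fun t => ?_) t₁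
    have hnorm : ‖w (2 * t₂ - t)‖ = ‖w t‖ := by
      rw [Complex.norm_eq_sqrt_sq_add_sq, Complex.norm_eq_sqrt_sq_add_sq, (hrefl t).1, (hrefl t).2, neg_sq]
    have h3 : cos (θ (2 * t₂ - t)) = -cos (θ t) := by
      have := (hrefl t).1
      rw [h.re_eq, h.re_eq, hnorm, ← mul_neg] at this
      exact mul_left_cancel₀ (hn t).ne' this
    have h4 : sin (θ (2 * t₂ - t)) = sin (θ t) := by
      have := (hrefl t).2
      rw [h.im_eq, h.im_eq, hnorm] at this
      exact mul_left_cancel₀ (hn t).ne' this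
    have h5 : cos (θ (2 * t₂ - t) + θ t) = -1 := by
      rw [cos_add, h3, h4]; linarith [sin_sq_add_cos_sq (θ t)]
    have h6 : sin (θ (2 * t₂ - t) + θ t) = 0 := by rw [sin_add, h3, h4]; ring
    have h7 : cos (θ (2 * t₂ - t₂) + θ t₂) = -1 := by
      rw [show 2 * t₂ - t₂ = t₂ by ring, cos_add, hcos2]
      have := sin_sq_add_cos_sq (θ t₂)
      rw [hcos2] at this
      linarith
    rw [cos_sub, h5, h6, h7]; ring
  -- By periodicity of `w` the change over a period is a multiple of `2π`; it is continuous in `t`,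
  -- so it is the same for all `t`.
  have hconst : ∀ t, θ (t + 2 * (t₂ - t₁)) - θ t = θ (t₁ + 2 * (t₂ - t₁)) - θ t₁ := by
    refine eq_of_cos_sub_eq_one (f := fun t => θ (t + 2 * (t₂ - t₁)) - θ t) (by fun_prop) fun t => ?_
    have key : ∀ t, cos (θ (t + 2 * (t₂ - t₁)) - θ t) = 1 ∧ sin (θ (t + 2 * (t₂ - t₁)) - θ t) = 0 := by
      intro t
      have h3 : cos (θ (t + 2 * (t₂ - t₁))) = cos (θ t) := by
        have := h.re_eq (t + 2 * (t₂ - t₁))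
        rw [hper, h.re_eq] at this
        exact (mul_left_cancel₀ (hn t).ne' this).symm
      have h4 : sin (θ (t + 2 * (t₂ - t₁))) = sin (θ t) := by
        have := h.im_eq (t + 2 * (t₂ - t₁))
        rw [hper, h.im_eq] at this
        exact (mul_left_cancel₀ (hn t).ne' this).symm
      rw [cos_sub, sin_sub, h3, h4]
      exact ⟨by linarith [sin_sq_add_cos_sq (θ t)], by ring⟩
    rw [cos_sub, (key t).1, (key t).2, (key t₁).1]; ring
  have e : t₁ + 2 * (t₂ - t₁) = 2 * t₂ - t₁ := by ring
  have e' : 2 * t₂ - t₂ = t₂ := by ring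
  rw [e] at hconst
  rw [e'] at hsum
  rcases hpm with h3 | h3
  · left; intro t; linarith [hconst t]
  · right; intro t; linarith [hconst t]

/-! ### Rotation, periods and the argument of the separation -/

section Separation

variable {Γ₁ Γ₂ C : ℝ}

theorem separation_re (s : ℝ → ℂ × ℂ) (n : ℤ) (t : ℝ) :
    (separation s n t).re = (s t).1.re - (s t).2.re - n * π := by
  simp only [separation, mobiusFlip, Complex.sub_re]; ring

theorem separation_im (s : ℝ → ℂ × ℂ) (n : ℤ) (t : ℝ) :
    (separation s n t).im = (s t).1.im - (-1) ^ n * (s t).2.im := by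
  simp only [separation, mobiusFlip, Complex.sub_im]

theorem separation_ne_zero {s : ℝ → ℂ × ℂ} {n : ℤ} {t : ℝ} (h : NoCollision (s t)) :
    separation s n t ≠ 0 := by
  intro h0
  have h1 := separation_re s n t
  have h2 := separation_im s n t
  rw [h0] at h1 h2
  rw [noCollision_iff, show (s t).1.re - (s t).2.re = n * π by simp at h1; linarith,
    cos_int_mul_pi] at h
  rcases Int.even_or_odd n with hn | hn
  · rw [hn.neg_one_zpow] at h h2
    rw [show (s t).1.im - (s t).2.im = 0 by simp at h2; linarith, cosh_zero] at h
    linarith [h.1]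
  · rw [hn.neg_one_zpow] at h h2
    rw [show (s t).1.im + (s t).2.im = 0 by simp at h2; linarith, cosh_zero] at h
    linarith [h.2]

namespace IsLevelMotion

variable {e : ℝ} {s : ℝ → ℂ × ℂ}

theorem exists_isAngle_separation (hm : IsLevelMotion Γ₁ Γ₂ C e s) (hs : IsMotion Γ₁ Γ₂ s) (n : ℤ) :
    ∃ θ, IsAngle (separation s n) θ := by
  have hu := hm.flow.continuous_fst
  have hy := hm.flow.continuous_snd
  have hG : Continuous (levelSpeed Γ₁ Γ₂ C e) := (contDiff_levelSpeed (n := 0) hm.pos).continuous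
  have hW : Continuous (deriv (levelCos Γ₁ Γ₂ C e)) :=
    (contDiff_one_deriv (contDiff_levelCos hm.pos)).continuous
  refine exists_isAngle (w' := fun t =>
    Complex.equivRealProdCLM.symm
      (-(deriv (levelCos Γ₁ Γ₂ C e) (s t).1.im * levelSpeed Γ₁ Γ₂ C e (s t).1.im),
      sin ((s t).1.re - (s t).2.re) * levelSpeed Γ₁ Γ₂ C e (s t).1.im -
        (-1) ^ n * (-(Γ₁ / Γ₂) *
          (sin ((s t).1.re - (s t).2.re) * levelSpeed Γ₁ Γ₂ C e (s t).1.im))))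
    (fun t => ?_) ?_ fun t => separation_ne_zero (hs t).1
  · rw [hasDerivAt_complex_iff]
    simp only [separation_re, separation_im, Complex.equivRealProdCLM_symm_apply_re,
      Complex.equivRealProdCLM_symm_apply_im, hm.height]
    exact ⟨(hm.flow.hasDerivAt_fst t).sub_const _, (hm.flow.hasDerivAt_snd t).sub
      (((hasDerivAt_height₂ _).comp t (hm.flow.hasDerivAt_snd t)).const_mul _)⟩
  · have h1 := hW.comp hy
    have h2 := hG.comp hy
    have h3 := continuous_sin.comp hu
    simp only [Function.comp_def] at h1 h2 h3
    refine Complex.equivRealProdCLM.symm.continuous.comp ((h1.mul h2).neg.prodMk ?_)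
    exact (h3.mul h2).sub (continuous_const.mul (continuous_const.mul (h3.mul h2)))

variable {α β : ℝ} {k : ℤ} {t₁ t₂ : ℝ}

theorem period (hm : IsLevelMotion Γ₁ Γ₂ C e s)
    (hp : IsFlow.IsHalfPeriod (fun t => (s t).1.re - (s t).2.re) (fun t => (s t).1.im) α β k t₁ t₂) (t : ℝ) :
    (s (t + 2 * (t₂ - t₁))).1.re = (s t).1.re + 2 * ((s t₂).1.re - (s t₁).1.re) ∧
    (s (t + 2 * (t₂ - t₁))).2.re = (s t).2.re + 2 * ((s t₂).2.re - (s t₁).2.re) ∧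
    (s (t + 2 * (t₂ - t₁))).1.im = (s t).1.im ∧ (s (t + 2 * (t₂ - t₁))).2.im = (s t).2.im := by
  have hW := contDiff_levelCos (Γ₁ := Γ₁) (Γ₂ := Γ₂) (C := C) (n := 2) hm.pos
  have hG := contDiff_levelSpeed (Γ₁ := Γ₁) (Γ₂ := Γ₂) (C := C) (n := 1) hm.pos
  have h3 := (hm.flow.period hW hG hp t).2
  refine ⟨hm.flow.period_integral hW hG hp hm.drift₁ t, hm.flow.period_integral hW hG hp hm.drift₂ t,
    h3, ?_⟩
  rw [hm.height, hm.height]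
  exact congrArg _ h3

/-- During the half period the separation stays on one side of the vertical axis and joins points
above and below the origin (`him`); the reflection at `t₂` supplies the other side, so
`IsAngle.full_turn` applies. Since `u` returns to its wall, both vortices are displaced equally. -/
theorem turnsAsPair (hm : IsLevelMotion Γ₁ Γ₂ C e s) (hs : IsMotion Γ₁ Γ₂ s)
    (hp : IsFlow.IsHalfPeriod (fun t => (s t).1.re - (s t).2.re) (fun t => (s t).1.im) α β k t₁ t₂)
    (h12 : (s t₁).1.re - (s t₁).2.re = (s t₂).1.re - (s t₂).2.re) {n : ℤ}
    (hn : (s t₁).1.re - (s t₁).2.re = n * π) (hnk : n = k ∨ n = k + 1)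
    (him : ((s t₁).1.im - (-1) ^ n * (s t₁).2.im) * ((s t₂).1.im - (-1) ^ n * (s t₂).2.im) < 0) :
    TurnsAsPair s n (2 * (t₂ - t₁)) (2 * ((s t₂).1.re - (s t₁).1.re)) := by
  have hW := contDiff_levelCos (Γ₁ := Γ₁) (Γ₂ := Γ₂) (C := C) (n := 2) hm.pos
  have hG := contDiff_levelSpeed (Γ₁ := Γ₁) (Γ₂ := Γ₂) (C := C) (n := 1) hm.pos
  have hT := hp.lt
  have hper : ∀ t, (s (t + 2 * (t₂ - t₁))).1 = (s t).1 + (2 * ((s t₂).1.re - (s t₁).1.re) : ℝ) ∧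
      (s (t + 2 * (t₂ - t₁))).2 = (s t).2 + (2 * ((s t₂).1.re - (s t₁).1.re) : ℝ) := fun t => by
    obtain ⟨h1, h2, h3, h4⟩ := hm.period hp t
    refine ⟨Complex.ext ?_ ?_, Complex.ext ?_ ?_⟩
    · rw [Complex.add_re, Complex.ofReal_re, h1]
    · rw [Complex.add_im, Complex.ofReal_im, h3, add_zero]
    · rw [Complex.add_re, Complex.ofReal_re, h2]; linarith
    · rw [Complex.add_im, Complex.ofReal_im, h4, add_zero]
  refine ⟨by linarith, hper, ?_⟩
  obtain ⟨θ, hθ⟩ := hm.exists_isAngle_separation hs n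
  refine ⟨θ, hθ, ?_⟩
  have hre : ∀ σ : ℝ, (∀ t ∈ Ioo t₁ t₂, 0 ≤ σ * ((s t).1.re - (s t).2.re - n * π)) →
      ∀ t ∈ Icc t₁ t₂, 0 ≤ σ * (separation s n t).re := by
    intro σ hσ t ht
    rw [separation_re]
    rcases ht.1.eq_or_lt with rfl | h3
    · rw [hn, sub_self, mul_zero]
    rcases ht.2.eq_or_lt with rfl | h4
    · rw [← h12, hn, sub_self, mul_zero]
    exact hσ t ⟨h3, h4⟩
  -- The strip lies to the right of its left wall `n = k` and to the left of its right wall `n = k +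
  -- 1`.
  obtain ⟨σ, hσ, hσ'⟩ : ∃ σ : ℝ, (σ = 1 ∨ σ = -1) ∧
      ∀ t ∈ Ioo t₁ t₂, 0 ≤ σ * ((s t).1.re - (s t).2.re - n * π) := by
    rcases hnk with rfl | rfl
    · exact ⟨1, Or.inl rfl, fun t ht => by linarith [(hp.strip t ht).1]⟩
    · refine ⟨-1, Or.inr rfl, fun t ht => ?_⟩
      have := (hp.strip t ht).2
      push_cast
      linarith
  refine hθ.full_turn (fun t => separation_ne_zero (hs t).1) hT hσ (hre σ hσ') ?_ ?_ ?_
    (fun t => ?_) fun t => ?_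
  · rw [separation_re, hn, sub_self]
  · rw [separation_re, ← h12, hn, sub_self]
  · rw [separation_im, separation_im]; exact him
  · have h3 := hm.flow.reflect hW hG (c := t₂) (m := n) (h12 ▸ hn) t
    rw [separation_re, separation_re, separation_im, separation_im, h3.1, hm.height, hm.height, h3.2,
      ← h12, hn]
    exact ⟨by ring, rfl⟩
  · obtain ⟨h1, h2⟩ := hper t
    apply Complex.ext
    · rw [separation_re, separation_re, h1, h2]; simp
    · rw [separation_im, separation_im, h1, h2]; simp

/-- The separation from the `n`-th lift is vertical only when `u = nπ`, where `levelCos = (-1)^n`;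
this holds at just one end of the window. So it always crosses the vertical axis at the same point,
and its angle omits one of the directions `±π/2`. -/
theorem neverTurns (hm : IsLevelMotion Γ₁ Γ₂ C e s) (hs : IsMotion Γ₁ Γ₂ s)
    (hw : IsWindow (levelCos Γ₁ Γ₂ C e) α β) (hy : ∀ t, (s t).1.im ∈ Icc α β)
    (hαβ : levelCos Γ₁ Γ₂ C e α = -levelCos Γ₁ Γ₂ C e β) : NeverTurns s := by
  intro n θ hθ t t'
  obtain ⟨η, hη⟩ : ∃ η, ∀ t, (s t).1.re - (s t).2.re = n * π → (s t).1.im = η := by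
    have hcase : ∀ t, (s t).1.re - (s t).2.re = n * π → levelCos Γ₁ Γ₂ C e (s t).1.im = (-1) ^ n ∧
        ((s t).1.im = α ∨ (s t).1.im = β) := fun t ht => by
      have h1 := hm.flow.curve t
      rw [ht, cos_int_mul_pi] at h1
      refine ⟨h1.symm, ?_⟩
      by_contra! hne
      have h2 := hw.inside _ ⟨(hy t).1.lt_of_ne hne.1.symm, (hy t).2.lt_of_ne hne.2⟩
      rw [← h1, abs_zpow, abs_neg, abs_one, one_zpow] at h2
      exact h2.false
    have hn0 : ((-1 : ℝ) ^ n) ≠ 0 := zpow_ne_zero _ (by norm_num)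
    by_cases hα : levelCos Γ₁ Γ₂ C e α = (-1) ^ n
    · refine ⟨α, fun t ht => (hcase t ht).2.resolve_right fun h => ?_⟩
      have h1 := (hcase t ht).1
      rw [h] at h1
      rw [hα, h1] at hαβ
      exact hn0 (by linarith)
    · refine ⟨β, fun t ht => (hcase t ht).2.resolve_left fun h => hα ?_⟩
      rw [← h]; exact (hcase t ht).1
  have hn : ∀ t, 0 < ‖separation s n t‖ := fun t => norm_pos_iff.2 (separation_ne_zero (hs t).1)
  set f := η - (-1) ^ n * height₂ Γ₁ Γ₂ C η with hf
  have hcos : ∀ t, cos (θ t) = 0 → ‖separation s n t‖ * sin (θ t) = f := fun t ht => by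
    have h1 := hθ.re_eq t
    rw [ht, mul_zero, separation_re, sub_eq_zero] at h1
    have h2 := hη t h1
    rw [← hθ.im_eq, separation_im, hm.height, h2]
  refine abs_sub_lt_two_pi (c := if 0 ≤ f then -(π / 2) else π / 2) hθ.1.continuousOn
    fun r _ m hr => ?_
  split_ifs at hr with h0
  · have := hcos r (by rw [hr, cos_add_int_mul_two_pi, cos_neg, cos_pi_div_two])
    rw [hr, sin_add_int_mul_two_pi, sin_neg, sin_pi_div_two] at this
    linarith [hn r]
  · have := hcos r (by rw [hr, cos_add_int_mul_two_pi, cos_pi_div_two])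
    rw [hr, sin_add_int_mul_two_pi, sin_pi_div_two] at this
    linarith [hn r]

end IsLevelMotion

/-- The half period of a motion on a regular trajectory. -/
theorem IsMotion.exists_isHalfPeriod (h₂ : 0 < Γ₂) (h : Γ₂ < Γ₁) {s : ℝ → ℂ × ℂ}
    (hs : IsMotion Γ₁ Γ₂ s) (hC : momentum Γ₁ Γ₂ (s 0) = C)
    (hp : reduce (s 0) ∈ reducedDomain Γ₁ Γ₂ C) {α β : ℝ}
    (hw : IsWindow (levelCos Γ₁ Γ₂ C (levelParam Γ₁ Γ₂ C (reduce (s 0)))) α β)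
    (hX : ∀ q ∈ levelCurve Γ₁ Γ₂ C (reduce (s 0)), q.2 ∈ Icc α β) :
    (∀ t, (s t).1.im ∈ Icc α β) ∧ ∃ (k : ℤ) (t₁ t₂ : ℝ),
      IsFlow.IsHalfPeriod (fun t => (s t).1.re - (s t).2.re) (fun t => (s t).1.im) α β k t₁ t₂ := by
  have h₁ := h₂.trans h
  have hm := hs.isLevelMotion h₁.ne' h₂.ne' hC
  rw [levelCurve_eq h₁.ne' h₂.ne' hp] at hX
  have hy : ∀ t, (s t).1.im ∈ Icc α β := fun t => hX _ (hm.flow.mem_component 0 t)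
  exact ⟨hy, hm.flow.exists_isHalfPeriod (contDiff_levelCos hm.pos)
    (contDiff_levelSpeed (n := 0) hm.pos).continuous (levelSpeed_pos h₂ hm.pos) hw hy⟩

theorem exists_isMotion_of_isRegular (h₂ : 0 < Γ₂) (h : Γ₂ < Γ₁) {z₀ : ℂ × ℂ}
    (hC : momentum Γ₁ Γ₂ z₀ = C) (hp : IsRegular Γ₁ Γ₂ C (reduce z₀)) :
    ∃ s, IsMotion Γ₁ Γ₂ s ∧ s 0 = z₀ := by
  obtain ⟨α, β, -, hX⟩ := exists_window_of_isRegular h₂ h hp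
  exact exists_isMotion (h₂.trans h).ne' h₂.ne' hC hp.1 hX

theorem IsFlow.IsHalfPeriod.int_ends {u y : ℝ → ℝ} {α β t₁ t₂ : ℝ} {k : ℤ}
    (hp : IsFlow.IsHalfPeriod u y α β k t₁ t₂) : ∃ n : ℤ, u t₁ = n * π ∧ (n = k ∨ n = k + 1) := by
  rcases hp.left with h | h
  · exact ⟨k, h, Or.inl rfl⟩
  · exact ⟨k + 1, by push_cast; exact h, Or.inr rfl⟩

/-- The collision height lies strictly inside the window, so `y₁ - y₂` has opposite signs at the two
ends of the half period. -/
theorem IsMotion.turnsAsPair_even (hA : Admissible Γ₁ Γ₂ C) {s : ℝ → ℂ × ℂ} (hs : IsMotion Γ₁ Γ₂ s)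
    (hC : momentum Γ₁ Γ₂ (s 0) = C) (hI : IsTypeI Γ₁ Γ₂ C (reduce (s 0))) :
    ∃ (k : ℤ) (T d : ℝ), TurnsAsPair s (2 * k) T d := by
  have h₂ := hA.pos
  have h₁ := h₂.trans hA.lt
  have hp : IsRegular Γ₁ Γ₂ C (reduce (s 0)) := hI.choose_spec.1
  obtain ⟨α, β, hw, hX, hI', -, -, -⟩ := window_cases hA hp
  obtain ⟨hα, hβ⟩ := hI' hI
  obtain ⟨hy, k, t₁, t₂, hh⟩ := hs.exists_isHalfPeriod h₂ hA.lt hC hp.1 hw hX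
  have hm := hs.isLevelMotion h₁.ne' h₂.ne' hC
  have he := IsFlow.ends_eq hh hα hβ
  have h12 := (hm.flow.levelCos_left hh).1 (he.1.trans he.2.symm)
  obtain ⟨n, hn, hnk⟩ := hh.int_ends
  have hcos := (hm.flow.curve t₁).trans he.1
  have hne : Even n := by
    by_contra hc
    rw [hn, cos_int_mul_pi, (Int.not_even_iff_odd.1 hc).neg_one_zpow] at hcos
    norm_num at hcos
  obtain ⟨j, rfl⟩ := even_iff_exists_two_mul.1 hne
  have hmem := (window_even h₂ hA.lt hm.pos hw hα hβ).1
  have hpos : 0 < halfDiff Γ₁ Γ₂ C β := (halfDiff_pos_iff h₂ h₁ β).2 hmem.2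
  have hneg : halfDiff Γ₁ Γ₂ C α < 0 := by
    rw [halfDiff_eq h₂.ne', div_lt_iff₀ (by linarith)]
    have := (lt_div_iff₀ (by linarith)).1 hmem.1
    linarith
  have hprod : halfDiff Γ₁ Γ₂ C (s t₁).1.im * halfDiff Γ₁ Γ₂ C (s t₂).1.im < 0 := by
    rcases hh.ends with ⟨h3, h4⟩ | ⟨h3, h4⟩ <;> rw [h3, h4]
    · exact mul_neg_of_neg_of_pos hneg hpos
    · exact mul_neg_of_pos_of_neg hpos hneg
  refine ⟨j, _, _, hm.turnsAsPair hs hh h12 hn hnk ?_⟩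
  rw [hne.neg_one_zpow, hm.height, hm.height]
  simp only [halfDiff] at hprod
  linarith

/-- The flipped second vortex has height `-y₂`; here `y₁ + y₂` has opposite signs at the two ends of
the half period. -/
theorem IsMotion.turnsAsPair_odd (hA : Admissible Γ₁ Γ₂ C) {s : ℝ → ℂ × ℂ} (hs : IsMotion Γ₁ Γ₂ s)
    (hC : momentum Γ₁ Γ₂ (s 0) = C) (hI : IsTypeII Γ₁ Γ₂ C (reduce (s 0))) :
    ∃ (k : ℤ) (T d : ℝ), TurnsAsPair s (2 * k + 1) T d := by
  have h₂ := hA.pos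
  have h₁ := h₂.trans hA.lt
  have hp : IsRegular Γ₁ Γ₂ C (reduce (s 0)) := hI.choose_spec.1
  obtain ⟨α, β, hw, hX, -, hI', -, -⟩ := window_cases hA hp
  obtain ⟨hα, hβ⟩ := hI' hI
  obtain ⟨hy, k, t₁, t₂, hh⟩ := hs.exists_isHalfPeriod h₂ hA.lt hC hp.1 hw hX
  have hm := hs.isLevelMotion h₁.ne' h₂.ne' hC
  have he := IsFlow.ends_eq hh hα hβ
  have h12 := (hm.flow.levelCos_left hh).1 (he.1.trans he.2.symm)
  obtain ⟨n, hn, hnk⟩ := hh.int_ends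
  have hcos := (hm.flow.curve t₁).trans he.1
  have hne : Odd n := by
    by_contra hc
    rw [hn, cos_int_mul_pi, (Int.not_odd_iff_even.1 hc).neg_one_zpow] at hcos
    norm_num at hcos
  obtain ⟨j, rfl⟩ := hne
  have hmem := window_odd hA hm.pos hw hα hβ
  have hneg : halfSum Γ₁ Γ₂ C β < 0 := (halfSum_neg_iff h₂ hA.lt β).2 hmem.2
  have hpos : 0 < halfSum Γ₁ Γ₂ C α := by
    rw [halfSum_eq h₂.ne', div_pos_iff_of_pos_right (by linarith)]
    have := (lt_div_iff₀ (by linarith [hA.lt])).1 hmem.1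
    linarith
  have hprod : halfSum Γ₁ Γ₂ C (s t₁).1.im * halfSum Γ₁ Γ₂ C (s t₂).1.im < 0 := by
    rcases hh.ends with ⟨h3, h4⟩ | ⟨h3, h4⟩ <;> rw [h3, h4]
    · exact mul_neg_of_pos_of_neg hpos hneg
    · exact mul_neg_of_neg_of_pos hneg hpos
  refine ⟨j, _, _, hm.turnsAsPair hs hh h12 hn hnk ?_⟩
  rw [(odd_two_mul_add_one j).neg_one_zpow, hm.height, hm.height]
  simp only [halfSum] at hprod
  linarith

/-- The period of a motion on a trajectory of the third type. -/
theorem IsMotion.isSeparationPeriod (hA : Admissible Γ₁ Γ₂ C) {s : ℝ → ℂ × ℂ}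
    (hs : IsMotion Γ₁ Γ₂ s) (hC : momentum Γ₁ Γ₂ (s 0) = C)
    (hI : IsTypeIII Γ₁ Γ₂ C (reduce (s 0))) :
    ∃ T, IsSeparationPeriod s T := by
  have h₂ := hA.pos
  have h₁ := h₂.trans hA.lt
  have hp : IsRegular Γ₁ Γ₂ C (reduce (s 0)) := hI.1
  obtain ⟨α, β, hw, hX, -, -, hI', -⟩ := window_cases hA hp
  have hαβ := hI' hI.2.1 hI.2.2
  obtain ⟨hy, k, t₁, t₂, hh⟩ := hs.exists_isHalfPeriod h₂ hA.lt hC hp.1 hw hX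
  have hm := hs.isLevelMotion h₁.ne' h₂.ne' hC
  have h12 := (hm.flow.levelCos_left hh).2 (IsFlow.ends_neg hh hαβ)
  have hper := fun t => hm.period hh t
  refine ⟨2 * (t₂ - t₁), by linarith [hh.lt], fun t => (hper t).2.2, ?_⟩
  rcases h12 with h12 | h12
  · left; intro t; rw [(hper t).1, (hper t).2.1]; linarith
  · right; intro t; rw [(hper t).1, (hper t).2.1]; linarith

/-- At fixed momentum `y₁ - y₂` is an injective affine function of `y₁`, and `y₁` takes both end
values of the window. -/
theorem IsMotion.exists_separation_ne (hA : Admissible Γ₁ Γ₂ C) {s : ℝ → ℂ × ℂ}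
    (hs : IsMotion Γ₁ Γ₂ s) (hC : momentum Γ₁ Γ₂ (s 0) = C)
    (hI : IsTypeIII Γ₁ Γ₂ C (reduce (s 0))) :
    (∃ t, (s t).1.im - (s t).2.im ≠ (s 0).1.im - (s 0).2.im) ∧ NeverTurns s := by
  have h₂ := hA.pos
  have h₁ := h₂.trans hA.lt
  have hp : IsRegular Γ₁ Γ₂ C (reduce (s 0)) := hI.1
  obtain ⟨α, β, hw, hX, -, -, hI', -⟩ := window_cases hA hp
  have hαβ := hI' hI.2.1 hI.2.2
  obtain ⟨hy, k, t₁, t₂, hh⟩ := hs.exists_isHalfPeriod h₂ hA.lt hC hp.1 hw hX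
  have hm := hs.isLevelMotion h₁.ne' h₂.ne' hC
  refine ⟨?_, hm.neverTurns hs hw hy hαβ⟩
  by_contra! hcon
  have h3 := (hcon t₁).trans (hcon t₂).symm
  rw [hm.height, hm.height] at h3
  have h4 : halfDiff Γ₁ Γ₂ C (s t₁).1.im = halfDiff Γ₁ Γ₂ C (s t₂).1.im := by
    simp only [halfDiff]; rw [h3]
  rw [halfDiff_eq h₂.ne', halfDiff_eq h₂.ne', div_left_inj' (by linarith), sub_left_inj,
    mul_right_inj' (by linarith)] at h4
  rcases hh.ends with ⟨h5, h6⟩ | ⟨h5, h6⟩ <;> rw [h5, h6] at h4 <;>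
    linarith [hw.lt]

end Separation

/-! ### Motions far from the core circle -/

section Directions

variable {Γ₁ Γ₂ C : ℝ}

theorem sq_div_two_le_cosh_sub_one (a : ℝ) : a ^ 2 / 2 ≤ cosh a - 1 := by
  have h1 : cosh a = 1 + 2 * sinh (a / 2) ^ 2 := by
    have h2 := cosh_two_mul (a / 2)
    rw [show 2 * (a / 2) = a by ring] at h2
    linarith [cosh_sq (a / 2)]
  have h3 : (a / 2) ^ 2 ≤ sinh (a / 2) ^ 2 := by
    rw [sq_le_sq, abs_sinh]
    exact self_le_sinh_iff.2 (abs_nonneg _)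
  nlinarith

/-- The numerator `sinh a - cosh a + c` has absolute value at most `2` and the denominator is at
least `a² / 2`. This crude rate suffices for the far field. -/
theorem abs_sinh_div_sub_one_le {a c : ℝ} (ha : 0 < a) (hc : |c| ≤ 1) :
    |sinh a / (cosh a - c) - 1| ≤ 4 / a ^ 2 := by
  have h1 := sq_div_two_le_cosh_sub_one a
  obtain ⟨h2, h3⟩ := abs_le.1 hc
  have ha2 : 0 < a ^ 2 := by positivity
  have hpos : 0 < cosh a - c := by linarith
  have h4 := cosh_sub_sinh a
  have h5 : exp (-a) ≤ 1 := exp_le_one_iff.2 (by linarith)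
  have h6 := exp_pos (-a)
  rw [div_sub_one hpos.ne', abs_div, abs_of_pos hpos, div_le_div_iff₀ hpos ha2]
  have h7 : |sinh a - (cosh a - c)| ≤ 2 := by rw [abs_le]; constructor <;> linarith
  nlinarith

theorem abs_tanh_sub_one_le {a : ℝ} (ha : 0 < a) : |tanh a - 1| ≤ 4 / a ^ 2 := by
  rw [tanh_eq_sinh_div_cosh]
  simpa using abs_sinh_div_sub_one_le ha (c := 0) (by simp)

/-- Since `Γ₁ > Γ₂`, far out `y₂` is about `-(Γ₁/Γ₂) y₁`: `y₁` and `y₁ - y₂` have the sign `σ`,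
while `y₂` and `y₁ + y₂` have the opposite sign, and all are large. -/
theorem exists_far_heights (h₂ : 0 < Γ₂) (h : Γ₂ < Γ₁) (C L : ℝ) :
    ∃ R, ∀ y σ : ℝ, (σ = 1 ∨ σ = -1) → R ≤ σ * y → L ≤ σ * y ∧
      L ≤ σ * (y - height₂ Γ₁ Γ₂ C y) ∧ L ≤ -(σ * (y + height₂ Γ₁ Γ₂ C y)) ∧
      L ≤ -(σ * height₂ Γ₁ Γ₂ C y) := by
  set r := Γ₁ / Γ₂ with hr
  have hr1 : 1 < r := (one_lt_div h₂).2 h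
  refine ⟨max 0 (max L ((L + |C / Γ₂|) / (r - 1))), fun y σ hσ hy => ?_⟩
  have h0 : 0 ≤ σ * y := (le_max_left _ _).trans hy
  have h1 : L ≤ σ * y := ((le_max_left _ _).trans (le_max_right _ _)).trans hy
  have h3 := ((le_max_right _ _).trans (le_max_right _ _)).trans hy
  rw [div_le_iff₀ (by linarith)] at h3
  have h4 : |σ * (C / Γ₂)| = |C / Γ₂| := by rcases hσ with rfl | rfl <;> simp
  have h5 := abs_le.1 h4.le
  have hy2 : height₂ Γ₁ Γ₂ C y = C / Γ₂ - r * y := by rw [height₂, hr]; ring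
  rw [hy2]
  refine ⟨h1, ?_, ?_, ?_⟩
  all_goals nlinarith [h5.1, h5.2]

theorem sinh_mul_sign {σ : ℝ} (hσ : σ = 1 ∨ σ = -1) (x : ℝ) :
    σ * sinh x = sinh (σ * x) ∧ σ * tanh x = tanh (σ * x) ∧ cosh x = cosh (σ * x) := by
  rcases hσ with rfl | rfl <;> simp

/-- The velocities of vortices that are far from the core circle of the Möbius band. -/
theorem exists_far_velocity (h₂ : 0 < Γ₂) (h : Γ₂ < Γ₁) (C : ℝ) {ε : ℝ} (hε : 0 < ε) :
    ∃ R, ∀ (z : ℂ × ℂ) (σ : ℝ), momentum Γ₁ Γ₂ z = C → (σ = 1 ∨ σ = -1) → R ≤ σ * z.1.im →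
      |4 * π * (σ * (velocity Γ₁ Γ₂ z).1.re) - (Γ₁ - 2 * Γ₂)| < ε ∧
        |4 * π * (σ * (velocity Γ₁ Γ₂ z).2.re) + Γ₂| < ε := by
  have h₁ := h₂.trans h
  -- Three error terms, each at most `Γ₁ · 4 / L²`, must add up to less than `ε`.
  set L := 12 * Γ₁ / ε + 1 with hL
  have hL1 : 1 < L := by rw [hL]; linarith [show 0 < 12 * Γ₁ / ε by positivity]
  have hLε : 12 * Γ₁ / L ^ 2 < ε := by
    rw [div_lt_iff₀ (by positivity)]
    have h3 : 12 * Γ₁ < ε * L := by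
      rw [hL, mul_add, mul_div_cancel₀ _ hε.ne']; linarith
    nlinarith
  obtain ⟨R, hR⟩ := exists_far_heights h₂ h C L
  refine ⟨R, fun z σ hC hσ hz => ?_⟩
  obtain ⟨b1, b2, b3, b4⟩ := hR _ σ hσ hz
  rw [← (momentum_eq_iff h₂.ne' z).1 hC] at b2 b3 b4
  have hle : ∀ {a x : ℝ}, L ≤ a → |x| ≤ 4 / a ^ 2 → |x| ≤ 4 / L ^ 2 := fun ha hx =>
    hx.trans (by gcongr)
  have hcos := abs_cos_le_one (z.1.re - z.2.re)
  have c1 := hle b2 (abs_sinh_div_sub_one_le (by linarith) hcos)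
  have c2 := hle b3 (abs_sinh_div_sub_one_le (c := -cos (z.1.re - z.2.re)) (by linarith) (by rwa [abs_neg]))
  have c3 := hle b1 (abs_tanh_sub_one_le (by linarith))
  have c4 := hle b4 (abs_tanh_sub_one_le (by linarith))
  obtain ⟨s1, -, s2⟩ := sinh_mul_sign hσ (z.1.im - z.2.im)
  obtain ⟨s3, -, s4⟩ := sinh_mul_sign hσ (z.1.im + z.2.im)
  obtain ⟨-, s5, -⟩ := sinh_mul_sign hσ z.1.im
  obtain ⟨-, s6, -⟩ := sinh_mul_sign hσ z.2.im
  rw [← s1, ← s2] at c1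
  rw [sinh_neg, cosh_neg, ← s3, ← s4, sub_neg_eq_add] at c2
  rw [← s5] at c3
  rw [tanh_neg, ← s6] at c4
  have hpi := pi_ne_zero
  -- Replacing every quotient by its limit `1` leaves `Γ₁ - 2Γ₂` for the first vortex; for the
  -- second the two interaction terms cancel and `-Γ₂` remains.
  have e1 : 4 * π * (σ * (velocity Γ₁ Γ₂ z).1.re) - (Γ₁ - 2 * Γ₂) =
      -(Γ₂ * (σ * sinh (z.1.im - z.2.im) / (cosh (z.1.im - z.2.im) - cos (z.1.re - z.2.re)) - 1))
      - Γ₂ * (-(σ * sinh (z.1.im + z.2.im)) / (cosh (z.1.im + z.2.im) + cos (z.1.re - z.2.re)) - 1)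
      + Γ₁ * (σ * tanh z.1.im - 1) := by
    simp only [velocity, gapEven_eq, gapOdd_eq]
    field_simp
    ring
  have e2 : 4 * π * (σ * (velocity Γ₁ Γ₂ z).2.re) + Γ₂ =
      Γ₁ * (σ * sinh (z.1.im - z.2.im) / (cosh (z.1.im - z.2.im) - cos (z.1.re - z.2.re)) - 1)
      - Γ₁ * (-(σ * sinh (z.1.im + z.2.im)) / (cosh (z.1.im + z.2.im) + cos (z.1.re - z.2.re)) - 1)
      - Γ₂ * (-(σ * tanh z.2.im) - 1) := by
    have : sinh (z.2.im - z.1.im) = -sinh (z.1.im - z.2.im) := by rw [← sinh_neg]; ring_nf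
    simp only [velocity, gapEven_eq, gapOdd_eq, this, add_comm z.2.im]
    field_simp
    ring
  have hb : ∀ {Γ x : ℝ}, 0 < Γ → |x| ≤ 4 / L ^ 2 → |Γ * x| ≤ Γ * (4 / L ^ 2) := fun hΓ hx => by
    rw [abs_mul, abs_of_pos hΓ]; gcongr
  have hpos : 0 < 4 / L ^ 2 := by positivity
  have hlt : 3 * (Γ₁ * (4 / L ^ 2)) < ε := by
    rw [show 3 * (Γ₁ * (4 / L ^ 2)) = 12 * Γ₁ / L ^ 2 by ring]; exact hLε
  have h21 : Γ₂ * (4 / L ^ 2) < Γ₁ * (4 / L ^ 2) := by gcongr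
  rw [e1, e2]
  have d1 := abs_le.1 (hb h₂ c1)
  have d2 := abs_le.1 (hb h₂ c2)
  have d3 := abs_le.1 (hb h₁ c3)
  have d4 := abs_le.1 (hb h₁ c1)
  have d5 := abs_le.1 (hb h₁ c2)
  have d6 := abs_le.1 (hb h₂ c4)
  rw [abs_lt, abs_lt]
  refine ⟨⟨?_, ?_⟩, ?_, ?_⟩
  · linarith [d1.2, d2.2, d3.1]
  · linarith [d1.1, d2.1, d3.2]
  · linarith [d4.1, d5.2, d6.2]
  · linarith [d4.2, d5.1, d6.1]

theorem zero_mem_reducedDomain {y : ℝ} (hy : halfDiff Γ₁ Γ₂ C y ≠ 0) :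
    ((0, y) : ℝ × ℝ) ∈ reducedDomain Γ₁ Γ₂ C := by
  have hs : sinh (halfDiff Γ₁ Γ₂ C y) ≠ 0 := sinh_ne_zero.2 hy
  rw [mem_reducedDomain_iff]
  simp only [cos_zero]
  rw [coshDiff_eq, coshSum_eq]
  constructor
  · have : 0 < sinh (halfDiff Γ₁ Γ₂ C y) ^ 2 := by positivity
    linarith
  · positivity

/-- Increasing `cos u` decreases the numerator and increases the denominator, so at a given height
the parameter is least at `u = 0`. -/
theorem levelParam_zero_le {q : ℝ × ℝ} (hq : q ∈ reducedDomain Γ₁ Γ₂ C) :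
    levelParam Γ₁ Γ₂ C (0, q.2) ≤ levelParam Γ₁ Γ₂ C q := by
  have h1 := (mem_reducedDomain_iff q).1 hq
  have h3 := selfFactor_pos (Γ₁ := Γ₁) (Γ₂ := Γ₂) (C := C) q.2
  have h4 := cos_le_one q.1
  have h5 := one_le_coshDiff (Γ₁ := Γ₁) (Γ₂ := Γ₂) (C := C) q.2
  have h6 := h1.2
  simp only [levelParam, cos_zero]
  gcongr
  linarith

/-- A motion that starts far from the core circle stays far from it. -/
theorem exists_stays_far (h₂ : 0 < Γ₂) (h : Γ₂ < Γ₁) (C R₁ : ℝ) :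
    ∃ R, ∀ s, IsMotion Γ₁ Γ₂ s → momentum Γ₁ Γ₂ (s 0) = C → R < |(s 0).1.im| →
      ∃ σ : ℝ, (σ = 1 ∨ σ = -1) ∧ ∀ t, R₁ < σ * (s t).1.im := by
  have h₁ := h₂.trans h
  set R₂ := max R₁ (|C| / (Γ₁ + Γ₂) + 1) with hR₂
  have hcR : |C| / (Γ₁ + Γ₂) < R₂ := by
    have : |C| / (Γ₁ + Γ₂) + 1 ≤ R₂ := le_max_right _ _
    linarith
  have hcpos : 0 ≤ |C| / (Γ₁ + Γ₂) := by positivity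
  have hcC := abs_le.1 (show |C / (Γ₁ + Γ₂)| ≤ |C| / (Γ₁ + Γ₂) by
    rw [abs_div, abs_of_pos (show 0 < Γ₁ + Γ₂ by linarith)])
  have hne : ∀ σ : ℝ, (σ = 1 ∨ σ = -1) → ((0, σ * R₂) : ℝ × ℝ) ∈ reducedDomain Γ₁ Γ₂ C := by
    intro σ hσ
    refine zero_mem_reducedDomain fun h0 => ?_
    rw [halfDiff_eq h₂.ne', div_eq_zero_iff, or_iff_left (by linarith), sub_eq_zero] at h0
    have h3 : σ * R₂ = C / (Γ₁ + Γ₂) := by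
      rw [eq_div_iff (by linarith)]; linarith
    rcases hσ with rfl | rfl <;> linarith
  set ε := min (levelParam Γ₁ Γ₂ C (0, 1 * R₂)) (levelParam Γ₁ Γ₂ C (0, -1 * R₂)) with hε
  have hεpos : 0 < ε := lt_min (levelParam_pos (hne 1 (Or.inl rfl))) (levelParam_pos (hne (-1) (Or.inr rfl)))
  obtain ⟨R, hR⟩ := levelParam_tendsto_zero (C := C) h₂ h hεpos
  refine ⟨max R R₂, fun s hs hC hs0 => ?_⟩
  have hm := hs.isLevelMotion h₁.ne' h₂.ne' hC
  -- The heights `±R₂` are barriers: the level parameter is at least `ε` all along them, and it is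
  -- conserved at a value below `ε`.
  have he : levelParam Γ₁ Γ₂ C (reduce (s 0)) < ε := hR _ ((le_max_left _ _).trans_lt hs0)
  obtain ⟨σ, hσ, hσ0⟩ : ∃ σ : ℝ, (σ = 1 ∨ σ = -1) ∧ R₂ < σ * (s 0).1.im := by
    have h3 := (le_max_right R R₂).trans_lt hs0
    rcases abs_cases (s 0).1.im with h4 | h4
    · exact ⟨1, Or.inl rfl, by rw [one_mul, ← h4.1]; exact h3⟩
    · exact ⟨-1, Or.inr rfl, by rw [neg_one_mul, ← h4.1]; exact h3⟩
  refine ⟨σ, hσ, fun t => lt_of_le_of_lt (le_max_left _ _ : R₁ ≤ R₂) ?_⟩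
  by_contra! hcon
  have hc : Continuous fun t => σ * (s t).1.im := continuous_const.mul hm.flow.continuous_snd
  obtain ⟨t', ht'⟩ := mem_range_of_exists_le_of_exists_ge hc ⟨t, hcon⟩ ⟨0, hσ0.le⟩
  simp only at ht'
  have hy : (s t').1.im = σ * R₂ := by
    rcases hσ with rfl | rfl <;> linarith
  obtain ⟨h3, h4⟩ := (mem_cosCurve_levelCos_iff hm.pos
    ((s t').1.re - (s t').2.re, (s t').1.im)).1 (hm.flow.curve t')
  have h5 := levelParam_zero_le h3
  rw [h4, hy] at h5
  have h6 : ε ≤ levelParam Γ₁ Γ₂ C (0, σ * R₂) := by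
    rcases hσ with rfl | rfl
    exacts [min_le_left _ _, min_le_right _ _]
  linarith

theorem IsMotion.hasDerivAt_re {s : ℝ → ℂ × ℂ} (hs : IsMotion Γ₁ Γ₂ s) (t : ℝ) :
    HasDerivAt (fun t => (s t).1.re) (velocity Γ₁ Γ₂ (s t)).1.re t ∧
      HasDerivAt (fun t => (s t).2.re) (velocity Γ₁ Γ₂ (s t)).2.re t := by
  have h := hasDerivAt_pair_iff.1 (hs t).2
  exact ⟨(hasDerivAt_complex_iff.1 h.1).1, (hasDerivAt_complex_iff.1 h.2).1⟩

/-- The direction of the motion of vortices that are far from the core circle. -/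
theorem exists_far_displacement (h₂ : 0 < Γ₂) (h : Γ₂ < Γ₁) (C : ℝ) (hne : Γ₁ ≠ 2 * Γ₂) :
    ∃ R, ∀ s, IsMotion Γ₁ Γ₂ s → momentum Γ₁ Γ₂ (s 0) = C → R < |(s 0).1.im| →
      ∀ t t', t < t' → 0 < (2 * Γ₂ - Γ₁) *
        (((s t').1.re - (s t).1.re) * ((s t').2.re - (s t).2.re)) := by
  have hd : 0 < |Γ₁ - 2 * Γ₂| := abs_pos.2 (sub_ne_zero.2 hne)
  obtain ⟨R₁, hR₁⟩ := exists_far_velocity h₂ h C (lt_min hd h₂)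
  obtain ⟨R, hR⟩ := exists_stays_far h₂ h C R₁
  refine ⟨R, fun s hs hC hs0 => ?_⟩
  obtain ⟨σ, hσ, hfar⟩ := hR s hs hC hs0
  have hσσ : σ * σ = 1 := by rcases hσ with rfl | rfl <;> norm_num
  have hv := fun t => hR₁ (s t) σ ((hs.momentum_eq t).trans hC) hσ (hfar t).le
  have hpi := pi_pos
  have h1 : StrictAnti fun t => σ * (s t).2.re := by
    refine strictAnti_of_deriv_neg fun t => ?_
    rw [((hs.hasDerivAt_re t).2.const_mul σ).deriv]
    have h3 := (abs_lt.1 ((hv t).2.trans_le (min_le_right _ _))).2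
    by_contra! h4
    have : 0 ≤ 4 * π * (σ * (velocity Γ₁ Γ₂ (s t)).2.re) := by positivity
    linarith
  have h2 : StrictMono fun t => (Γ₁ - 2 * Γ₂) * (σ * (s t).1.re) := by
    refine strictMono_of_deriv_pos fun t => ?_
    rw [(((hs.hasDerivAt_re t).1.const_mul σ).const_mul _).deriv]
    have h3 := abs_lt.1 ((hv t).1.trans_le (min_le_left _ _))
    have h5 : 0 < (Γ₁ - 2 * Γ₂) * (4 * π * (σ * (velocity Γ₁ Γ₂ (s t)).1.re)) := by
      rcases abs_cases (Γ₁ - 2 * Γ₂) with h6 | h6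
      · rw [h6.1] at h3 hd
        exact mul_pos hd (by linarith [h3.1])
      · rw [h6.1] at h3
        exact mul_pos_of_neg_of_neg h6.2 (by linarith [h3.2])
    by_contra! h4
    have : 4 * π * ((Γ₁ - 2 * Γ₂) * (σ * (velocity Γ₁ Γ₂ (s t)).1.re)) ≤ 0 :=
      mul_nonpos_of_nonneg_of_nonpos (by positivity) h4
    linarith
  intro t t' htt
  have h3 : 0 < σ * (s t).2.re - σ * (s t').2.re := sub_pos.2 (h1 htt)
  have h4 : 0 < (Γ₁ - 2 * Γ₂) * (σ * (s t').1.re) - (Γ₁ - 2 * Γ₂) * (σ * (s t).1.re) :=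
    sub_pos.2 (h2 htt)
  have h5 := mul_pos h4 h3
  rcases hσ with rfl | rfl <;> linarith

end Directions

/-! ### Existence of Type III motions and admissible parameters -/

section Examples

variable {Γ₁ Γ₂ C : ℝ}

/-- A critical point has `cos u = ±1`, and `cos u = -1` is excluded because `critOdd > 0`. So all
critical points are translates of those on `u = 0`. -/
theorem isCritical_cases (hA : Admissible Γ₁ Γ₂ C) {q : ℝ × ℝ} (hq : IsCritical Γ₁ Γ₂ C q) :
    critEven Γ₁ Γ₂ C q.2 = 0 ∧ levelParam Γ₁ Γ₂ C q = levelParam Γ₁ Γ₂ C (0, q.2) := by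
  have h₂ := hA.pos
  have h₁ := h₂.trans hA.lt
  obtain ⟨hd, hs, hder⟩ := (isCritical_iff h₁.ne' h₂.ne' q).1 hq
  have he := levelParam_pos hd
  have hcurve : cos q.1 = levelCos Γ₁ Γ₂ C (levelParam Γ₁ Γ₂ C q) q.2 := mem_cosCurve_self hd
  have hdom := (mem_reducedDomain_iff q).1 hd
  rcases sin_eq_zero_iff_cos_eq.1 hs with hc | hc
  · rw [hc] at hcurve
    obtain ⟨c, hc0, h3⟩ := deriv_levelCos_of_eq_one h₁.ne' h₂.ne' he hcurve.symm
    refine ⟨?_, by simp only [levelParam, hc, cos_zero]⟩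
    have hne : sinh (halfDiff Γ₁ Γ₂ C q.2) ≠ 0 := fun h0 => by
      rw [coshDiff_eq, h0, hc] at hdom; norm_num at hdom
    rw [hder] at h3
    simpa [hc0.ne', hne, h₂.ne'] using h3.symm
  · rw [hc] at hcurve
    obtain ⟨c, hc0, h3⟩ := deriv_levelCos_of_eq_neg_one h₁.ne' h₂.ne' he hcurve.symm
    have hne : sinh (halfSum Γ₁ Γ₂ C q.2) ≠ 0 := fun h0 => by
      rw [coshSum_eq, h0, hc] at hdom; norm_num at hdom
    rw [hder] at h3
    simp [hc0.ne', hne, h₂.ne', (critOdd_pos hA q.2).ne'] at h3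

/-- A point `(0, y)` far out has a smaller level parameter than all critical points, so its
trajectory is regular. The motion sweeps its whole window and stays beyond both collision heights,
whereas a window of Type I or II would contain one of them. -/
theorem exists_isTypeIII (hA : Admissible Γ₁ Γ₂ C) (R : ℝ) :
    ∃ s, IsMotion Γ₁ Γ₂ s ∧ momentum Γ₁ Γ₂ (s 0) = C ∧ IsTypeIII Γ₁ Γ₂ C (reduce (s 0)) ∧
      R < |(s 0).1.im| := by
  have h₂ := hA.pos
  have h₁ := h₂.trans hA.lt
  obtain ⟨a, b, ha, hb, ha0, hb0, h3, h4, h5⟩ := exists_critEven_sign h₂ hA.lt C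
  have hda : ((0, a) : ℝ × ℝ) ∈ reducedDomain Γ₁ Γ₂ C := by
    refine zero_mem_reducedDomain fun h0 => ?_
    rw [halfDiff_eq h₂.ne', div_eq_zero_iff, or_iff_left (by linarith), sub_eq_zero] at h0
    rw [lt_div_iff₀ (by linarith)] at ha
    linarith
  have hdb : ((0, b) : ℝ × ℝ) ∈ reducedDomain Γ₁ Γ₂ C := by
    exact zero_mem_reducedDomain ((halfDiff_pos_iff h₂ h₁ b).2 hb).ne'
  obtain ⟨R₁, hR₁⟩ := levelParam_tendsto_zero (C := C) h₂ hA.lt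
    (lt_min (levelParam_pos hda) (levelParam_pos hdb))
  obtain ⟨R₂, hR₂⟩ := exists_stays_far h₂ hA.lt C
    (max (|C / (Γ₁ - Γ₂)|) (|C / (Γ₁ + Γ₂)|))
  set y := max R (max R₁ (max R₂ (max b 0))) + 1 with hy
  have hyR : R < y := (le_max_left _ _).trans_lt (lt_add_one _)
  have hyR₁ : R₁ < y := ((le_max_left _ _).trans (le_max_right _ _)).trans_lt (lt_add_one _)
  have hyR₂ : R₂ < y := ((le_max_left _ _).trans ((le_max_right _ _).trans
    (le_max_right _ _))).trans_lt (lt_add_one _)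
  have hyb : max b 0 < y := ((le_max_right _ _).trans ((le_max_right _ _).trans
    (le_max_right _ _))).trans_lt (lt_add_one _)
  have hy0 : 0 < y := (le_max_right _ _).trans_lt hyb
  have hby : b < y := (le_max_left _ _).trans_lt hyb
  have habs : |y| = y := abs_of_pos hy0
  set z₀ : ℂ × ℂ := (⟨0, y⟩, ⟨0, height₂ Γ₁ Γ₂ C y⟩) with hz₀
  have hC : momentum Γ₁ Γ₂ z₀ = C := (momentum_eq_iff h₂.ne' z₀).2 rfl
  have hred : reduce z₀ = (0, y) := by simp [reduce, hz₀]
  have hdom : ((0, y) : ℝ × ℝ) ∈ reducedDomain Γ₁ Γ₂ C :=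
    zero_mem_reducedDomain ((halfDiff_pos_iff h₂ h₁ y).2 (hb.trans hby)).ne'
  have hreg : IsRegular Γ₁ Γ₂ C (0, y) := by
    refine ⟨hdom, fun q hq hcrit => ?_⟩
    rw [levelCurve_eq h₁.ne' h₂.ne' hdom] at hq
    have h6 := ((mem_cosCurve_levelCos_iff (levelParam_pos hdom) q).1
      (connectedComponentIn_subset (cosCurve _) _ hq)).2
    obtain ⟨h7, h8⟩ := isCritical_cases hA hcrit
    have h9 := hR₁ (0, y) (by rw [habs]; exact hyR₁)
    rw [← h6, h8] at h9
    have h10 : q.2 = a ∨ q.2 = b := by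
      rcases lt_trichotomy q.2 a with h | h | h
      · exact absurd h7 (h4 _ h).ne
      · exact Or.inl h
      rcases lt_trichotomy q.2 b with h' | h' | h'
      · exact absurd h7 (h3 _ ⟨h, h'⟩).ne'
      · exact Or.inr h'
      · exact absurd h7 (h5 _ h').ne
    rcases h10 with h | h <;> rw [h] at h9
    · exact h9.not_ge (min_le_left _ _)
    · exact h9.not_ge (min_le_right _ _)
  obtain ⟨s, hs, hs0⟩ := exists_isMotion_of_isRegular h₂ hA.lt hC (by rwa [hred])
  have hreds : reduce (s 0) = (0, y) := by rw [hs0, hred]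
  have hCs : momentum Γ₁ Γ₂ (s 0) = C := by rw [hs0, hC]
  have him : (s 0).1.im = y := by rw [hs0]
  refine ⟨s, hs, hCs, ?_, by rw [him, habs]; exact hyR⟩
  obtain ⟨σ, hσ, hfar⟩ := hR₂ s hs hCs (by rw [him, habs]; exact hyR₂)
  rw [← hreds] at hreg
  obtain ⟨α, β, hw, hX, hI, hII, -, -⟩ := window_cases hA hreg
  obtain ⟨hyI, k, t₁, t₂, hh⟩ := hs.exists_isHalfPeriod h₂ hA.lt hCs hreg.1 hw hX
  have hm := hs.isLevelMotion h₁.ne' h₂.ne' hCs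
  have hmem : ∀ x ∈ Ioo α β, max (|C / (Γ₁ - Γ₂)|) (|C / (Γ₁ + Γ₂)|) < |x| := by
    intro x hx
    have hrange : x ∈ range fun t => (s t).1.im := by
      rcases hh.ends with ⟨h6, h7⟩ | ⟨h6, h7⟩
      · exact mem_range_of_exists_le_of_exists_ge hm.flow.continuous_snd
          ⟨t₁, h6.le.trans hx.1.le⟩ ⟨t₂, hx.2.le.trans h7.ge⟩
      · exact mem_range_of_exists_le_of_exists_ge hm.flow.continuous_snd
          ⟨t₂, h7.le.trans hx.1.le⟩ ⟨t₁, hx.2.le.trans h6.ge⟩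
    obtain ⟨t, rfl⟩ := hrange
    refine (hfar t).trans_le ?_
    rcases hσ with rfl | rfl
    · rw [one_mul]; exact le_abs_self _
    · rw [neg_one_mul]; exact neg_le_abs _
  refine ⟨hreg, fun h => ?_, fun h => ?_⟩
  · exact (hmem _ (window_even h₂ hA.lt hm.pos hw (hI h).1 (hI h).2).1).not_ge (le_max_right _ _)
  · exact (hmem _ (window_odd hA hm.pos hw (hII h).1 (hII h).2)).not_ge (le_max_left _ _)

theorem cosh_add_le_exp_mul_cosh {p : ℝ} (hp : 0 ≤ p) (q : ℝ) : cosh (p + q) ≤ exp p * cosh q := by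
  rw [cosh_eq, cosh_eq, neg_add, exp_add, exp_add]
  have : exp (-p) ≤ exp p := exp_le_exp.2 (by linarith)
  nlinarith [exp_pos (-q)]

/-- Here `a` and `b` stand for `halfDiff` and `halfSum`, which satisfy `b = c - l a` with `c = C/(Γ₁
+ Γ₂)` and `l = (Γ₁ - Γ₂)/(Γ₁ + Γ₂)`. If `a > 0` then `-a/2 ≤ b < 0` and half-angle formulas
suffice; if `a < 0` the offset `c` costs a factor `exp (2c)`, which `hcl` controls. -/
theorem sinh_sq_le_of_offset {l c a b : ℝ} (hl : 1 / 4 ≤ l) (hl' : l ≤ 1 / 2) (hc : 0 ≤ c)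
    (hcl : exp (2 * c) ^ 2 ≤ 8 * l) (hb : b = c - l * a) (hab : a * b < 0) :
    sinh b ^ 2 ≤ l * cosh a ^ 2 := by
  rcases lt_or_ge 0 a with ha | ha
  · have hb0 : b < 0 := by by_contra! h; nlinarith
    have h1 : -b ≤ a / 2 := by nlinarith
    have h2 : sinh (-b) ≤ sinh (a / 2) := sinh_le_sinh.2 h1
    have h3 : 0 ≤ sinh (-b) := sinh_nonneg_iff.2 (by linarith)
    have h4 : sinh b ^ 2 ≤ sinh (a / 2) ^ 2 := by
      rw [← neg_sq, ← sinh_neg]; gcongr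
    have h5 : cosh a = 2 * sinh (a / 2) ^ 2 + 1 := by
      have := cosh_two_mul (a / 2)
      rw [show 2 * (a / 2) = a by ring] at this
      linarith [cosh_sq (a / 2)]
    have h6 : 0 ≤ sinh (a / 2) ^ 2 := sq_nonneg _
    have h7 : 1 / 4 * cosh a ^ 2 ≤ l * cosh a ^ 2 := by gcongr
    nlinarith
  · have ha' : a < 0 := ha.lt_of_ne (by rintro rfl; simp at hab)
    have h1 : cosh (2 * b) = 2 * sinh b ^ 2 + 1 := by rw [cosh_two_mul, cosh_sq]; ring
    have h2 : cosh (2 * b) ≤ exp (2 * c) * cosh (2 * l * -a) := by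
      rw [show 2 * b = 2 * c + 2 * l * -a by rw [hb]; ring]
      exact cosh_add_le_exp_mul_cosh (by linarith) _
    have h3 : cosh (2 * l * -a) ≤ cosh a := by
      rw [cosh_le_cosh, abs_of_nonneg (by nlinarith), abs_of_neg ha']; nlinarith
    have h4 := exp_pos (2 * c)
    have h5 : exp (2 * c) * cosh (2 * l * -a) ≤ exp (2 * c) * cosh a := by gcongr
    have h6 : exp (2 * c) ^ 2 * cosh a ^ 2 ≤ 8 * l * cosh a ^ 2 := by gcongr
    -- With `X = exp (2c) cosh a`: `sinh² b ≤ (X - 1)/2 ≤ X²/8 ≤ l cosh² a`, which is where the `8`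
    -- in `hcl` comes from.
    nlinarith [sq_nonneg (exp (2 * c) * cosh a / 2 - 1)]

/-- Only `critOdd > 0` is at issue, and only where `sinh a * sinh b < 0`. There `|sinh a sinh b| <
cosh a cosh b` and `sinh² b ≤ l cosh² a` bound the negative term by the positive one. -/
theorem admissible_of_offset (h₂ : 0 < Γ₂) (h : Γ₂ < Γ₁) (hC : 0 < C)
    (hl : Γ₁ + Γ₂ ≤ 4 * (Γ₁ - Γ₂)) (hl' : 2 * (Γ₁ - Γ₂) ≤ Γ₁ + Γ₂)
    (hcl : exp (2 * (C / (Γ₁ + Γ₂))) ^ 2 ≤ 8 * ((Γ₁ - Γ₂) / (Γ₁ + Γ₂))) : Admissible Γ₁ Γ₂ C := by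
  have hs : 0 < Γ₁ + Γ₂ := by linarith
  have hd : 0 < Γ₁ - Γ₂ := by linarith
  refine ⟨h₂, h, hC.ne', ncard_critical_zero h₂ h C, ?_⟩
  ext y
  simp only [mem_ofPred_eq, mem_empty_iff_false, iff_false]
  rw [isCritical_pi_iff h₂ h]
  refine ne_of_gt ?_
  set a := halfDiff Γ₁ Γ₂ C y with ha
  set b := halfSum Γ₁ Γ₂ C y with hb
  set l := (Γ₁ - Γ₂) / (Γ₁ + Γ₂) with hl0
  have hlpos : 0 < l := by positivity
  have hcrit : critOdd Γ₁ Γ₂ C y =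
      (Γ₁ + Γ₂) * (l * (cosh a ^ 3 * cosh b) + (sinh a * sinh b) * sinh b ^ 2) := by
    rw [critOdd, hl0]; field_simp; ring
  rw [hcrit]
  refine mul_pos hs ?_
  have hca := cosh_pos a
  have hcb := cosh_pos b
  rcases le_or_gt 0 (sinh a * sinh b) with h3 | h3
  · positivity
  have hab : a * b < 0 := by
    by_contra! h4
    refine h3.not_ge ?_
    rcases le_or_gt 0 a with h5 | h5
    · rcases h5.eq_or_lt with h6 | h6
      · rw [← h6]; simp
      · exact mul_nonneg (sinh_nonneg_iff.2 h5) (sinh_nonneg_iff.2 (nonneg_of_mul_nonneg_right h4 h6))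
    · have h6 : b ≤ 0 := by by_contra! h7; nlinarith
      exact mul_nonneg_of_nonpos_of_nonpos (sinh_nonpos_iff.2 h5.le) (sinh_nonpos_iff.2 h6)
  have h4 := sinh_sq_le_of_offset (l := l) (c := C / (Γ₁ + Γ₂)) (a := a) (b := b)
    (by rw [hl0, div_le_div_iff₀ (by norm_num) hs]; linarith)
    (by rw [hl0, div_le_div_iff₀ hs (by norm_num)]; linarith) (by positivity) hcl
    (by rw [ha, hb, hl0, halfDiff_eq h₂.ne', halfSum_eq h₂.ne']; field_simp; ring) hab
  have h5 : -(sinh a * sinh b) < cosh a * cosh b := by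
    have : |sinh a * sinh b| < cosh a * cosh b := by
      rw [abs_mul]
      have h6 : ∀ x, |sinh x| < cosh x := fun x => by
        rw [abs_sinh, ← cosh_abs]; exact sinh_lt_cosh _
      exact mul_lt_mul'' (h6 a) (h6 b) (abs_nonneg _) (abs_nonneg _)
    exact (neg_le_abs _).trans_lt this
  have h6 : -(sinh a * sinh b) * sinh b ^ 2 ≤ -(sinh a * sinh b) * (l * cosh a ^ 2) :=
    mul_le_mul_of_nonneg_left h4 (by linarith)
  have h7 : -(sinh a * sinh b) * (l * cosh a ^ 2) < cosh a * cosh b * (l * cosh a ^ 2) :=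
    mul_lt_mul_of_pos_right h5 (by positivity)
  linarith

/-- Here `l = 1/4` and `c = 1/8`, so the condition reads `exp (1/2) ≤ 2`. -/
theorem admissible_five_three : Admissible 5 3 1 := by
  refine admissible_of_offset (by norm_num) (by norm_num) one_pos (by norm_num) (by norm_num) ?_
  rw [← exp_nat_mul]
  have h1 := exp_one_lt_d9
  have h2 : exp (1 / 2) ^ 2 = exp 1 := by rw [← exp_nat_mul]; norm_num
  have h3 := exp_pos (1 / 2 : ℝ)
  norm_num at *
  nlinarith

/-- Here `l = 1/2` and `c = 1/4`, so the condition reads `exp 1 ≤ 4`. -/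
theorem admissible_three_one : Admissible 3 1 1 := by
  refine admissible_of_offset (by norm_num) (by norm_num) one_pos (by norm_num) (by norm_num) ?_
  rw [← exp_nat_mul]
  have h1 := exp_one_lt_d9
  norm_num at *
  linarith

end Examples

section Main

variable {Γ₁ Γ₂ C : ℝ}

theorem exists_moveSameDirection (hA : Admissible Γ₁ Γ₂ C) (h : Γ₁ < 2 * Γ₂) :
    ∃ R : ℝ, ∀ s, IsMotion Γ₁ Γ₂ s → momentum Γ₁ Γ₂ (s 0) = C →
      IsTypeIII Γ₁ Γ₂ C (reduce (s 0)) → R < |(s 0).1.im| → MoveSameDirection s := by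
  obtain ⟨R, hR⟩ := exists_far_displacement hA.pos hA.lt C h.ne
  refine ⟨R, fun s hs hC hIII hs0 => ?_⟩
  obtain ⟨T, hT⟩ := hs.isSeparationPeriod hA hC hIII
  refine ⟨T, hT, fun t => ?_⟩
  have := hR s hs hC hs0 t (t + T) (by linarith [hT.1])
  exact pos_of_mul_pos_right this (by linarith)

theorem exists_moveOppositeDirections (hA : Admissible Γ₁ Γ₂ C) (h : 2 * Γ₂ < Γ₁) :
    ∃ R : ℝ, ∀ s, IsMotion Γ₁ Γ₂ s → momentum Γ₁ Γ₂ (s 0) = C →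
      IsTypeIII Γ₁ Γ₂ C (reduce (s 0)) → R < |(s 0).1.im| → MoveOppositeDirections s := by
  obtain ⟨R, hR⟩ := exists_far_displacement hA.pos hA.lt C h.ne'
  refine ⟨R, fun s hs hC hIII hs0 => ?_⟩
  obtain ⟨T, hT⟩ := hs.isSeparationPeriod hA hC hIII
  refine ⟨T, hT, fun t => ?_⟩
  have := hR s hs hC hs0 t (t + T) (by linarith [hT.1])
  exact neg_of_mul_pos_right this (by linarith)

end Main

/-! ### Analyticity of parametric integrals -/

open scoped NNReal ENNReal

/-- Moving the origin of the power series at `(x₀, s₀)` to `(x₀, s)` expands `F (x₀ + h, s)` in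
powers of `h`. The coefficients are continuous in `s` and dominated uniformly by a convergent
series, so integration term by term gives a power series in `h`. -/
theorem exists_analyticAt_integral {F : ℝ × ℝ → ℝ} {x₀ s₀ : ℝ} (hF : AnalyticAt ℝ F (x₀, s₀)) :
    ∃ δ > 0, ∀ a ∈ Metric.ball s₀ δ, ∀ b ∈ Metric.ball s₀ δ,
      AnalyticAt ℝ (fun x => ∫ s in a..b, F (x, s)) x₀ := by
  obtain ⟨p, r, hp⟩ := hF
  -- One radius `ρ` is spent on moving the base point, the other on `h`.
  obtain ⟨ρ, hρ0, hρ⟩ : ∃ ρ : ℝ≥0, 0 < ρ ∧ (ρ + ρ : ℝ≥0∞) < r := by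
    obtain ⟨q, hq0, hq⟩ := ENNReal.lt_iff_exists_nnreal_btwn.1 hp.r_pos
    refine ⟨q / 2, by have := ENNReal.coe_pos.1 hq0; positivity, ?_⟩
    rw [← ENNReal.coe_add, add_halves]
    exact hq
  have hρr : (ρ : ℝ≥0∞) < r := lt_of_le_of_lt le_self_add hρ
  have hρp : (ρ : ℝ≥0∞) < p.radius := hρr.trans_le hp.r_le
  set B : ℕ → ℝ≥0 := fun n =>
    ∑' s : Σ l : ℕ, { s : Finset (Fin (n + l)) // s.card = l }, ‖p (n + s.1)‖₊ * ρ ^ s.1 with hB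
  have hBsum : Summable fun n => B n * ρ ^ n := by
    have := (NNReal.summable_sigma.1 (p.changeOriginSeries_summable_aux₁ (hρ.trans_le hp.r_le))).2
    simpa only [NNReal.tsum_mul_right] using this
  have hBound : ∀ v : ℝ × ℝ, ‖v‖₊ ≤ ρ → ∀ n, ‖p.changeOrigin v n‖₊ ≤ B n := by
    intro v hv n
    refine (p.nnnorm_changeOrigin_le n ((ENNReal.coe_le_coe.2 hv).trans_lt hρp)).trans ?_
    have hs := p.changeOriginSeries_summable_aux₂ hρp n
    have hle : ∀ s : Σ l : ℕ, { s : Finset (Fin (n + l)) // s.card = l },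
        ‖p (n + s.1)‖₊ * ‖v‖₊ ^ s.1 ≤ ‖p (n + s.1)‖₊ * ρ ^ s.1 := fun s => by gcongr
    exact (NNReal.summable_of_le hle hs).tsum_le_tsum hle hs
  refine ⟨ρ, hρ0, fun a ha b hb => ?_⟩
  have hab : ∀ s ∈ uIcc a b, |s - s₀| < ρ := fun s hs => by
    have := (convex_ball s₀ (ρ : ℝ)).ordConnected.uIcc_subset ha hb hs
    rwa [Metric.mem_ball, Real.dist_eq] at this
  set A : ℕ → ℝ → ℝ := fun n s => p.changeOrigin (0, s - s₀) n fun _ => (1, 0) with hA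
  have hnorm : ∀ s, ‖((0, s - s₀) : ℝ × ℝ)‖ = |s - s₀| := fun s => by
    simp [Prod.norm_def]
  have hnn : ∀ s ∈ uIcc a b, ‖((0, s - s₀) : ℝ × ℝ)‖₊ ≤ ρ := fun s hs => by
    rw [← NNReal.coe_le_coe, coe_nnnorm, hnorm]; exact (hab s hs).le
  have hAcont : ∀ n, ContinuousOn (A n) (uIcc a b) := by
    intro n
    have h1 := (p.hasFPowerSeriesOnBall_changeOrigin n (hp.r_pos.trans_le hp.r_le)).continuousOn
    have h2 : ContinuousOn (fun s => p.changeOrigin ((0, s - s₀) : ℝ × ℝ) n) (uIcc a b) := by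
      refine h1.comp (by fun_prop) fun s hs => ?_
      rw [mem_eball_zero_iff]
      exact lt_of_le_of_lt (ENNReal.coe_le_coe.2 (hnn s hs)) hρp
    exact h2.eval_const _
  have hAbound : ∀ n, ∀ s ∈ uIcc a b, |A n s| ≤ B n := by
    intro n s hs
    have h1 : ‖A n s‖ ≤ ‖p.changeOrigin ((0, s - s₀) : ℝ × ℝ) n‖ * ∏ _i : Fin n, ‖((1, 0) : ℝ × ℝ)‖ :=
      ContinuousMultilinearMap.le_opNorm _ _
    have h2 : ‖((1, 0) : ℝ × ℝ)‖ = 1 := by simp [Prod.norm_def]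
    rw [h2, Finset.prod_const_one, mul_one] at h1
    exact h1.trans (by exact_mod_cast hBound _ (hnn s hs) n)
  have hsum : ∀ h : ℝ, |h| < ρ → ∀ s ∈ uIcc a b, HasSum (fun n => h ^ n * A n s) (F (x₀ + h, s)) := by
    intro h hh s hs
    have h1 := hp.changeOrigin ((ENNReal.coe_le_coe.2 (hnn s hs)).trans_lt hρr)
    have hmem : ((h, 0) : ℝ × ℝ) ∈ Metric.eball (0 : ℝ × ℝ) (r - ‖((0, s - s₀) : ℝ × ℝ)‖₊) := by
      rw [mem_eball_zero_iff]
      have h3 : ‖((h, 0) : ℝ × ℝ)‖₊ ≤ ρ := by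
        rw [← NNReal.coe_le_coe, coe_nnnorm]
        have : ‖((h, 0) : ℝ × ℝ)‖ = |h| := by simp [Prod.norm_def]
        rw [this]; exact hh.le
      refine lt_of_le_of_lt (ENNReal.coe_le_coe.2 h3) ?_
      rw [lt_tsub_iff_right]
      refine lt_of_le_of_lt ?_ hρ
      gcongr
      exact hnn s hs
    have h2 := h1.hasSum hmem
    have h4 : ((x₀, s₀) : ℝ × ℝ) + (0, s - s₀) + (h, 0) = (x₀ + h, s) := by ext <;> simp
    rw [h4] at h2
    have h5 : ((h, 0) : ℝ × ℝ) = h • ((1, 0) : ℝ × ℝ) := by simp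
    have h6 : (fun n => h ^ n * A n s) =
        fun n => p.changeOrigin ((0, s - s₀) : ℝ × ℝ) n fun _ => ((h, 0) : ℝ × ℝ) := by
      funext n
      rw [h5, ContinuousMultilinearMap.map_smul_univ, Finset.prod_const, Finset.card_univ,
        Fintype.card_fin, smul_eq_mul]
    rw [h6]
    exact h2
  refine ⟨FormalMultilinearSeries.ofScalars ℝ fun n => ∫ s in a..b, A n s, ?_⟩
  rw [hasFPowerSeriesAt_iff]
  filter_upwards [Metric.ball_mem_nhds (0 : ℝ) (NNReal.coe_pos.2 hρ0)] with h hh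
  rw [Metric.mem_ball, dist_zero_right, Real.norm_eq_abs] at hh
  have hsummable : Summable fun n => (B n : ℝ) * ρ ^ n := by exact_mod_cast hBsum
  have key : HasSum (fun n => ∫ s in a..b, h ^ n * A n s) (∫ s in a..b, F (x₀ + h, s)) := by
    refine intervalIntegral.hasSum_integral_of_dominated_convergence (fun n _ => B n * ρ ^ n)
      (fun n => ?_) (fun n => ?_) ?_ ?_ ?_
    · exact ((continuousOn_const.mul (hAcont n)).mono uIoc_subset_uIcc).aestronglyMeasurable
        measurableSet_uIoc
    · refine MeasureTheory.ae_of_all _ fun s hs => ?_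
      rw [Real.norm_eq_abs, abs_mul, abs_pow, mul_comm]
      have := hAbound n s (uIoc_subset_uIcc hs)
      gcongr
    · exact MeasureTheory.ae_of_all _ fun s _ => hsummable
    · exact intervalIntegrable_const
    · exact MeasureTheory.ae_of_all _ fun s hs => hsum h hh s (uIoc_subset_uIcc hs)
  have hcoeff : (fun n => h ^ n •
      (FormalMultilinearSeries.ofScalars ℝ fun n => ∫ s in a..b, A n s).coeff n) =
      fun n => ∫ s in a..b, h ^ n * A n s := by
    funext n
    rw [FormalMultilinearSeries.coeff_ofScalars, smul_eq_mul, intervalIntegral.integral_const_mul]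
  rw [hcoeff]
  exact key

/-- A subdivision of the compact interval reduces to finitely many short pieces; for `x` near `x₀`
the integrand is continuous in `s`, so the pieces add up to the whole integral. -/
theorem analyticAt_integral {F : ℝ × ℝ → ℝ} {x₀ a b : ℝ} (hab : a ≤ b)
    (hF : ∀ s ∈ Icc a b, AnalyticAt ℝ F (x₀, s)) :
    AnalyticAt ℝ (fun x => ∫ s in a..b, F (x, s)) x₀ := by
  have hloc : ∀ s : Icc a b, ∃ δ > 0, ∀ a ∈ Metric.ball (s : ℝ) δ, ∀ b ∈ Metric.ball (s : ℝ) δ,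
      AnalyticAt ℝ (fun x => ∫ s in a..b, F (x, s)) x₀ := fun s =>
    exists_analyticAt_integral (hF s s.2)
  choose δ hδ hδ' using hloc
  obtain ⟨t, ht0, hmono, ⟨m, hm⟩, ht⟩ := exists_monotone_Icc_subset_open_cover_Icc hab
    (c := fun s : Icc a b => Subtype.val ⁻¹' Metric.ball (s : ℝ) (δ s))
    (fun s => Metric.isOpen_ball.preimage continuous_subtype_val)
    (fun s _ => mem_iUnion.2 ⟨s, Metric.mem_ball_self (hδ s)⟩)
  have hpiece : ∀ n, AnalyticAt ℝ (fun x => ∫ s in (t n : ℝ)..(t (n + 1) : ℝ), F (x, s)) x₀ := by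
    intro n
    obtain ⟨s, hs⟩ := ht n
    exact hδ' s _ (hs ⟨le_rfl, hmono n.le_succ⟩) _ (hs ⟨hmono n.le_succ, le_rfl⟩)
  have hsum : AnalyticAt ℝ (fun x => ∑ n ∈ Finset.range m,
      ∫ s in (t n : ℝ)..(t (n + 1) : ℝ), F (x, s)) x₀ :=
    Finset.analyticAt_fun_sum _ fun n _ => hpiece n
  refine hsum.congr ?_
  have hev : ∀ᶠ x in 𝓝 x₀, ∀ s ∈ Icc a b, AnalyticAt ℝ F (x, s) :=
    isCompact_Icc.eventually_forall_of_forall_eventually fun s hs => (hF s hs).eventually_analyticAt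
  filter_upwards [hev] with x hx
  rw [intervalIntegral.sum_integral_adjacent_intervals, ht0, hm m le_rfl]
  intro n _
  have hc : ContinuousOn (fun s => F (x, s)) (Icc a b) := fun s hs =>
    ((hx s hs).continuousAt.comp (by fun_prop : Continuous fun s : ℝ => (x, s)).continuousAt).continuousWithinAt
  refine (hc.mono ?_).intervalIntegrable
  exact ordConnected_Icc.uIcc_subset (t n).2 (t (n + 1)).2

/-! ### Displacement as an analytic function of the amplitude -/

section Drift

variable {σ : ℝ → ℝ} {N : Set ℝ}

theorem analyticAt_invFunOn (hN : IsOpen N) (hσ : AnalyticOnNhd ℝ σ N)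
    (hσ' : ∀ y ∈ N, deriv σ y ≠ 0) (hinj : InjOn σ N) {y : ℝ} (hy : y ∈ N) :
    AnalyticAt ℝ (Function.invFunOn σ N) (σ y) := by
  refine (analyticAt_comp_iff_of_deriv_ne_zero (hσ y hy) (hσ' y hy)).1 (analyticAt_id.congr ?_)
  filter_upwards [hN.mem_nhds hy] with z hz
  exact (hinj.leftInvOn_invFunOn hz).symm

/-- The displacement during half an oscillation, as an integral over the phase of the
oscillation. -/
theorem displacement_eq_integral (hσ : AnalyticOnNhd ℝ σ N) (hinj : InjOn σ N) {q r x y : ℝ → ℝ} {ε t₁ t₂ s : ℝ} (hε : 0 < ε)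
    (h12 : t₁ < t₂) (hs : s = 1 ∨ s = -1) (hxc : Continuous x) (hyc : Continuous y)
    (hyN : ∀ t ∈ Icc t₁ t₂, y t ∈ N) (hlt : ∀ t ∈ Ioo t₁ t₂, |σ (y t)| < ε)
    (hy : ∀ t ∈ Ioo t₁ t₂, HasDerivAt y (s * √(ε ^ 2 - σ (y t) ^ 2) * r (y t)) t)
    (hx : ∀ t ∈ Ioo t₁ t₂, HasDerivAt x (q (y t) * deriv σ (y t) * r (y t)) t)
    (hq : ∀ v, |v| ≤ ε → ContinuousAt (fun v => q (Function.invFunOn σ N v)) v)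
    (h1 : σ (y t₁) = -(s * ε)) (h2 : σ (y t₂) = s * ε) :
    x t₂ - x t₁ = ∫ ψ in (0 : ℝ)..π, q (Function.invFunOn σ N (-(ε * cos ψ))) := by
  set φ : ℝ → ℝ := fun ψ => q (Function.invFunOn σ N (-(ε * cos ψ))) with hφ
  have hφc : Continuous φ := continuous_iff_continuousAt.2 fun ψ => by
    refine ContinuousAt.comp (f := fun ψ => -(ε * cos ψ)) (hq _ ?_) (by fun_prop)
    rw [abs_neg, abs_mul, abs_of_pos hε]
    exact mul_le_of_le_one_right hε.le (abs_cos_le_one ψ)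
  set H : ℝ → ℝ := fun ψ => ∫ ψ' in (0 : ℝ)..ψ, φ ψ' with hH
  have hHd : ∀ ψ, HasDerivAt H (φ ψ) ψ := fun ψ =>
    intervalIntegral.integral_hasDerivAt_right (hφc.intervalIntegrable _ _)
      (hφc.stronglyMeasurableAtFilter _ _) hφc.continuousAt
  have hHc : Continuous H := continuous_iff_continuousAt.2 fun ψ => (hHd ψ).continuousAt
  -- `P` is the phase `ψ` with `σ y = -ε cos ψ`. Along the motion `s dx = q dψ`, so `s x - H (P)` is
  -- constant; for `s = -1` the phase runs from `π` to `0`.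
  set P : ℝ → ℝ := fun t => arccos (-(σ (y t) / ε)) with hP
  have hPc : ContinuousOn P (Icc t₁ t₂) := by
    have h3 : ContinuousOn (fun t => σ (y t)) (Icc t₁ t₂) :=
      hσ.continuousOn.comp hyc.continuousOn hyN
    exact continuous_arccos.comp_continuousOn (h3.div_const ε).neg
  have hd : ∀ t ∈ Ioo t₁ t₂, HasDerivAt (fun t => s * x t - H (P t)) 0 t := by
    intro t ht
    have hyt := hyN t (Ioo_subset_Icc_self ht)
    have hσt : HasDerivAt (fun t => σ (y t)) (deriv σ (y t) * (s * √(ε ^ 2 - σ (y t) ^ 2) * r (y t))) t :=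
      (hσ _ hyt).differentiableAt.hasDerivAt.comp t (hy t ht)
    have hb := abs_lt.1 (hlt t ht)
    have hz1 : -(σ (y t) / ε) ≠ -1 := by
      intro h; rw [neg_inj, div_eq_one_iff_eq hε.ne'] at h; linarith
    have hz2 : -(σ (y t) / ε) ≠ 1 := by
      intro h; rw [neg_eq_iff_eq_neg, div_eq_iff hε.ne'] at h; linarith
    have hrad : 0 < ε ^ 2 - σ (y t) ^ 2 := by nlinarith
    have hsqrt : √(1 - (-(σ (y t) / ε)) ^ 2) = √(ε ^ 2 - σ (y t) ^ 2) / ε := by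
      rw [show 1 - (-(σ (y t) / ε)) ^ 2 = (ε ^ 2 - σ (y t) ^ 2) / ε ^ 2 by field_simp,
        sqrt_div hrad.le, sqrt_sq hε.le]
    have hPd : HasDerivAt P (s * deriv σ (y t) * r (y t)) t := by
      refine ((hasDerivAt_arccos hz1 hz2).comp t (hσt.div_const ε).neg).congr_deriv ?_
      rw [hsqrt]
      have := (sqrt_pos.2 hrad).ne'
      field_simp
    have hφP : φ (P t) = q (y t) := by
      simp only [hφ, hP]
      rw [cos_arccos, mul_neg, neg_neg, mul_div_cancel₀ _ hε.ne', hinj.leftInvOn_invFunOn hyt]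
      · have : σ (y t) / ε ≤ 1 := by rw [div_le_one hε]; linarith
        linarith
      · have : -1 ≤ σ (y t) / ε := by rw [le_div_iff₀ hε]; linarith
        linarith
    refine (((hx t ht).const_mul s).sub ((hHd _).comp t hPd)).congr_deriv ?_
    rw [hφP]; ring
  obtain ⟨c, -, hc⟩ := exists_hasDerivAt_eq_slope (fun t => s * x t - H (P t)) (fun _ => 0) h12
    ((continuous_const.mul hxc).continuousOn.sub (hHc.comp_continuousOn hPc)) hd
  rw [eq_comm, div_eq_zero_iff, or_iff_left (by linarith)] at hc
  have hH0 : H 0 = 0 := by simp [hH]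
  have e1 : P t₁ = arccos s := by simp only [hP]; rw [h1]; congr 1; field_simp
  have e2 : P t₂ = arccos (-s) := by simp only [hP]; rw [h2]; congr 1; field_simp
  rw [e1, e2] at hc
  change x t₂ - x t₁ = H π
  rcases hs with rfl | rfl
  · rw [arccos_one, arccos_neg_one, hH0] at hc; linarith
  · rw [neg_neg, arccos_one, arccos_neg_one, hH0] at hc; linarith

/-- The amplitudes with a given drift form a countable set. -/
theorem countable_setOf_drift_eq (hN : IsOpen N) (hσ : AnalyticOnNhd ℝ σ N)
    (hσ' : ∀ y ∈ N, deriv σ y ≠ 0) (hinj : InjOn σ N) {q : ℝ × ℝ → ℝ} {U : Set (ℝ × ℝ)}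
    (hq : AnalyticOnNhd ℝ q U) (hU : ∀ ε ε' y, (ε, y) ∈ U → |ε'| ≤ |ε| → (ε', y) ∈ U) {y₀ : ℝ}
    (hy₀ : y₀ ∈ N) (hσ₀ : σ y₀ = 0) (h0 : (0, y₀) ∈ U) (hne : q (0, y₀) ≠ 0) (c : ℝ) :
    {ε : ℝ | (∀ v, |v| ≤ |ε| → v ∈ σ '' N ∧ (ε, Function.invFunOn σ N v) ∈ U) ∧
      ε ^ 2 * ∫ ψ in (0 : ℝ)..π, q (ε, Function.invFunOn σ N (-(ε * cos ψ))) = c}.Countable := by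
  set Y := Function.invFunOn σ N with hY
  set S : Set ℝ := {ε | ∀ v, |v| ≤ |ε| → v ∈ σ '' N ∧ (ε, Y v) ∈ U} with hS
  set D : ℝ → ℝ := fun ε => ∫ ψ in (0 : ℝ)..π, q (ε, Y (-(ε * cos ψ))) with hD
  have hDan : AnalyticOnNhd ℝ D S := by
    intro ε hε
    refine analyticAt_integral (F := fun z : ℝ × ℝ => q (z.1, Y (-(z.1 * cos z.2)))) pi_pos.le
      fun ψ _ => ?_
    have hv : |-(ε * cos ψ)| ≤ |ε| := by
      rw [abs_neg, abs_mul]; exact mul_le_of_le_one_right (abs_nonneg _) (abs_cos_le_one ψ)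
    obtain ⟨⟨y, hy, hyv⟩, hmem⟩ := hε _ hv
    have hYan : AnalyticAt ℝ Y (-(ε * cos ψ)) := hyv ▸ analyticAt_invFunOn hN hσ hσ' hinj hy
    have hin : AnalyticAt ℝ (fun z : ℝ × ℝ => -(z.1 * cos z.2)) (ε, ψ) :=
      (analyticAt_fst.mul (analyticAt_cos.comp analyticAt_snd)).neg
    exact AnalyticAt.comp (f := fun z : ℝ × ℝ => (z.1, Y (-(z.1 * cos z.2)))) (hq _ hmem)
      (analyticAt_fst.prod (AnalyticAt.comp (g := Y) (f := fun z : ℝ × ℝ => -(z.1 * cos z.2)) hYan hin))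
  have hstar : ∀ ε ∈ S, ∀ ε', |ε'| ≤ |ε| → ε' ∈ S := fun ε hε ε' h v hv =>
    ⟨(hε v (hv.trans h)).1, hU _ _ _ (hε v (hv.trans h)).2 h⟩
  -- With an amplitude `S` contains all smaller ones, so it is an interval about `0`, and the
  -- identity theorem applies.
  have hconn : IsPreconnected S := by
    refine OrdConnected.isPreconnected ⟨fun a ha b hb z hz => ?_⟩
    rcases le_max_iff.1 (abs_le_max_abs_abs hz.1 hz.2) with h | h
    exacts [hstar a ha z h, hstar b hb z h]
  have hY0 : Y 0 = y₀ := by rw [← hσ₀]; exact hinj.leftInvOn_invFunOn hy₀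
  have hS0 : (0 : ℝ) ∈ S := fun v hv => by
    rw [abs_zero, abs_nonpos_iff] at hv
    rw [hv, hY0]; exact ⟨⟨y₀, hy₀, hσ₀⟩, h0⟩
  have hD0 : D 0 ≠ 0 := by
    simp only [hD, zero_mul, neg_zero, hY0, intervalIntegral.integral_const, smul_eq_mul, sub_zero]
    exact mul_ne_zero pi_ne_zero hne
  have hnear : ∀ᶠ ε in 𝓝[≠] (0 : ℝ), ε ^ 2 * D ε ≠ 0 := by
    filter_upwards [self_mem_nhdsWithin, mem_nhdsWithin_of_mem_nhds
      ((hDan 0 hS0).continuousAt.eventually_ne hD0)] with ε h1 h2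
    exact mul_ne_zero (pow_ne_zero _ h1) h2
  -- If solutions accumulated, `ε² D(ε) = c` would hold on all of `S`. At `ε = 0` this gives `c =
  -- 0`, which contradicts `D(0) ≠ 0`, except for `S = {0}`, where `hnear` itself forbids
  -- accumulation at `0`.
  have hiso : ∀ z ∈ S, ∀ᶠ ε in 𝓝[≠] z, ε ^ 2 * D ε ≠ c := by
    intro z hz
    by_contra hcon
    have hf : AnalyticOnNhd ℝ (fun ε => ε ^ 2 * D ε - c) S := fun ε hε =>
      ((analyticAt_id.pow 2).mul (hDan ε hε)).sub analyticAt_const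
    have hfreq : ∃ᶠ ε in 𝓝[≠] z, ε ^ 2 * D ε - c = 0 := by
      rw [not_eventually] at hcon
      exact hcon.mono fun ε h => sub_eq_zero.2 (not_not.1 h)
    have heq := hf.eqOn_zero_of_preconnected_of_frequently_eq_zero hconn hz hfreq
    have hc : c = 0 := by
      have := heq hS0
      simpa using this
    subst hc
    rcases eq_or_ne z 0 with rfl | hz0
    · exact hfreq (by simpa using hnear)
    · have h1 : ∀ᶠ ε in 𝓝[≠] (0 : ℝ), ε ∈ S := by
        filter_upwards [mem_nhdsWithin_of_mem_nhds
          (Metric.ball_mem_nhds (0 : ℝ) (abs_pos.2 hz0))] with ε h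
        rw [Metric.mem_ball, dist_zero_right, Real.norm_eq_abs] at h
        exact hstar z hz ε h.le
      obtain ⟨ε, h2, h3⟩ := (h1.and hnear).exists
      have := heq h2
      simp only [sub_zero, Pi.zero_apply] at this
      exact h3 this
  set Z : Set ℝ := {ε | ε ∈ S ∧ ε ^ 2 * D ε = c} with hZ
  -- A discrete subset of the line is countable.
  obtain ⟨t, -, ht, hcov⟩ := TopologicalSpace.countable_cover_nhdsWithin (s := Z)
    (f := fun x => ({x} : Set ℝ)) (fun z hz => by
      have h1 := hiso z hz.1
      rw [eventually_nhdsWithin_iff] at h1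
      rw [mem_nhdsWithin_iff_eventually]
      filter_upwards [h1] with ε h2 h3
      by_contra h4
      exact h2 h4 h3.2)
  exact (ht.mono fun x hx => by
    obtain ⟨i, hi, hxi⟩ := mem_iUnion₂.1 (hcov hx)
    rwa [mem_singleton_iff.1 hxi])

end Drift

/-! ### Periodic or driftless motions have rational displacement -/

section Rational

/-- In one period `y` takes its value at `t₁` only once: it is strictly monotone on the first half,
and the second half is its mirror image. -/
theorem IsFlow.eq_add_of_snd_eq {W G u y : ℝ → ℝ} {α β : ℝ} (hW : ContDiff ℝ 2 W) (hG : ContDiff ℝ 1 G)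
    (h : IsFlow W G u y) {k : ℤ} {t₁ t₂ : ℝ} (hp : IsHalfPeriod u y α β k t₁ t₂) {t : ℝ}
    (ht : y t = y t₁) : ∃ m : ℤ, t = t₁ + m * (2 * (t₂ - t₁)) := by
  have hT : 0 < 2 * (t₂ - t₁) := by linarith [hp.lt]
  have hper : Function.Periodic y (2 * (t₂ - t₁)) := fun t => (h.period hW hG hp t).2
  have hinj : ∀ r ∈ Icc t₁ t₂, y r = y t₁ → r = t₁ := fun r hr hy =>
    hp.strictMonoOn.injOn hr (left_mem_Icc.2 hp.lt.le) (by simp only [hy])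
  refine ⟨toIcoDiv hT t₁ t, ?_⟩
  have hmem := toIcoMod_mem_Ico hT t₁ t
  have hmod := self_sub_toIcoDiv_zsmul hT t₁ t
  have hy' : y (toIcoMod hT t₁ t) = y t₁ := by rw [← hmod, hper.sub_zsmul_eq, ht]
  have : toIcoMod hT t₁ t = t₁ := by
    rcases le_or_gt (toIcoMod hT t₁ t) t₂ with h1 | h1
    · exact hinj _ ⟨hmem.1, h1⟩ hy'
    · obtain ⟨m, hm⟩ : ∃ m : ℤ, u t₂ = m * π :=
        hp.right.elim (fun h => ⟨k, h⟩) fun h => ⟨k + 1, by push_cast; exact h⟩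
      have h2 := (h.reflect hW hG hm (toIcoMod hT t₁ t)).2
      have h3 := hinj _ ⟨by linarith [hmem.2], by linarith⟩ (h2.trans hy')
      linarith [hmem.2]
  rw [this, zsmul_eq_mul] at hmod
  linarith

theorem add_nat_mul_of_add {x : ℝ → ℝ} {T d : ℝ} (h : ∀ t, x (t + T) = x t + d) (t : ℝ) (n : ℕ) :
    x (t + n * T) = x t + n * d := by
  induction n with
  | zero => simp
  | succ n ih =>
    rw [show t + ((n + 1 : ℕ) : ℝ) * T = t + n * T + T by push_cast; ring, h, ih]
    push_cast; ring

variable {Γ₁ Γ₂ C e α β t₁ t₂ : ℝ} {s : ℝ → ℂ × ℂ} {k : ℤ}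

/-- The recurrence time `P` is a positive multiple `m` of the period, so `2m` times the half-period
displacement is `nπ`. -/
theorem IsLevelMotion.exists_rat_of_recurs (hm : IsLevelMotion Γ₁ Γ₂ C e s)
    (hp : IsFlow.IsHalfPeriod (fun t => (s t).1.re - (s t).2.re) (fun t => (s t).1.im) α β k t₁ t₂)
    {P : ℝ} (hP : 0 < P) {n : ℤ} (hx : (s (t₁ + P)).1.re = (s t₁).1.re + n * π)
    (hy : (s (t₁ + P)).1.im = (s t₁).1.im) : ∃ r : ℚ, (s t₂).1.re - (s t₁).1.re = r * π := by
  have hT : 0 < 2 * (t₂ - t₁) := by linarith [hp.lt]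
  obtain ⟨m, hmP⟩ := hm.flow.eq_add_of_snd_eq (contDiff_levelCos hm.pos) (contDiff_levelSpeed hm.pos)
    hp hy
  have hmP' : P = m * (2 * (t₂ - t₁)) := by linarith
  have hm0 : (0 : ℝ) < m := pos_of_mul_pos_left (hmP' ▸ hP) hT.le
  lift m to ℕ using by exact_mod_cast hm0.le
  have h1 := add_nat_mul_of_add (x := fun t => (s t).1.re) (fun t => (hm.period hp t).1) t₁ m
  rw [Int.cast_natCast] at hmP' hm0
  simp only [← hmP', hx] at h1
  refine ⟨n / (2 * m), ?_⟩
  push_cast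
  field_simp
  linarith

theorem toBand_eq_iff {z w : ℂ} : toBand z = toBand w ↔ ∃ n : ℤ, w = mobiusFlip n z :=
  ⟨fun h => Quotient.exact h, fun h => Quotient.sound h⟩

/-- For a periodic motion on the band, and for a rotating pair without drift, the displacement
during a half period is a rational multiple of `π`. -/
theorem IsLevelMotion.exists_rat (hm : IsLevelMotion Γ₁ Γ₂ C e s)
    (hp : IsFlow.IsHalfPeriod (fun t => (s t).1.re - (s t).2.re) (fun t => (s t).1.im) α β k t₁ t₂)
    (hs : IsPeriodicOnBand s ∨ ∃ (n : ℤ) (T : ℝ), TurnsAsPair s n T 0) :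
    ∃ r : ℚ, (s t₂).1.re - (s t₁).1.re = r * π := by
  rcases hs with ⟨P, hP, h⟩ | ⟨n, T, hT, h, -⟩
  · choose n hn using fun t => toBand_eq_iff.1 (h t).1
    have hre : ∀ t, (s t).1.re = (s (t + P)).1.re + n t * π := fun t => congrArg Complex.re (hn t)
    have him : ∀ t, (s t).1.im = (-1) ^ n t * (s (t + P)).1.im := fun t => congrArg Complex.im (hn t)
    have hxc : Continuous fun t => (s t).1.re :=
      continuous_iff_continuousAt.2 fun t => (hm.drift₁ t).continuousAt
    -- Twice the displacement is continuous with values in `2πℤ`, so the deck transformation does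
    -- not depend on the time.
    have hconst : ∀ t, n t = n t₁ := fun t => by
      have hf : Continuous fun t => 2 * ((s t).1.re - (s (t + P)).1.re) :=
        continuous_const.mul (hxc.sub (hxc.comp (continuous_add_const P)))
      have := eq_of_cos_sub_eq_one (t₀ := t₁) hf (fun t => by
        rw [hre t, hre t₁, show 2 * ((s (t + P)).1.re + n t * π - (s (t + P)).1.re) -
          2 * ((s (t₁ + P)).1.re + n t₁ * π - (s (t₁ + P)).1.re) = ((n t - n t₁ : ℤ) : ℝ) * (2 * π) by
            push_cast; ring]
        exact cos_int_mul_two_pi _) t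
      have h2 : (n t : ℝ) * π = n t₁ * π := by linarith [hre t, hre t₁]
      exact_mod_cast mul_right_cancel₀ pi_ne_zero h2
    -- Over two periods the sign flip of `y₁` cancels.
    refine hm.exists_rat_of_recurs hp (P := P + P) (n := -(2 * n t₁)) (by linarith) ?_ ?_
    · have h1 := hre t₁
      have h2 := hre (t₁ + P)
      rw [hconst, add_assoc] at h2
      push_cast; linarith
    · have h1 := him t₁
      have h2 := him (t₁ + P)
      rw [hconst, add_assoc] at h2
      rw [h1, h2, ← mul_assoc, neg_one_zpow_mul_self, one_mul]
  · refine hm.exists_rat_of_recurs hp hT (n := 0) ?_ ?_ <;> simp [(h t₁).1]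

/-- Every horizontal slice is a countable set `cos u = const`, so Tonelli's theorem gives measure
zero. -/
theorem volume_cosCurve {W : ℝ → ℝ} (hW : Continuous W) : MeasureTheory.volume (cosCurve W) = 0 := by
  rw [MeasureTheory.Measure.volume_eq_prod,
    MeasureTheory.Measure.prod_apply_symm (isClosed_cosCurve hW).measurableSet,
    MeasureTheory.lintegral_eq_zero_of_ae_eq_zero]
  refine Eventually.of_forall fun y => Countable.measure_zero ?_ _
  show {u : ℝ | cos u = W y}.Countable
  rcases eq_empty_or_nonempty {u : ℝ | cos u = W y} with h | ⟨v, hv⟩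
  · rw [h]; exact countable_empty
  · refine ((countable_range fun k : ℤ => 2 * k * π + v).union
      (countable_range fun k : ℤ => 2 * k * π - v)).mono fun u hu => ?_
    have hu' : cos v = cos u := Eq.trans hv (Eq.symm hu)
    obtain ⟨k, h | h⟩ := cos_eq_cos_iff.1 hu'
    exacts [Or.inl ⟨k, h.symm⟩, Or.inr ⟨k, h.symm⟩]

end Rational

/-! ### Oscillations about a collision point, for both types at once -/

section Oscillation

/-- On the level set with amplitude `ε` the horizontal separation of two rotating vortices satisfies
`cos u = pairCos A B g ε y` up to sign. -/
def pairCos (A B g : ℝ → ℝ) (ε y : ℝ) : ℝ := (A y - ε ^ 2 * g y * B y) / (1 + ε ^ 2 * g y)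

/-- The vertical speed of the first vortex is `|sin u| * pairSpeed γ A B g ε y`. -/
def pairSpeed (γ : ℝ) (A B g : ℝ → ℝ) (ε y : ℝ) : ℝ :=
  γ * (1 + ε ^ 2 * g y) ^ 2 / (ε ^ 2 * g y * (A y + B y))

/-- The data of a family of oscillations about `y₀`: `σ` is a coordinate near `y₀` in which the
oscillation of amplitude `ε` runs from `-ε` to `ε`, and `X (ε, y)` is a horizontal velocity. -/
structure IsOscillationFamily (A B g σ : ℝ → ℝ) (X : ℝ × ℝ → ℝ) (N : Set ℝ) (y₀ : ℝ) : Prop where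
  isOpen : IsOpen N
  analyticAt_A : ∀ y, AnalyticAt ℝ A y
  analyticAt_B : ∀ y, AnalyticAt ℝ B y
  analyticAt_g : ∀ y, AnalyticAt ℝ g y
  analyticAt_σ : ∀ y, AnalyticAt ℝ σ y
  analyticAt_X : ∀ z, AnalyticAt ℝ X z
  one_le_A : ∀ y, 1 ≤ A y
  one_le_B : ∀ y, 1 ≤ B y
  g_pos : ∀ y, 0 < g y
  A_sub_one : ∀ y, A y - 1 = g y * (1 + B y) * σ y ^ 2
  deriv_ne : ∀ y ∈ N, deriv σ y ≠ 0
  injOn : InjOn σ N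
  mem : y₀ ∈ N
  zero : σ y₀ = 0
  ne : X (0, y₀) ≠ 0

/-- Half an oscillation of amplitude `ε`, during which `x` moves with velocity `X (ε, y)`. -/
structure IsHalfOscillation (γ : ℝ) (A B g σ : ℝ → ℝ) (X : ℝ × ℝ → ℝ) (N : Set ℝ) (ε t₁ t₂ : ℝ)
    (x y : ℝ → ℝ) : Prop where
  pos : 0 < ε
  lt : t₁ < t₂
  continuous_x : Continuous x
  continuous_y : Continuous y
  mem : ∀ t ∈ Icc t₁ t₂, y t ∈ N
  neg_one_lt : ∀ t ∈ Icc t₁ t₂, -1 < pairCos A B g ε (y t)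
  lt_one : ∀ t ∈ Ioo t₁ t₂, pairCos A B g ε (y t) < 1
  left : pairCos A B g ε (y t₁) = 1
  right : pairCos A B g ε (y t₂) = 1
  hasDerivAt_x : ∀ t, HasDerivAt x (X (ε, y t)) t
  sign : ∃ s : ℝ, (s = 1 ∨ s = -1) ∧ s * σ (y t₁) < 0 ∧ 0 < s * σ (y t₂) ∧ ∀ t ∈ Ioo t₁ t₂,
    HasDerivAt y (s * √(1 - pairCos A B g ε (y t) ^ 2) * pairSpeed γ A B g ε (y t)) t

variable {γ : ℝ} {A B g σ : ℝ → ℝ} {X : ℝ × ℝ → ℝ} {N : Set ℝ} {y₀ : ℝ}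

namespace IsOscillationFamily

/-- By the relation `A_sub_one` the turning points of amplitude `ε` are exactly `σ = ±ε`. -/
theorem one_sub_pairCos (h : IsOscillationFamily A B g σ X N y₀) (ε y : ℝ) :
    1 - pairCos A B g ε y = g y * (1 + B y) * (ε ^ 2 - σ y ^ 2) / (1 + ε ^ 2 * g y) := by
  have hg := h.g_pos y
  have h1 : 0 < 1 + ε ^ 2 * g y := by positivity
  rw [pairCos, one_sub_div h1.ne']
  congr 1
  linarith [h.A_sub_one y]

theorem one_add_pairCos (h : IsOscillationFamily A B g σ X N y₀) (ε y : ℝ) :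
    1 + pairCos A B g ε y = (1 + A y - ε ^ 2 * g y * (B y - 1)) / (1 + ε ^ 2 * g y) := by
  have hg := h.g_pos y
  have h1 : 0 < 1 + ε ^ 2 * g y := by positivity
  have h2 := h1.ne'
  rw [pairCos]
  field_simp
  ring

/-- The displacements of a given size occur for countably many amplitudes only. -/
theorem countable_setOf_displacement_eq (h : IsOscillationFamily A B g σ X N y₀) (hγ : 0 < γ) (c : ℝ) :
    {ε : ℝ | ∃ t₁ t₂ x y, IsHalfOscillation γ A B g σ X N ε t₁ t₂ x y ∧ x t₂ - x t₁ = c}.Countable := by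
  -- Up to the square of a positive denominator, `1 - pairCos²` is `m (ε² - σ²)`. On `U` the factor
  -- `m` is positive, so its square root is analytic, and `q` is the horizontal velocity divided by
  -- the phase speed, with the factor `ε²` of the result taken out.
  set U : Set (ℝ × ℝ) := {z | z.2 ∈ N ∧ 0 < 1 + A z.2 - z.1 ^ 2 * g z.2 * (B z.2 - 1)} with hU
  set m : ℝ × ℝ → ℝ := fun z =>
    g z.2 * (1 + B z.2) * (1 + A z.2 - z.1 ^ 2 * g z.2 * (B z.2 - 1)) with hm
  set q : ℝ × ℝ → ℝ := fun z => X z * (g z.2 * (A z.2 + B z.2)) /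
    (γ * (1 + z.1 ^ 2 * g z.2) * deriv σ z.2 * √(m z)) with hq
  have hmpos : ∀ z ∈ U, 0 < m z := fun z hz =>
    mul_pos (mul_pos (h.g_pos _) (by linarith [h.one_le_B z.2])) hz.2
  have hden : ∀ z ∈ U, γ * (1 + z.1 ^ 2 * g z.2) * deriv σ z.2 * √(m z) ≠ 0 := fun z hz => by
    have h1 := h.g_pos z.2
    have h2 := h.deriv_ne _ hz.1
    have h3 := (sqrt_pos.2 (hmpos z hz)).ne'
    have h4 : 1 + z.1 ^ 2 * g z.2 ≠ 0 := by positivity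
    have h5 := hγ.ne'
    positivity
  have hσ : AnalyticOnNhd ℝ σ N := fun y _ => h.analyticAt_σ y
  have hqan : AnalyticOnNhd ℝ q U := fun z hz => by
    have hA : AnalyticAt ℝ (fun z : ℝ × ℝ => A z.2) z :=
      AnalyticAt.comp (g := A) (f := Prod.snd) (h.analyticAt_A _) analyticAt_snd
    have hB : AnalyticAt ℝ (fun z : ℝ × ℝ => B z.2) z :=
      AnalyticAt.comp (g := B) (f := Prod.snd) (h.analyticAt_B _) analyticAt_snd
    have hg : AnalyticAt ℝ (fun z : ℝ × ℝ => g z.2) z :=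
      AnalyticAt.comp (g := g) (f := Prod.snd) (h.analyticAt_g _) analyticAt_snd
    have hσ' : AnalyticAt ℝ (fun z : ℝ × ℝ => deriv σ z.2) z :=
      AnalyticAt.comp (g := deriv σ) (f := Prod.snd) (h.analyticAt_σ _).deriv analyticAt_snd
    have hf : AnalyticAt ℝ (fun z : ℝ × ℝ => z.1) z := analyticAt_fst
    have hc : ∀ c : ℝ, AnalyticAt ℝ (fun _ : ℝ × ℝ => c) z := fun c => analyticAt_const
    have hman : AnalyticAt ℝ m z := (hg.mul ((hc 1).add hB)).mul
      (((hc 1).add hA).sub (((hf.pow 2).mul hg).mul (hB.sub (hc 1))))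
    have hsq : AnalyticAt ℝ (fun z => √(m z)) z :=
      AnalyticAt.comp (g := fun x => √x) (f := m) (contDiffAt_sqrt (hmpos z hz).ne').analyticAt hman
    exact ((h.analyticAt_X z).mul (hg.mul (hA.add hB))).div
      ((((hc γ).mul ((hc 1).add ((hf.pow 2).mul hg))).mul hσ').mul hsq) (hden z hz)
  have hUstar : ∀ ε ε' y, (ε, y) ∈ U → |ε'| ≤ |ε| → (ε', y) ∈ U := fun ε ε' y hy hle => by
    refine ⟨hy.1, hy.2.trans_le ?_⟩
    have h1 := mul_le_mul_of_nonneg_right (mul_le_mul_of_nonneg_right (sq_le_sq.2 hle)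
      (h.g_pos y).le) (sub_nonneg.2 (h.one_le_B y))
    simp only
    linarith
  have hA0 := h.one_le_A y₀
  have hB0 := h.one_le_B y₀
  have h0 : ((0 : ℝ), y₀) ∈ U := ⟨h.mem, by simp only; linarith⟩
  have hne : q (0, y₀) ≠ 0 := by
    refine div_ne_zero (mul_ne_zero h.ne (mul_ne_zero (h.g_pos _).ne' ?_)) (hden _ h0)
    simp only; linarith
  refine (countable_setOf_drift_eq h.isOpen hσ h.deriv_ne h.injOn hqan hUstar h.mem h.zero h0 hne
    c).mono ?_
  rintro ε ⟨t₁, t₂, x, y, ho, hxc⟩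
  obtain ⟨s, hs, hs1, hs2, hy⟩ := ho.sign
  have hε := ho.pos
  have hk : ∀ y, 0 < 1 + ε ^ 2 * g y := fun y => by have := h.g_pos y; positivity
  have hgB : ∀ y, 0 < g y * (1 + B y) := fun y => mul_pos (h.g_pos y) (by linarith [h.one_le_B y])
  have hss : s ^ 2 = 1 := by rcases hs with rfl | rfl <;> norm_num
  have hyU : ∀ t ∈ Icc t₁ t₂, (ε, y t) ∈ U := fun t ht => by
    have h1 := ho.neg_one_lt t ht
    have h2 := h.one_add_pairCos ε (y t)
    refine ⟨ho.mem t ht, ?_⟩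
    have h3 : 0 < (1 + A (y t) - ε ^ 2 * g (y t) * (B (y t) - 1)) / (1 + ε ^ 2 * g (y t)) := by
      linarith
    exact (div_pos_iff_of_pos_right (hk _)).1 h3
  have hend : ∀ t, pairCos A B g ε (y t) = 1 → σ (y t) = s * ε ∨ σ (y t) = -(s * ε) := fun t ht => by
    have h1 := h.one_sub_pairCos ε (y t)
    rw [ht, sub_self, eq_comm, div_eq_zero_iff, or_iff_left (hk _).ne', mul_eq_zero,
      or_iff_right (hgB _).ne'] at h1
    refine sq_eq_sq_iff_eq_or_eq_neg.1 ?_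
    rw [mul_pow, hss]; linarith
  have h1 : σ (y t₁) = -(s * ε) := (hend t₁ ho.left).resolve_left fun h1 => by
    rw [h1, ← mul_assoc, ← sq, hss] at hs1; linarith
  have h2 : σ (y t₂) = s * ε := (hend t₂ ho.right).resolve_right fun h1 => by
    rw [h1, mul_neg, ← mul_assoc, ← sq, hss] at hs2; linarith
  -- During the half oscillation `σ (y t)` sweeps `[-ε, ε]`, so the conditions hold at all these
  -- values.
  have hS : ∀ v, |v| ≤ |ε| → v ∈ σ '' N ∧ (ε, Function.invFunOn σ N v) ∈ U := fun v hv => by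
    have hc : ContinuousOn (fun t => σ (y t)) (uIcc t₁ t₂) := by
      rw [uIcc_of_le ho.lt.le]
      exact hσ.continuousOn.comp ho.continuous_y.continuousOn ho.mem
    obtain ⟨t, ht, rfl⟩ : v ∈ (fun t => σ (y t)) '' uIcc t₁ t₂ := by
      refine intermediate_value_uIcc hc ?_
      rw [abs_of_pos hε, abs_le] at hv
      simp only [h1, h2]
      rcases hs with rfl | rfl
      · rw [uIcc_of_le (by linarith)]; exact ⟨by linarith, by linarith⟩
      · rw [uIcc_of_ge (by linarith)]; exact ⟨by linarith, by linarith⟩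
    rw [uIcc_of_le ho.lt.le] at ht
    refine ⟨⟨_, ho.mem t ht, rfl⟩, ?_⟩
    simp only
    rw [h.injOn.leftInvOn_invFunOn (ho.mem t ht)]
    exact hyU t ht
  refine ⟨hS, ?_⟩
  have hlt : ∀ t ∈ Ioo t₁ t₂, |σ (y t)| < ε := fun t ht => by
    have h3 := ho.lt_one t ht
    have h4 : 0 < g (y t) * (1 + B (y t)) * (ε ^ 2 - σ (y t) ^ 2) / (1 + ε ^ 2 * g (y t)) := by
      rw [← h.one_sub_pairCos]; linarith
    have h5 := pos_of_mul_pos_right ((div_pos_iff_of_pos_right (hk _)).1 h4) (hgB _).le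
    exact abs_lt_of_sq_lt_sq (by linarith) hε.le
  rw [← hxc, ← intervalIntegral.integral_const_mul]
  symm
  refine displacement_eq_integral (q := fun z => ε ^ 2 * q (ε, z))
    (r := fun z => γ * (1 + ε ^ 2 * g z) * √(m (ε, z)) / (ε ^ 2 * g z * (A z + B z)))
    hσ h.injOn hε ho.lt hs ho.continuous_x ho.continuous_y ho.mem hlt (fun t ht => ?_) (fun t ht => ?_)
    (fun v hv => ?_) h1 h2
  · refine (hy t ht).congr_deriv ?_
    have hmp := hmpos _ (hyU t (Ioo_subset_Icc_self ht))
    have h3 : 1 - pairCos A B g ε (y t) ^ 2 =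
        m (ε, y t) * (ε ^ 2 - σ (y t) ^ 2) / (1 + ε ^ 2 * g (y t)) ^ 2 := by
      rw [show 1 - pairCos A B g ε (y t) ^ 2 =
        (1 - pairCos A B g ε (y t)) * (1 + pairCos A B g ε (y t)) by ring, h.one_sub_pairCos,
        h.one_add_pairCos]
      simp only [hm]
      field_simp
    have h4 := (hk (y t)).ne'
    rw [h3, sqrt_div' _ (by positivity), sqrt_mul hmp.le, sqrt_sq (hk _).le, pairSpeed]
    field_simp
  · refine (ho.hasDerivAt_x t).congr_deriv ?_
    have hd := hden _ (hyU t (Ioo_subset_Icc_self ht))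
    have hd2 := (sqrt_pos.2 (hmpos _ (hyU t (Ioo_subset_Icc_self ht)))).ne'
    have hd3 := h.deriv_ne _ (ho.mem t (Ioo_subset_Icc_self ht))
    have h4 := (hk (y t)).ne'
    have h5 := (h.g_pos (y t)).ne'
    have h6 : A (y t) + B (y t) ≠ 0 := by linarith [h.one_le_A (y t), h.one_le_B (y t)]
    have h7 := hγ.ne'
    have h8 := hε.ne'
    simp only [hq]
    field_simp
  · have hv' : |v| ≤ |ε| := by rwa [abs_of_pos hε]
    obtain ⟨⟨z, hz, rfl⟩, hmem⟩ := hS v hv'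
    have hY := (analyticAt_invFunOn h.isOpen hσ h.deriv_ne h.injOn hz).continuousAt
    exact continuousAt_const.mul (ContinuousAt.comp
      (f := fun v => ((ε, Function.invFunOn σ N v) : ℝ × ℝ)) (hqan _ hmem).continuousAt
      (continuousAt_const.prodMk hY))

end IsOscillationFamily

end Oscillation

/-- In strip `k` the sign of `sin u` is `(-1)^k`, which turns `sin u` into `s √(1 - cos² u)`. The
sign `δ` is `1` for Type I and `-1` for Type II, where `pairCos = -cos u`. -/
theorem IsFlow.isHalfOscillation {W G u x y A B g σ : ℝ → ℝ} {X : ℝ × ℝ → ℝ} {N : Set ℝ}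
    {α β γ ε t₁ t₂ δ : ℝ} {k : ℤ} (hf : IsFlow W G u y) (hp : IsHalfPeriod u y α β k t₁ t₂)
    (hw : IsWindow W α β) (hy : ∀ t, y t ∈ Icc α β) (hε : 0 < ε) (hδ : δ ^ 2 = 1)
    (hcos : ∀ z, pairCos A B g ε z = δ * W z) (hspeed : ∀ z, pairSpeed γ A B g ε z = G z)
    (hα : W α = δ) (hβ : W β = δ) (hN : ∀ z ∈ Icc α β, z ∈ N) (hσα : σ α < 0) (hσβ : 0 < σ β)
    (hx : ∀ t, HasDerivAt x (X (ε, y t)) t) :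
    IsHalfOscillation γ A B g σ X N ε t₁ t₂ x y := by
  have hlt : ∀ t ∈ Ioo t₁ t₂, |δ * W (y t)| < 1 := fun t ht => by
    have h1 := neg_one_zpow_mul_sin_pos (hp.strip t ht)
    have h2 : sin (u t) ≠ 0 := right_ne_zero_of_mul h1.ne'
    rw [← sq_lt_one_iff_abs_lt_one, mul_pow, hδ, ← hf.curve]
    have := sin_sq_add_cos_sq (u t)
    have := sq_pos_of_ne_zero h2
    linarith
  have hend := ends_eq hp hα hβ
  refine ⟨hε, hp.lt, continuous_iff_continuousAt.2 fun t => (hx t).continuousAt,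
    hf.continuous_snd, fun t _ => hN _ (hy t), fun t ht => ?_, fun t ht => ?_, ?_, ?_, hx,
    (-1) ^ k, ?_, ?_⟩
  · rw [hcos]
    rcases ht.1.eq_or_lt with rfl | h1
    · rw [hend.1, ← sq, hδ]; norm_num
    rcases ht.2.eq_or_lt with rfl | h2
    · rw [hend.2, ← sq, hδ]; norm_num
    exact (abs_lt.1 (hlt t ⟨h1, h2⟩)).1
  · rw [hcos]; exact (abs_lt.1 (hlt t ht)).2
  · rw [hcos, hend.1, ← sq, hδ]
  · rw [hcos, hend.2, ← sq, hδ]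
  · rcases Int.even_or_odd k with h | h
    exacts [Or.inl h.neg_one_zpow, Or.inr h.neg_one_zpow]
  have hmono := hp.strictMonoOn (left_mem_Icc.2 hp.lt.le) (right_mem_Icc.2 hp.lt.le) hp.lt
  have hαβ := hw.lt
  refine ⟨?_, ?_, fun t ht => ?_⟩
  · rcases Int.even_or_odd k with h | h <;> rcases hp.ends with ⟨h1, h2⟩ | ⟨h1, h2⟩ <;>
      simp only [h.neg_one_zpow, h1, h2] at hmono ⊢ <;> linarith
  · rcases Int.even_or_odd k with h | h <;> rcases hp.ends with ⟨h1, h2⟩ | ⟨h1, h2⟩ <;>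
      simp only [h.neg_one_zpow, h1, h2] at hmono ⊢ <;> linarith
  · refine (hf.hasDerivAt_snd t).congr_deriv ?_
    have h1 := neg_one_zpow_mul_sin_pos (hp.strip t ht)
    rw [hspeed, hcos, mul_pow, hδ, one_mul, ← hf.curve, ← sin_sq, sqrt_sq_eq_abs,
      ← abs_neg_one_zpow_mul k, abs_of_pos h1, ← mul_assoc, neg_one_zpow_mul_self, one_mul]

/-! ### The two families of oscillations -/

section Instances

variable {Γ₁ Γ₂ C : ℝ}

/-- The coordinate of the oscillations about a point `(2kπ, C/(Γ₁ + Γ₂))`. -/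
def phaseEven (Γ₁ Γ₂ C y : ℝ) : ℝ :=
  sinh (halfDiff Γ₁ Γ₂ C y) / (cosh (halfSum Γ₁ Γ₂ C y) * √(selfFactor Γ₁ Γ₂ C y))

/-- The coordinate of the oscillations about a point `((2k+1)π, C/(Γ₁ - Γ₂))`. -/
def phaseOdd (Γ₁ Γ₂ C y : ℝ) : ℝ :=
  -(sinh (halfSum Γ₁ Γ₂ C y) * √(selfFactor Γ₁ Γ₂ C y)) / cosh (halfDiff Γ₁ Γ₂ C y)

theorem contDiff_halfDiff {n : WithTop ℕ∞} : ContDiff ℝ n (halfDiff Γ₁ Γ₂ C) :=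
  (contDiff_id.sub contDiff_height₂).div_const 2

theorem contDiff_halfSum {n : WithTop ℕ∞} : ContDiff ℝ n (halfSum Γ₁ Γ₂ C) :=
  (contDiff_id.add contDiff_height₂).div_const 2

theorem contDiff_phaseEven {n : WithTop ℕ∞} : ContDiff ℝ n (phaseEven Γ₁ Γ₂ C) :=
  contDiff_halfDiff.sinh.div
    (contDiff_halfSum.cosh.mul (contDiff_selfFactor.sqrt fun y => (selfFactor_pos y).ne'))
    fun y => (mul_pos (cosh_pos _) (sqrt_pos.2 (selfFactor_pos y))).ne'

theorem contDiff_phaseOdd {n : WithTop ℕ∞} : ContDiff ℝ n (phaseOdd Γ₁ Γ₂ C) :=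
  (contDiff_halfSum.sinh.mul (contDiff_selfFactor.sqrt fun y => (selfFactor_pos y).ne')).neg.div
    contDiff_halfDiff.cosh fun _ => (cosh_pos _).ne'

theorem hasDerivAt_sqrt_selfFactor (h₁ : Γ₁ ≠ 0) (h₂ : Γ₂ ≠ 0) (y : ℝ) :
    HasDerivAt (fun y => √(selfFactor Γ₁ Γ₂ C y)) (√(selfFactor Γ₁ Γ₂ C y) *
      ((sinh (y - height₂ Γ₁ Γ₂ C y) * (1 + Γ₁ / Γ₂) - sinh (y + height₂ Γ₁ Γ₂ C y) * (1 - Γ₁ / Γ₂)) /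
        (2 * (coshDiff Γ₁ Γ₂ C y + coshSum Γ₁ Γ₂ C y)))) y := by
  have hg := selfFactor_pos (Γ₁ := Γ₁) (Γ₂ := Γ₂) (C := C) y
  have hAB := (coshDiff_add_coshSum_pos (Γ₁ := Γ₁) (Γ₂ := Γ₂) (C := C) y).ne'
  refine ((hasDerivAt_selfFactor h₁ h₂ y).sqrt hg.ne').congr_deriv ?_
  rw [← selfFactor_logDeriv]
  have h1 := (sqrt_pos.2 hg).ne'
  have h2 := sq_sqrt hg.le
  field_simp
  rw [h2, mul_comm]

/-- Consequently `phaseEven` is a coordinate where `critEven > 0`, an interval that contains all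
windows of Type I. -/
theorem exists_hasDerivAt_phaseEven (h₁ : 0 < Γ₁) (h₂ : 0 < Γ₂) (y : ℝ) :
    ∃ c, 0 < c ∧ HasDerivAt (phaseEven Γ₁ Γ₂ C) (c * critEven Γ₁ Γ₂ C y) y := by
  have hg := sqrt_pos.2 (selfFactor_pos (Γ₁ := Γ₁) (Γ₂ := Γ₂) (C := C) y)
  have hAB := coshDiff_add_coshSum_pos (Γ₁ := Γ₁) (Γ₂ := Γ₂) (C := C) y
  have hc := cosh_pos (halfSum Γ₁ Γ₂ C y)
  refine ⟨1 / (Γ₂ * (coshDiff Γ₁ Γ₂ C y + coshSum Γ₁ Γ₂ C y) * cosh (halfSum Γ₁ Γ₂ C y) ^ 2 *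
    √(selfFactor Γ₁ Γ₂ C y)), by positivity, ?_⟩
  refine ((hasDerivAt_halfDiff y).sinh.div ((hasDerivAt_halfSum y).cosh.mul
    (hasDerivAt_sqrt_selfFactor h₁.ne' h₂.ne' y)) (mul_pos hc hg).ne').congr_deriv ?_
  have e1 := cosh_sq (halfDiff Γ₁ Γ₂ C y)
  have e2 := cosh_sq (halfSum Γ₁ Γ₂ C y)
  rw [critEven, sinh_sub_height₂, sinh_add_height₂]
  have hS : coshDiff Γ₁ Γ₂ C y + coshSum Γ₁ Γ₂ C y =
      2 * (sinh (halfDiff Γ₁ Γ₂ C y) ^ 2 + cosh (halfSum Γ₁ Γ₂ C y) ^ 2) := by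
    rw [coshDiff_eq, coshSum_eq, e2]; ring
  rw [hS] at hAB ⊢
  have hAB' := (pos_of_mul_pos_right hAB two_pos.le).ne'
  simp only [Pi.mul_apply]
  field_simp
  ring

theorem exists_hasDerivAt_phaseOdd (h₁ : 0 < Γ₁) (h₂ : 0 < Γ₂) (y : ℝ) :
    ∃ c, 0 < c ∧ HasDerivAt (phaseOdd Γ₁ Γ₂ C) (c * critOdd Γ₁ Γ₂ C y) y := by
  have hg := sqrt_pos.2 (selfFactor_pos (Γ₁ := Γ₁) (Γ₂ := Γ₂) (C := C) y)
  have hAB := coshDiff_add_coshSum_pos (Γ₁ := Γ₁) (Γ₂ := Γ₂) (C := C) y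
  have hc := cosh_pos (halfDiff Γ₁ Γ₂ C y)
  refine ⟨√(selfFactor Γ₁ Γ₂ C y) / (Γ₂ * (coshDiff Γ₁ Γ₂ C y + coshSum Γ₁ Γ₂ C y) *
    cosh (halfDiff Γ₁ Γ₂ C y) ^ 2), by positivity, ?_⟩
  refine ((((hasDerivAt_halfSum y).sinh.mul (hasDerivAt_sqrt_selfFactor h₁.ne' h₂.ne' y)).neg).div
    (hasDerivAt_halfDiff y).cosh hc.ne').congr_deriv ?_
  have e1 := cosh_sq (halfDiff Γ₁ Γ₂ C y)
  rw [critOdd, sinh_sub_height₂, sinh_add_height₂]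
  have hS : coshDiff Γ₁ Γ₂ C y + coshSum Γ₁ Γ₂ C y =
      2 * (cosh (halfDiff Γ₁ Γ₂ C y) ^ 2 + sinh (halfSum Γ₁ Γ₂ C y) ^ 2) := by
    rw [coshDiff_eq, coshSum_eq, e1]; ring
  rw [hS] at hAB ⊢
  have hAB' := (pos_of_mul_pos_right hAB two_pos.le).ne'
  simp only [Pi.neg_apply, Pi.mul_apply]
  field_simp
  ring

/-- The velocity of the centre of vorticity, on the level set with parameter `ε ^ 2`. -/
def centerDrift (Γ₁ Γ₂ C : ℝ) (z : ℝ × ℝ) : ℝ :=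
  1 / (4 * π) * (2 * Γ₁ * Γ₂ * (sinh (z.2 + height₂ Γ₁ Γ₂ C z.2) *
    (1 + z.1 ^ 2 * selfFactor Γ₁ Γ₂ C z.2) / (coshDiff Γ₁ Γ₂ C z.2 + coshSum Γ₁ Γ₂ C z.2)) +
    Γ₁ ^ 2 * tanh z.2 + Γ₂ ^ 2 * tanh (height₂ Γ₁ Γ₂ C z.2)) / (Γ₁ + Γ₂)

/-- The velocity of the centre of vorticity of the first vortex and the flipped second one, on the
level set with parameter `1 / ε ^ 2`. -/
def flippedCenterDrift (Γ₁ Γ₂ C : ℝ) (z : ℝ × ℝ) : ℝ :=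
  -(1 / (4 * π)) * (2 * Γ₁ * Γ₂ * (sinh (z.2 - height₂ Γ₁ Γ₂ C z.2) *
    (1 + z.1 ^ 2 * (selfFactor Γ₁ Γ₂ C z.2)⁻¹) / (coshDiff Γ₁ Γ₂ C z.2 + coshSum Γ₁ Γ₂ C z.2)) -
    Γ₁ ^ 2 * tanh z.2 + Γ₂ ^ 2 * tanh (height₂ Γ₁ Γ₂ C z.2)) / (Γ₁ - Γ₂)

theorem contDiff_tanh {n : WithTop ℕ∞} : ContDiff ℝ n tanh := by
  have : tanh = fun x => sinh x / cosh x := funext tanh_eq_sinh_div_cosh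
  rw [this]
  exact contDiff_sinh.div contDiff_cosh fun x => (cosh_pos x).ne'

theorem contDiff_centerDrift {n : WithTop ℕ∞} : ContDiff ℝ n (centerDrift Γ₁ Γ₂ C) := by
  have hf : ContDiff ℝ n (Prod.fst : ℝ × ℝ → ℝ) := contDiff_fst
  have hy : ContDiff ℝ n (Prod.snd : ℝ × ℝ → ℝ) := contDiff_snd
  have h2 := (contDiff_height₂ (Γ₁ := Γ₁) (Γ₂ := Γ₂) (C := C)).comp hy
  have hg := (contDiff_selfFactor (Γ₁ := Γ₁) (Γ₂ := Γ₂) (C := C)).comp hy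
  have hA := (contDiff_coshDiff (Γ₁ := Γ₁) (Γ₂ := Γ₂) (C := C)).comp hy
  have hB := (contDiff_coshSum (Γ₁ := Γ₁) (Γ₂ := Γ₂) (C := C)).comp hy
  exact (contDiff_const.mul (((contDiff_const.mul (((hy.add h2).sinh.mul
    (contDiff_const.add ((hf.pow 2).mul hg))).div (hA.add hB)
      fun z => (coshDiff_add_coshSum_pos z.2).ne')).add (contDiff_const.mul (contDiff_tanh.comp hy))).add
    (contDiff_const.mul (contDiff_tanh.comp h2)))).div_const _

theorem contDiff_flippedCenterDrift {n : WithTop ℕ∞} : ContDiff ℝ n (flippedCenterDrift Γ₁ Γ₂ C) := by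
  have hf : ContDiff ℝ n (Prod.fst : ℝ × ℝ → ℝ) := contDiff_fst
  have hy : ContDiff ℝ n (Prod.snd : ℝ × ℝ → ℝ) := contDiff_snd
  have h2 := (contDiff_height₂ (Γ₁ := Γ₁) (Γ₂ := Γ₂) (C := C)).comp hy
  have hg := (contDiff_selfFactor (Γ₁ := Γ₁) (Γ₂ := Γ₂) (C := C)).comp hy
  have hA := (contDiff_coshDiff (Γ₁ := Γ₁) (Γ₂ := Γ₂) (C := C)).comp hy
  have hB := (contDiff_coshSum (Γ₁ := Γ₁) (Γ₂ := Γ₂) (C := C)).comp hy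
  exact (contDiff_const.mul (((contDiff_const.mul (((hy.sub h2).sinh.mul
    (contDiff_const.add ((hf.pow 2).mul (hg.inv fun z => (selfFactor_pos z.2).ne')))).div (hA.add hB)
      fun z => (coshDiff_add_coshSum_pos z.2).ne')).sub (contDiff_const.mul (contDiff_tanh.comp hy))).add
    (contDiff_const.mul (contDiff_tanh.comp h2)))).div_const _

theorem tanh_eq_sinh_two_mul_div (y : ℝ) : tanh y = sinh (y + y) / (1 + cosh (y + y)) := by
  have h := cosh_pos y
  have h1 := cosh_two_mul y
  have h2 := cosh_sq y
  rw [← two_mul, sinh_two_mul, tanh_eq_sinh_div_cosh,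
    show 1 + cosh (2 * y) = 2 * cosh y ^ 2 by linarith]
  field_simp

/-- In the limit of amplitude `0` both vortices are at height `C/(Γ₁ + Γ₂)`, and the drift is `(Γ₁ +
Γ₂) tanh (C/(Γ₁ + Γ₂)) / (4π)`; it is nonzero because `C ≠ 0`. -/
theorem isOscillationFamily_even (h₂ : 0 < Γ₂) (h : Γ₂ < Γ₁) (hC : C ≠ 0) :
    IsOscillationFamily (coshDiff Γ₁ Γ₂ C) (coshSum Γ₁ Γ₂ C) (selfFactor Γ₁ Γ₂ C)
      (phaseEven Γ₁ Γ₂ C) (centerDrift Γ₁ Γ₂ C) {y | 0 < critEven Γ₁ Γ₂ C y} (C / (Γ₁ + Γ₂)) := by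
  have h₁ := h₂.trans h
  obtain ⟨a, b, ha, hb, ha0, hb0, h3, h4, h5⟩ := exists_critEven_sign h₂ h C
  have hN : {y | 0 < critEven Γ₁ Γ₂ C y} = Ioo a b := by
    ext y
    refine ⟨fun (hy : 0 < critEven Γ₁ Γ₂ C y) => ⟨?_, ?_⟩, h3 y⟩
    · by_contra! h6
      rcases h6.eq_or_lt with rfl | h6
      exacts [hy.ne' ha0, (h4 y h6).not_gt hy]
    · by_contra! h6
      rcases h6.eq_or_lt with rfl | h6
      exacts [hy.ne' hb0, (h5 y h6).not_gt hy]
  have hy₂ : height₂ Γ₁ Γ₂ C (C / (Γ₁ + Γ₂)) = C / (Γ₁ + Γ₂) := by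
    rw [height₂]; field_simp; ring
  rw [hN]
  refine ⟨isOpen_Ioo, fun y => contDiff_coshDiff.contDiffAt.analyticAt,
    fun y => contDiff_coshSum.contDiffAt.analyticAt,
    fun y => contDiff_selfFactor.contDiffAt.analyticAt,
    fun y => contDiff_phaseEven.contDiffAt.analyticAt,
    fun y => contDiff_centerDrift.contDiffAt.analyticAt, one_le_coshDiff, one_le_coshSum,
    selfFactor_pos, fun y => ?_, fun y hy => ?_, ?_, ⟨ha, hb⟩, ?_, ?_⟩
  · have hg := selfFactor_pos (Γ₁ := Γ₁) (Γ₂ := Γ₂) (C := C) y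
    have hc := (cosh_pos (halfSum Γ₁ Γ₂ C y)).ne'
    have e2 := cosh_sq (halfSum Γ₁ Γ₂ C y)
    rw [phaseEven, div_pow, mul_pow, sq_sqrt hg.le, coshDiff_eq, coshSum_eq,
      show 1 + (1 + 2 * sinh (halfSum Γ₁ Γ₂ C y) ^ 2) = 2 * cosh (halfSum Γ₁ Γ₂ C y) ^ 2 by
        rw [e2]; ring]
    field_simp
    ring
  · obtain ⟨c, hc, hd⟩ := exists_hasDerivAt_phaseEven (C := C) h₁ h₂ y
    rw [hd.deriv]
    exact (mul_pos hc (h3 y hy)).ne'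
  · refine (strictMonoOn_of_deriv_pos (convex_Ioo a b)
      (contDiff_phaseEven (n := 0)).continuous.continuousOn fun y hy => ?_).injOn
    obtain ⟨c, hc, hd⟩ := exists_hasDerivAt_phaseEven (C := C) h₁ h₂ y
    rw [hd.deriv]
    exact mul_pos hc (h3 y (interior_subset hy))
  · rw [phaseEven, halfDiff, hy₂]; simp
  · have ht : tanh (C / (Γ₁ + Γ₂)) ≠ 0 := by
      rw [← tanh_zero]; exact tanh_injective.ne (div_ne_zero hC (by linarith))
    have e1 := tanh_eq_sinh_two_mul_div (C / (Γ₁ + Γ₂))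
    have e2 : centerDrift Γ₁ Γ₂ C (0, C / (Γ₁ + Γ₂)) =
        (Γ₁ + Γ₂) * tanh (C / (Γ₁ + Γ₂)) / (4 * π) := by
      simp only [centerDrift, coshDiff, coshSum, hy₂, sub_self, cosh_zero]
      rw [zero_pow two_ne_zero, zero_mul, add_zero, mul_one, ← e1]
      field_simp
      ring
    rw [e2]
    have := pi_pos.ne'
    have : Γ₁ + Γ₂ ≠ 0 := by linarith
    positivity

/-- As `critOdd > 0` everywhere, `phaseOdd` is a global coordinate. The collision point has `y₂ =
-y₁`, and the limiting drift `(Γ₁ - Γ₂) tanh (C/(Γ₁ - Γ₂)) / (4π)` is nonzero because `C ≠ 0`. -/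
theorem isOscillationFamily_odd (hA : Admissible Γ₁ Γ₂ C) :
    IsOscillationFamily (coshSum Γ₁ Γ₂ C) (coshDiff Γ₁ Γ₂ C) (fun y => (selfFactor Γ₁ Γ₂ C y)⁻¹)
      (phaseOdd Γ₁ Γ₂ C) (flippedCenterDrift Γ₁ Γ₂ C) univ (C / (Γ₁ - Γ₂)) := by
  have h₂ := hA.pos
  have h := hA.lt
  have h₁ := h₂.trans h
  have hsub : Γ₁ - Γ₂ ≠ 0 := by linarith
  have hy₂ : height₂ Γ₁ Γ₂ C (C / (Γ₁ - Γ₂)) = -(C / (Γ₁ - Γ₂)) := by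
    rw [height₂]; field_simp; ring
  have hpos : ∀ y, 0 < deriv (phaseOdd Γ₁ Γ₂ C) y := fun y => by
    obtain ⟨c, hc, hd⟩ := exists_hasDerivAt_phaseOdd (C := C) h₁ h₂ y
    rw [hd.deriv]
    exact mul_pos hc (critOdd_pos hA y)
  refine ⟨isOpen_univ, fun y => contDiff_coshSum.contDiffAt.analyticAt,
    fun y => contDiff_coshDiff.contDiffAt.analyticAt,
    fun y => (contDiff_selfFactor.inv fun y => (selfFactor_pos y).ne').contDiffAt.analyticAt,
    fun y => contDiff_phaseOdd.contDiffAt.analyticAt,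
    fun y => contDiff_flippedCenterDrift.contDiffAt.analyticAt, one_le_coshSum, one_le_coshDiff,
    fun y => inv_pos.2 (selfFactor_pos y), fun y => ?_, fun y _ => (hpos y).ne',
    (strictMono_of_deriv_pos hpos).injective.injOn, mem_univ _, ?_, ?_⟩
  · have hg := selfFactor_pos (Γ₁ := Γ₁) (Γ₂ := Γ₂) (C := C) y
    have hc := (cosh_pos (halfDiff Γ₁ Γ₂ C y)).ne'
    have e2 := cosh_sq (halfDiff Γ₁ Γ₂ C y)
    rw [phaseOdd, div_pow, neg_sq, mul_pow, sq_sqrt hg.le, coshDiff_eq, coshSum_eq,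
      show 1 + (1 + 2 * sinh (halfDiff Γ₁ Γ₂ C y) ^ 2) = 2 * cosh (halfDiff Γ₁ Γ₂ C y) ^ 2 by
        rw [e2]; ring]
    field_simp
    ring
  · rw [phaseOdd, halfSum, hy₂]; simp
  · have ht : tanh (C / (Γ₁ - Γ₂)) ≠ 0 := by
      rw [← tanh_zero]; exact tanh_injective.ne (div_ne_zero hA.ne_zero hsub)
    have e1 := tanh_eq_sinh_two_mul_div (C / (Γ₁ - Γ₂))
    rw [add_comm (1 : ℝ)] at e1
    have e2 : flippedCenterDrift Γ₁ Γ₂ C (0, C / (Γ₁ - Γ₂)) =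
        (Γ₁ - Γ₂) * tanh (C / (Γ₁ - Γ₂)) / (4 * π) := by
      simp only [flippedCenterDrift, coshDiff, coshSum, hy₂, sub_neg_eq_add, add_neg_cancel, cosh_zero]
      rw [zero_pow two_ne_zero, zero_mul, add_zero, mul_one, ← e1, tanh_neg]
      field_simp
      ring
    rw [e2]
    have := pi_pos.ne'
    positivity

end Instances

/-! ### Periodic and driftless motions form a null set -/

section Drift

variable {Γ₁ Γ₂ C : ℝ}

theorem IsMotion.isHalfOscillation_even (hA : Admissible Γ₁ Γ₂ C) {s : ℝ → ℂ × ℂ}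
    (hs : IsMotion Γ₁ Γ₂ s) (hC : momentum Γ₁ Γ₂ (s 0) = C) (hI : IsTypeI Γ₁ Γ₂ C (reduce (s 0)))
    (hbad : IsPeriodicOnBand s ∨ ∃ (n : ℤ) (T : ℝ), TurnsAsPair s n T 0) :
    ∃ (r : ℚ) (t₁ t₂ : ℝ) (x y : ℝ → ℝ), IsHalfOscillation (Γ₂ / (4 * π)) (coshDiff Γ₁ Γ₂ C)
      (coshSum Γ₁ Γ₂ C) (selfFactor Γ₁ Γ₂ C) (phaseEven Γ₁ Γ₂ C) (centerDrift Γ₁ Γ₂ C)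
      {y | 0 < critEven Γ₁ Γ₂ C y} √(levelParam Γ₁ Γ₂ C (reduce (s 0))) t₁ t₂ x y ∧
      x t₂ - x t₁ = r * π := by
  have h₂ := hA.pos
  have h₁ := h₂.trans hA.lt
  have hp : IsRegular Γ₁ Γ₂ C (reduce (s 0)) := hI.choose_spec.1
  obtain ⟨α, β, hw, hX, hI', -, -, -⟩ := window_cases hA hp
  obtain ⟨hα, hβ⟩ := hI' hI
  obtain ⟨hy, k, t₁, t₂, hh⟩ := hs.exists_isHalfPeriod h₂ hA.lt hC hp.1 hw hX
  have hm := hs.isLevelMotion h₁.ne' h₂.ne' hC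
  have h12 := (hm.flow.levelCos_left hh).1 ((IsFlow.ends_eq hh hα hβ).1.trans
    (IsFlow.ends_eq hh hα hβ).2.symm)
  obtain ⟨hmem, hcrit⟩ := window_even h₂ hA.lt hm.pos hw hα hβ
  obtain ⟨r, hr⟩ := hm.exists_rat hh hbad
  set e := levelParam Γ₁ Γ₂ C (reduce (s 0)) with he
  have hsq : √e ^ 2 = e := sq_sqrt hm.pos.le
  have hden : ∀ y, 0 < cosh (halfSum Γ₁ Γ₂ C y) * √(selfFactor Γ₁ Γ₂ C y) := fun y =>
    mul_pos (cosh_pos _) (sqrt_pos.2 (selfFactor_pos y))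
  -- In the centre of vorticity the interaction term with `1/e` cancels, so its velocity stays
  -- analytic at amplitude `0`. Over the half period it is displaced like `x₁`, since `u` returns to
  -- its value.
  refine ⟨r, t₁, t₂, fun t => (Γ₁ * (s t).1.re + Γ₂ * (s t).2.re) / (Γ₁ + Γ₂), _,
    hm.flow.isHalfOscillation hh hw hy (sqrt_pos.2 hm.pos) (one_pow 2) (fun z => ?_) (fun z => ?_)
      hα hβ hcrit ?_ ?_ fun t => ?_, ?_⟩
  · rw [pairCos, hsq, one_mul, levelCos]
  · rw [pairSpeed, hsq, levelSpeed]
  · refine div_neg_of_neg_of_pos (sinh_neg_iff.2 ?_) (hden _)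
    rw [halfDiff_eq h₂.ne', div_lt_iff₀ (by linarith)]
    have := (lt_div_iff₀ (by linarith)).1 hmem.1
    linarith
  · exact div_pos (sinh_pos_iff.2 ((halfDiff_pos_iff h₂ h₁ β).2 hmem.2)) (hden _)
  · refine ((((hm.drift₁ t).const_mul Γ₁).add ((hm.drift₂ t).const_mul Γ₂)).div_const _).congr_deriv ?_
    rw [centerDrift]
    simp only [hsq]
    congr 1
    rw [levelDrift₁, levelDrift₂]
    ring
  · have : Γ₁ + Γ₂ ≠ 0 := by linarith
    rw [← hr, div_sub_div_same, div_eq_iff this]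
    linear_combination Γ₂ * h12

theorem IsMotion.isHalfOscillation_odd (hA : Admissible Γ₁ Γ₂ C) {s : ℝ → ℂ × ℂ}
    (hs : IsMotion Γ₁ Γ₂ s) (hC : momentum Γ₁ Γ₂ (s 0) = C) (hI : IsTypeII Γ₁ Γ₂ C (reduce (s 0)))
    (hbad : IsPeriodicOnBand s ∨ ∃ (n : ℤ) (T : ℝ), TurnsAsPair s n T 0) :
    ∃ (r : ℚ) (t₁ t₂ : ℝ) (x y : ℝ → ℝ), IsHalfOscillation (Γ₂ / (4 * π)) (coshSum Γ₁ Γ₂ C)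
      (coshDiff Γ₁ Γ₂ C) (fun y => (selfFactor Γ₁ Γ₂ C y)⁻¹) (phaseOdd Γ₁ Γ₂ C)
      (flippedCenterDrift Γ₁ Γ₂ C) univ √(levelParam Γ₁ Γ₂ C (reduce (s 0)))⁻¹ t₁ t₂ x y ∧
      x t₂ - x t₁ = r * π := by
  have h₂ := hA.pos
  have h₁ := h₂.trans hA.lt
  have hp : IsRegular Γ₁ Γ₂ C (reduce (s 0)) := hI.choose_spec.1
  obtain ⟨α, β, hw, hX, -, hI', -, -⟩ := window_cases hA hp
  obtain ⟨hα, hβ⟩ := hI' hI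
  obtain ⟨hy, k, t₁, t₂, hh⟩ := hs.exists_isHalfPeriod h₂ hA.lt hC hp.1 hw hX
  have hm := hs.isLevelMotion h₁.ne' h₂.ne' hC
  have h12 := (hm.flow.levelCos_left hh).1 ((IsFlow.ends_eq hh hα hβ).1.trans
    (IsFlow.ends_eq hh hα hβ).2.symm)
  have hmem := window_odd hA hm.pos hw hα hβ
  obtain ⟨r, hr⟩ := hm.exists_rat hh hbad
  have he := hm.pos
  set e := levelParam Γ₁ Γ₂ C (reduce (s 0))
  have hsq : √e⁻¹ ^ 2 = e⁻¹ := sq_sqrt (inv_pos.2 he).le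
  have hk := fun y => (one_add_mul_selfFactor_pos (Γ₁ := Γ₁) (Γ₂ := Γ₂) (C := C) he.le y).ne'
  have hk' : ∀ y, 1 + e⁻¹ * (selfFactor Γ₁ Γ₂ C y)⁻¹ =
      (1 + e * selfFactor Γ₁ Γ₂ C y) / (e * selfFactor Γ₁ Γ₂ C y) := fun y => by
    have := (selfFactor_pos (Γ₁ := Γ₁) (Γ₂ := Γ₂) (C := C) y).ne'
    field_simp
    ring
  -- With the flipped strength `-Γ₂` the other interaction term, the one unbounded as `e → ∞`,
  -- cancels.
  refine ⟨r, t₁, t₂, fun t => (Γ₁ * (s t).1.re - Γ₂ * (s t).2.re) / (Γ₁ - Γ₂), _,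
    hm.flow.isHalfOscillation hh hw hy (sqrt_pos.2 (inv_pos.2 he)) (neg_one_sq) (fun z => ?_)
      (fun z => ?_) hα hβ (fun _ _ => mem_univ _) ?_ ?_ fun t => ?_, ?_⟩
  · have hg := (selfFactor_pos (Γ₁ := Γ₁) (Γ₂ := Γ₂) (C := C) z).ne'
    have := hk z
    rw [pairCos, hsq, levelCos, hk']
    field_simp
    ring
  · have hg := (selfFactor_pos (Γ₁ := Γ₁) (Γ₂ := Γ₂) (C := C) z).ne'
    have hAB := (coshDiff_add_coshSum_pos (Γ₁ := Γ₁) (Γ₂ := Γ₂) (C := C) z).ne'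
    rw [pairSpeed, hsq, levelSpeed, hk', add_comm (coshSum Γ₁ Γ₂ C z)]
    field_simp
  · refine div_neg_of_neg_of_pos (neg_neg_of_pos (mul_pos (sinh_pos_iff.2 ?_)
      (sqrt_pos.2 (selfFactor_pos _)))) (cosh_pos _)
    rw [halfSum_eq h₂.ne', div_pos_iff_of_pos_right (by linarith)]
    have := (lt_div_iff₀ (by linarith [hA.lt])).1 hmem.1
    linarith
  · refine div_pos (neg_pos.2 (mul_neg_of_neg_of_pos (sinh_neg_iff.2 ?_)
      (sqrt_pos.2 (selfFactor_pos _)))) (cosh_pos _)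
    exact (halfSum_neg_iff h₂ hA.lt β).2 hmem.2
  · refine ((((hm.drift₁ t).const_mul Γ₁).sub ((hm.drift₂ t).const_mul Γ₂)).div_const _).congr_deriv ?_
    rw [flippedCenterDrift]
    simp only [hsq, hk']
    congr 1
    rw [levelDrift₁, levelDrift₂]
    have hg := (selfFactor_pos (Γ₁ := Γ₁) (Γ₂ := Γ₂) (C := C) (s t).1.im).ne'
    have hAB := (coshDiff_add_coshSum_pos (Γ₁ := Γ₁) (Γ₂ := Γ₂) (C := C) (s t).1.im).ne'
    field_simp
    ring
  · have : Γ₁ - Γ₂ ≠ 0 := by linarith [hA.lt]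
    rw [← hr, div_sub_div_same, div_eq_iff this]
    linear_combination -Γ₂ * h12

/-- The configurations of the first two types whose motion is periodic on the band or has no drift
form a null set. -/
theorem volume_periodic_or_driftless (hA : Admissible Γ₁ Γ₂ C) :
    MeasureTheory.volume {p : ℝ × ℝ | (IsTypeI Γ₁ Γ₂ C p ∨ IsTypeII Γ₁ Γ₂ C p) ∧
        ∃ s, IsMotion Γ₁ Γ₂ s ∧ momentum Γ₁ Γ₂ (s 0) = C ∧ reduce (s 0) = p ∧
          (IsPeriodicOnBand s ∨ ∃ (n : ℤ) (T : ℝ), TurnsAsPair s n T 0)} = 0 := by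
  have hγ : 0 < Γ₂ / (4 * π) := div_pos hA.pos (by positivity)
  have h1 := fun r : ℚ =>
    (isOscillationFamily_even hA.pos hA.lt hA.ne_zero).countable_setOf_displacement_eq hγ (r * π)
  have h2 := fun r : ℚ => (isOscillationFamily_odd hA).countable_setOf_displacement_eq hγ (r * π)
  have h3 := (countable_iUnion h1).image (fun ε => ε ^ 2)
  have h4 := (countable_iUnion h2).image (fun ε => (ε ^ 2)⁻¹)
  -- The bad points lie on the level curves of countably many parameters, `ε²` for Type I and `1/ε²`
  -- for Type II. Intersecting with `Ioi 0` keeps only parameters for which `levelCos` is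
  -- continuous.
  refine MeasureTheory.measure_mono_null ?_ ((MeasureTheory.measure_biUnion_null_iff
    ((h3.union h4).mono (inter_subset_left (t := Ioi 0)))).2 fun e he =>
      volume_cosCurve (contDiff_levelCos (Γ₁ := Γ₁) (Γ₂ := Γ₂) (C := C) (n := 0) he.2).continuous)
  rintro p ⟨hp, s, hs, hC, rfl, hbad⟩
  have hdom : reduce (s 0) ∈ reducedDomain Γ₁ Γ₂ C := by
    rcases hp with h | h
    exacts [h.choose_spec.1.1, h.choose_spec.1.1]
  have hpos := levelParam_pos hdom
  refine mem_biUnion ⟨?_, hpos⟩ (mem_cosCurve_self hdom)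
  rcases hp with h | h
  · obtain ⟨r, hr⟩ := hs.isHalfOscillation_even hA hC h hbad
    exact Or.inl ⟨_, mem_iUnion.2 ⟨r, hr⟩, sq_sqrt hpos.le⟩
  · obtain ⟨r, hr⟩ := hs.isHalfOscillation_odd hA hC h hbad
    exact Or.inr ⟨_, mem_iUnion.2 ⟨r, hr⟩, by
      show (√(levelParam Γ₁ Γ₂ C (reduce (s 0)))⁻¹ ^ 2)⁻¹ = _
      rw [sq_sqrt (inv_pos.2 hpos).le, inv_inv]⟩

end Drift

end MobiusVortex

end

theorem mainTheorem3 :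
    (∀ Γ₁ Γ₂ C : ℝ, Admissible Γ₁ Γ₂ C →
      -- global existence of the motions in question
      (∀ z₀ : ℂ × ℂ, momentum Γ₁ Γ₂ z₀ = C →
        IsTypeI Γ₁ Γ₂ C (reduce z₀) ∨ IsTypeII Γ₁ Γ₂ C (reduce z₀) ∨
          IsTypeIII Γ₁ Γ₂ C (reduce z₀) →
        ∃ s, IsMotion Γ₁ Γ₂ s ∧ s 0 = z₀) ∧
      -- Types I and II: rotation about each other and drift as a pair
      (∀ s, IsMotion Γ₁ Γ₂ s → momentum Γ₁ Γ₂ (s 0) = C →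
        (IsTypeI Γ₁ Γ₂ C (reduce (s 0)) →
          ∃ (k : ℤ) (T d : ℝ), TurnsAsPair s (2 * k) T d) ∧
        (IsTypeII Γ₁ Γ₂ C (reduce (s 0)) →
          ∃ (k : ℤ) (T d : ℝ), TurnsAsPair s (2 * k + 1) T d)) ∧
      -- Types I and II: periodic motions and motions without drift form a planar null set
      (MeasureTheory.volume {p : ℝ × ℝ | (IsTypeI Γ₁ Γ₂ C p ∨ IsTypeII Γ₁ Γ₂ C p) ∧
        ∃ s, IsMotion Γ₁ Γ₂ s ∧ momentum Γ₁ Γ₂ (s 0) = C ∧ reduce (s 0) = p ∧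
          (IsPeriodicOnBand s ∨ ∃ (n : ℤ) (T : ℝ), TurnsAsPair s n T 0)} = 0) ∧
      -- Type III: periodically varying separations without mutual rotation
      (∀ s, IsMotion Γ₁ Γ₂ s → momentum Γ₁ Γ₂ (s 0) = C →
        IsTypeIII Γ₁ Γ₂ C (reduce (s 0)) →
          (∃ T, IsSeparationPeriod s T) ∧
          (∃ t, (s t).1.im - (s t).2.im ≠ (s 0).1.im - (s 0).2.im) ∧
          NeverTurns s) ∧
      -- Type III: direction of the motion of vortices that are far apart
      (Γ₁ < 2 * Γ₂ → ∃ R : ℝ, ∀ s, IsMotion Γ₁ Γ₂ s → momentum Γ₁ Γ₂ (s 0) = C →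
        IsTypeIII Γ₁ Γ₂ C (reduce (s 0)) → R < |(s 0).1.im| → MoveSameDirection s) ∧
      (2 * Γ₂ < Γ₁ → ∃ R : ℝ, ∀ s, IsMotion Γ₁ Γ₂ s → momentum Γ₁ Γ₂ (s 0) = C →
        IsTypeIII Γ₁ Γ₂ C (reduce (s 0)) → R < |(s 0).1.im| → MoveOppositeDirections s)) ∧
    -- Type III: both cases occur
    (∃ Γ₁ Γ₂ C : ℝ, Admissible Γ₁ Γ₂ C ∧ ∃ s, IsMotion Γ₁ Γ₂ s ∧ momentum Γ₁ Γ₂ (s 0) = C ∧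
      IsTypeIII Γ₁ Γ₂ C (reduce (s 0)) ∧ MoveSameDirection s) ∧
    (∃ Γ₁ Γ₂ C : ℝ, Admissible Γ₁ Γ₂ C ∧ ∃ s, IsMotion Γ₁ Γ₂ s ∧ momentum Γ₁ Γ₂ (s 0) = C ∧
      IsTypeIII Γ₁ Γ₂ C (reduce (s 0)) ∧ MoveOppositeDirections s) := by
  refine ⟨fun Γ₁ Γ₂ C hA => ⟨?_, ?_, ?_, ?_, exists_moveSameDirection hA,
    exists_moveOppositeDirections hA⟩, ?_, ?_⟩
  · intro z₀ hC hz
    refine exists_isMotion_of_isRegular hA.pos hA.lt hC ?_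
    rcases hz with ⟨_, h⟩ | ⟨_, h⟩ | h
    exacts [h.1, h.1, h.1]
  · exact fun s hs hC => ⟨hs.turnsAsPair_even hA hC, hs.turnsAsPair_odd hA hC⟩
  · exact volume_periodic_or_driftless hA
  · intro s hs hC hI
    exact ⟨hs.isSeparationPeriod hA hC hI, hs.exists_separation_ne hA hC hI⟩
  · obtain ⟨R, hR⟩ := exists_moveSameDirection admissible_five_three (by norm_num)
    obtain ⟨s, hs, hC, hI, hs0⟩ := exists_isTypeIII admissible_five_three R
    exact ⟨5, 3, 1, admissible_five_three, s, hs, hC, hI, hR s hs hC hI hs0⟩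
  · obtain ⟨R, hR⟩ := exists_moveOppositeDirections admissible_three_one (by norm_num)
    obtain ⟨s, hs, hC, hI, hs0⟩ := exists_isTypeIII admissible_three_one R
    exact ⟨3, 1, 1, admissible_three_one, s, hs, hC, hI, hR s hs hC hI hs0⟩
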